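/- A graph is a cluster graph if each of its connected components is a clique. A cluster vertex deletion of a finite simple graph $G=(V,E)$ is a set $S\subseteq V$ such that $G[V\setminus S]$ is a cluster graph; let $k=k(G)$ be the minimum size of a cluster vertex deletion of $G$. A kernel of $G$ for Cluster Vertex Deletion is an induced subgraph $G'=G[V']$ together with a set $X_0\subseteq V\setminus V'$ such that (i) for every minimum cluster vertex deletion $S$ of $G'$ the set $X_0\cup S$ is a minimum cluster vertex deletion of $G$, and (ii) for every integer $b\ge 0$, $G$ has a cluster vertex deletion of size at most $b$ if and only if $|X_0|\le b$ and $G'$ has a cluster vertex deletion of size at most $b-|X_0|$. **Corollary (quasilinear-time kernelization for Cluster Vertex Deletion).** There is an algorithm which, given a finite simple graph $G=(V,E)$ with $V=\{0,\dots,n-1\}$ by $n$, $|E|$ and a list of its edges in arbitrary order, computes a kernel $(G',X_0)$ of $G$ with $$|V(G')|+|E(G')| = O(k^5)$$ in time $$O\bigl((k+1)^8\,(|E|+1)\,\log(|V|+2)\bigr)$$ (that is, in time $O(k^8|E|\log|V|)$ when $k\ge1$, $|E|\ge 1$ and $|V|\ge 2$). The value of $k$ is not part of the input, and the constants are absolute.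 Here $G'$ is output as a graph on $\{0,\dots,|V'|-1\}$ by a list of its edges, together with the list of the original names of its vertices and a list of $X_0$. The algorithm is one fixed program of a unit-cost random access machine with words of $O(\log(|V|+2))$ bits, with memory initially zero outside the input, that adds, subtracts, multiplies, divides and compares words and reads and writes indirectly addressed memory. -/

import Mathlib

namespace CVD

section Graphs

variable {V W : Type*}

/-- A cluster graph: every connected component is a clique. -/
def IsClusterGraph (G : SimpleGraph V) : Prop :=
  ∀ c : G.ConnectedComponent, G.IsClique c.supp

/-- `S` is a cluster vertex deletion of `G`: removing `S` leaves a cluster graph. -/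
def IsClusterVertexDeletion (G : SimpleGraph V) (S : Finset V) : Prop :=
  IsClusterGraph (G.induce {v | v ∉ S})

/-- `S` is a cluster vertex deletion of `G` of minimum size. -/
def IsMinClusterVertexDeletion (G : SimpleGraph V) (S : Finset V) : Prop :=
  IsClusterVertexDeletion G S ∧
    ∀ T : Finset V, IsClusterVertexDeletion G T → S.card ≤ T.card

/-- The cluster vertex deletion number: the size of a minimum cluster vertex deletion. -/
noncomputable def cvdNumber (G : SimpleGraph V) : ℕ :=
  sInf {k | ∃ S : Finset V, IsClusterVertexDeletion G S ∧ S.card = k}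

/-- The induced subgraph `H` of `G` (embedded by `φ`), together with a set `X` of vertices of `G`
outside `H` that are put into the solution, is a problem kernel of `G` for Cluster Vertex Deletion:
minimum solutions of `H` extend by `X` to minimum solutions of `G`, and, for every budget `b`, the
instances `(G, b)` and `(H, b - |X|)` are equivalent (`(G, b)` being a no-instance if `b < |X|`). -/
structure IsKernel [DecidableEq V] (G : SimpleGraph V) (H : SimpleGraph W) (φ : H ↪g G)
    (X : Finset V) : Prop where
  disjoint : ∀ w, φ w ∉ X
  lift : ∀ S : Finset W, IsMinClusterVertexDeletion H S →
    IsMinClusterVertexDeletion G (X ∪ S.map φ.toEmbedding)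
  equivalent : ∀ b : ℕ,
    (∃ T : Finset V, IsClusterVertexDeletion G T ∧ T.card ≤ b) ↔
      X.card ≤ b ∧ ∃ S : Finset W, IsClusterVertexDeletion H S ∧ S.card ≤ b - X.card

/-- `e` lists the edges of `G`, each exactly once, in some order and with some orientation. -/
def IsEdgeListing {n m : ℕ} (G : SimpleGraph (Fin n)) (e : Fin m → Fin n × Fin n) : Prop :=
  Function.Injective (fun i => s((e i).1, (e i).2)) ∧
    Set.range (fun i => s((e i).1, (e i).2)) = G.edgeSet

end Graphs

section Machine

/-- A configuration of a random access machine: registers, and memory arrays with random access.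
A program mentions only finitely many registers and finitely many arrays. -/
structure State where
  reg : ℕ → ℕ
  mem : ℕ → ℕ → ℕ

/-- Write `v` into register `x`. -/
def State.setReg (s : State) (x v : ℕ) : State :=
  { s with reg := Function.update s.reg x v }

/-- Write `v` into cell `i` of array `a`. -/
def State.setMem (s : State) (a i v : ℕ) : State :=
  { s with mem := Function.update s.mem a (Function.update (s.mem a) i v) }

/-- Arithmetic instructions (subtraction is truncated, division rounds down). -/
inductive Op where
  | add | sub | mul | div

/-- The value of an arithmetic instruction. -/
def Op.eval : Op → ℕ → ℕ → ℕ
  | .add, a, b => a + b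
  | .sub, a, b => a - b
  | .mul, a, b => a * b
  | .div, a, b => a / b

/-- Programs of the random access machine. Below, `r x` is the content of register `x`. -/
inductive Cmd where
  /-- do nothing -/
  | skip
  /-- `r x := c` -/
  | const (x c : ℕ)
  /-- `r x := r y` -/
  | copy (x y : ℕ)
  /-- `r x := r y o r z` -/
  | arith (o : Op) (x y z : ℕ)
  /-- `r x :=` cell `r i` of array `a` -/
  | load (x a i : ℕ)
  /-- cell `r i` of array `a` `:= r x` -/
  | store (a i x : ℕ)
  /-- first `c`, then `d` -/
  | seq (c d : Cmd)
  /-- if `r x < r y` then `c` else `d` -/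
  | ifLt (x y : ℕ) (c d : Cmd)
  /-- while `r x < r y` do `c` -/
  | whileLt (x y : ℕ) (c : Cmd)

/-- `Exec B c s t s'`: started in `s`, the program `c` halts in `s'` after exactly `t` steps on the
machine whose words hold the numbers `0, …, B`. Every instruction and every test costs one step. If
a number that does not fit into a word arises, the machine is stuck and there is no halting run. -/
inductive Exec (B : ℕ) : Cmd → State → ℕ → State → Prop where
  | skip (s : State) : Exec B .skip s 1 s
  | const (s : State) (x c : ℕ) (h : c ≤ B) : Exec B (.const x c) s 1 (s.setReg x c)
  | copy (s : State) (x y : ℕ) (h : s.reg y ≤ B) :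
      Exec B (.copy x y) s 1 (s.setReg x (s.reg y))
  | arith (s : State) (o : Op) (x y z : ℕ) (h : o.eval (s.reg y) (s.reg z) ≤ B) :
      Exec B (.arith o x y z) s 1 (s.setReg x (o.eval (s.reg y) (s.reg z)))
  | load (s : State) (x a i : ℕ) (hi : s.reg i ≤ B) (h : s.mem a (s.reg i) ≤ B) :
      Exec B (.load x a i) s 1 (s.setReg x (s.mem a (s.reg i)))
  | store (s : State) (a i x : ℕ) (hi : s.reg i ≤ B) (h : s.reg x ≤ B) :
      Exec B (.store a i x) s 1 (s.setMem a (s.reg i) (s.reg x))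
  | seq {c d : Cmd} {s s' s'' : State} {t t' : ℕ} (h : Exec B c s t s') (h' : Exec B d s' t' s'') :
      Exec B (.seq c d) s (t + t') s''
  | ifTrue {x y : ℕ} {c d : Cmd} {s s' : State} {t : ℕ} (hxy : s.reg x < s.reg y)
      (h : Exec B c s t s') : Exec B (.ifLt x y c d) s (t + 1) s'
  | ifFalse {x y : ℕ} {c d : Cmd} {s s' : State} {t : ℕ} (hxy : ¬ s.reg x < s.reg y)
      (h : Exec B d s t s') : Exec B (.ifLt x y c d) s (t + 1) s'
  | whileTrue {x y : ℕ} {c : Cmd} {s s' s'' : State} {t t' : ℕ} (hxy : s.reg x < s.reg y)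
      (h : Exec B c s t s') (h' : Exec B (.whileLt x y c) s' t' s'') :
      Exec B (.whileLt x y c) s (t + t' + 1) s''
  | whileFalse {x y : ℕ} {c : Cmd} {s : State} (hxy : ¬ s.reg x < s.reg y) :
      Exec B (.whileLt x y c) s 1 s

/-- The initial configuration on a graph with vertices `0, …, n - 1` and edges listed by `e`:
register 0 holds `n`, register 1 holds the number `m` of edges, the ends of the `i`-th edge are in
the `i`-th cells of the arrays 0 and 1, and everything else is zero. -/
def inputState {n m : ℕ} (e : Fin m → Fin n × Fin n) : State where
  reg := fun x => if x = 0 then n else if x = 1 then m else 0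
  mem := fun a i => if h : i < m then
      if a = 0 then (e ⟨i, h⟩).1 else if a = 1 then (e ⟨i, h⟩).2 else 0
    else 0

/-- The final configuration `s` contains the graph with vertices `0, …, p - 1` and edges listed by
`f` (in the same format as an input), the name `φ j` in the input graph of each vertex `j` (array 2),
and the list `x` of `r` vertices of the input graph (length in register 2, list in array 3). -/
structure IsOutput {n p q r : ℕ} (s : State) (f : Fin q → Fin p × Fin p) (φ : Fin p → Fin n)
    (x : Fin r → Fin n) : Prop where
  numVertices : s.reg 0 = p
  numEdges : s.reg 1 = q
  edges : ∀ i : Fin q, s.mem 0 i = (f i).1 ∧ s.mem 1 i = (f i).2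
  names : ∀ j : Fin p, s.mem 2 j = φ j
  numForced : s.reg 2 = r
  forced : ∀ i : Fin r, s.mem 3 i = x i

end Machine

end CVD

namespace CVD

section Language

/-! ### A language of bounded loops

Programs all of whose loops have a bound fixed in advance denote total functions on states. Since
their instructions increase the largest number stored by at most one per step, they never leave
the word range when the time is small compared to the largest word. -/

/-! A graph is a cluster graph exactly if it has no induced path on three vertices, so a cluster
vertex deletion is a set that meets all these paths. A maximal family of vertex-disjoint induced
paths has at most k members. The set S of their vertices therefore has at most 3k elements. It meets
every induced path, so k ≤ |S|, and G - S is a disjoint union of cliques.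

For each v in S, up to 2|S|+2 cliques containing neighbours of v are selected, and in each of them
up to |S|+1 neighbours and up to |S|+1 non-neighbours of v are marked. The kernel is induced by S
and the marked vertices, and no vertex is forced into the solution. Let T be a solution of the
kernel with |T| ≤ k ≤ |S|. If v has marked neighbours in very many cliques, two of them survive T
and form an induced path through v, so v lies in T. Otherwise every clique that meets the
neighbourhood of v was treated, and each of its vertices outside T has a marked substitute outside T
with the same adjacency to v. An induced path of G missed by T could then be moved into the kernel
(`hits_of_represented`). By `isKernel_of_solutions_extend` this suffices. There are O(|S|^3) marked
vertices and O(|S|^2) in each clique, which gives O(k^5) edges (`ncard_edgeSet_le`).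

A further path is found in linear time by comparing, along each edge of the remaining graph, the
smallest closed neighbours and the degrees of its ends. A difference yields a private neighbour and
hence a path (`exists_private_neighbour`). If there is none, the remaining graph is a cluster graph
and the smallest closed neighbours name its cliques (`namesCliques_of_no_mismatch`). With at most
k+1 searches and one linear pass for each vertex of S, the total time is O((k+1)(m+1)), well within
the claim.

The algorithm is written in a language of bounded loops, where loop invariants (`for_rule_time`) and
static cost bounds (`time_le_cost`) are available, and is transferred to the machine by `Prog.exec`.
-/

@[simp] theorem State.reg_setReg (s : State) (x v y : ℕ) :
    (s.setReg x v).reg y = if y = x then v else s.reg y := by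
  simp [State.setReg, Function.update_apply]

@[simp] theorem State.mem_setReg (s : State) (x v : ℕ) : (s.setReg x v).mem = s.mem := rfl

@[simp] theorem State.reg_setMem (s : State) (a i v : ℕ) : (s.setMem a i v).reg = s.reg := rfl

@[simp] theorem State.mem_setMem (s : State) (a i v b : ℕ) :
    (s.setMem a i v).mem b = if b = a then Function.update (s.mem a) i v else s.mem b := by
  simp [State.setMem, Function.update_apply]

/-- Programs with bounded loops. Register 99 is reserved for the constant one. -/
inductive Prog where
  | skip
  | const (x c : ℕ)
  | copy (x y : ℕ)
  | inc (x : ℕ)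
  | dec (x : ℕ)
  | load (x a i : ℕ)
  | store (a i x : ℕ)
  | seq (c d : Prog)
  | ifLt (x y : ℕ) (c d : Prog)
  | ifEq (x y : ℕ) (c d : Prog)
  | forLt (i n : ℕ) (c : Prog)

infixr:60 " ;; " => Prog.seq

namespace Prog

/-- The machine program of a bounded-loop program. -/
def compile : Prog → Cmd
  | skip => .skip
  | const x c => .const x c
  | copy x y => .copy x y
  | inc x => .seq (.const 99 1) (.arith .add x x 99)
  | dec x => .seq (.const 99 1) (.arith .sub x x 99)
  | load x a i => .load x a i
  | store a i x => .store a i x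
  | seq c d => .seq c.compile d.compile
  | ifLt x y c d => .ifLt x y c.compile d.compile
  | ifEq x y c d => .ifLt x y d.compile (.ifLt y x d.compile c.compile)
  | forLt i n c => .seq (.const i 0)
      (.whileLt i n (.seq c.compile (.seq (.const 99 1) (.arith .add i i 99))))

/-- Add one to a register, by way of register 99. -/
def incr (s : State) (x : ℕ) : State :=
  (s.setReg 99 1).setReg x ((s.setReg 99 1).reg x + 1)

/-- Subtract one from a register, by way of register 99. -/
def decr (s : State) (x : ℕ) : State :=
  (s.setReg 99 1).setReg x ((s.setReg 99 1).reg x - 1)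

/-- The state reached by a bounded-loop program. -/
def run : Prog → State → State
  | skip, s => s
  | const x c, s => s.setReg x c
  | copy x y, s => s.setReg x (s.reg y)
  | inc x, s => incr s x
  | dec x, s => decr s x
  | load x a i, s => s.setReg x (s.mem a (s.reg i))
  | store a i x, s => s.setMem a (s.reg i) (s.reg x)
  | seq c d, s => d.run (c.run s)
  | ifLt x y c d, s => if s.reg x < s.reg y then c.run s else d.run s
  | ifEq x y c d, s => if s.reg x = s.reg y then c.run s else d.run s
  | forLt i n c, s =>
      Nat.rec (motive := fun _ => State) (s.setReg i 0) (fun _ s' => incr (c.run s') i) (s.reg n)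

/-- The state of a loop with counter `i` and body `c` after `j` rounds. -/
def loopState (i : ℕ) (c : Prog) (s : State) (j : ℕ) : State :=
  Nat.rec (motive := fun _ => State) (s.setReg i 0) (fun _ s' => incr (c.run s') i) j

/-- The number of steps of a bounded-loop program. -/
def time : Prog → State → ℕ
  | skip, _ => 1
  | const _ _, _ => 1
  | copy _ _, _ => 1
  | inc _, _ => 2
  | dec _, _ => 2
  | load _ _ _, _ => 1
  | store _ _ _, _ => 1
  | seq c d, s => c.time s + d.time (c.run s)
  | ifLt x y c d, s => (if s.reg x < s.reg y then c.time s else d.time s) + 1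
  | ifEq x y c d, s => if s.reg x < s.reg y then d.time s + 1 else
      (if s.reg y < s.reg x then d.time s else c.time s) + 1 + 1
  | forLt i n c, s => (∑ j ∈ Finset.range (s.reg n), (c.time (loopState i c s j) + 3)) + 2

/-- The registers a program may write. -/
def wreg : Prog → List ℕ
  | skip => []
  | const x _ => [x]
  | copy x _ => [x]
  | inc x => [99, x]
  | dec x => [99, x]
  | load x _ _ => [x]
  | store _ _ _ => []
  | seq c d => c.wreg ++ d.wreg
  | ifLt _ _ c d => c.wreg ++ d.wreg
  | ifEq _ _ c d => c.wreg ++ d.wreg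
  | forLt i _ c => 99 :: i :: c.wreg

/-- The arrays a program may write. -/
def wmem : Prog → List ℕ
  | store a _ _ => [a]
  | seq c d => c.wmem ++ d.wmem
  | ifLt _ _ c d => c.wmem ++ d.wmem
  | ifEq _ _ c d => c.wmem ++ d.wmem
  | forLt _ _ c => c.wmem
  | _ => []

/-- Loop counters and bounds are not written by the loop body, and constants are at most one. -/
def wf : Prog → Prop
  | const _ c => c ≤ 1
  | seq c d => c.wf ∧ d.wf
  | ifLt _ _ c d => c.wf ∧ d.wf
  | ifEq _ _ c d => c.wf ∧ d.wf
  | forLt i n c => c.wf ∧ i ∉ c.wreg ∧ n ∉ c.wreg ∧ i ≠ n ∧ i ≠ 99 ∧ n ≠ 99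
  | _ => True

/-- The registers that bound a loop. -/
def limits : Prog → List ℕ
  | seq c d => c.limits ++ d.limits
  | ifLt _ _ c d => c.limits ++ d.limits
  | ifEq _ _ c d => c.limits ++ d.limits
  | forLt _ n c => n :: c.limits
  | _ => []

/-- An upper bound for the time, given the loop bounds. -/
def cost (L : ℕ → ℕ) : Prog → ℕ
  | inc _ => 2
  | dec _ => 2
  | seq c d => c.cost L + d.cost L
  | ifLt _ _ c d => c.cost L + d.cost L + 1
  | ifEq _ _ c d => c.cost L + d.cost L + 2
  | forLt _ n c => L n * (c.cost L + 3) + 2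
  | _ => 1

theorem incr_reg (s : State) (x y : ℕ) (hx : x ≠ 99) : (incr s x).reg y =
    if y = x then s.reg x + 1 else if y = 99 then 1 else s.reg y := by
  simp [incr, hx]

@[simp] theorem incr_mem (s : State) (x : ℕ) : (incr s x).mem = s.mem := rfl

theorem loopState_succ (i : ℕ) (c : Prog) (s : State) (j : ℕ) :
    loopState i c s (j + 1) = incr (c.run (loopState i c s j)) i := rfl

theorem run_forLt (i n : ℕ) (c : Prog) (s : State) :
    (forLt i n c).run s = loopState i c s (s.reg n) := rfl

theorem run_reg (p : Prog) (s : State) (r : ℕ) (hr : r ∉ p.wreg) : (p.run s).reg r = s.reg r := by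
  induction p generalizing s with
  | forLt i n c ih =>
    simp only [wreg, List.mem_cons, not_or] at hr
    have : ∀ j, (loopState i c s j).reg r = s.reg r := by
      intro j
      induction j with
      | zero => simp [loopState, hr]
      | succ j hj => rw [loopState_succ]; simp [incr, hr, ih _ hr.2.2, hj]
    exact this _
  | ifLt x y c d ihc ihd =>
    simp only [wreg, List.mem_append, not_or] at hr
    simp only [run]; split_ifs
    · exact ihc _ hr.1
    · exact ihd _ hr.2
  | ifEq x y c d ihc ihd =>
    simp only [wreg, List.mem_append, not_or] at hr
    simp only [run]; split_ifs
    · exact ihc _ hr.1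
    · exact ihd _ hr.2
  | seq c d ihc ihd =>
    simp only [wreg, List.mem_append, not_or] at hr
    simp only [run]; rw [ihd _ hr.2, ihc _ hr.1]
  | _ => simp_all [wreg, run, incr, decr]

theorem run_mem (p : Prog) (s : State) (a : ℕ) (ha : a ∉ p.wmem) : (p.run s).mem a = s.mem a := by
  induction p generalizing s with
  | forLt i n c ih =>
    simp only [wmem] at ha
    have : ∀ j, (loopState i c s j).mem a = s.mem a := by
      intro j
      induction j with
      | zero => simp [loopState]
      | succ j hj => rw [loopState_succ]; simp [ih _ ha, hj]
    exact this _
  | ifLt x y c d ihc ihd =>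
    simp only [wmem, List.mem_append, not_or] at ha
    simp only [run]; split_ifs
    · exact ihc _ ha.1
    · exact ihd _ ha.2
  | ifEq x y c d ihc ihd =>
    simp only [wmem, List.mem_append, not_or] at ha
    simp only [run]; split_ifs
    · exact ihc _ ha.1
    · exact ihd _ ha.2
  | seq c d ihc ihd =>
    simp only [wmem, List.mem_append, not_or] at ha
    simp only [run]; rw [ihd _ ha.2, ihc _ ha.1]
  | _ => simp_all [wmem, run, incr, decr]

/-- Well-formedness keeps the body away from the counter and the bound. This is what makes the
machine's `whileLt` agree with iteration a fixed number of times. -/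
theorem loopState_reg {i n : ℕ} {c : Prog} (hwf : (forLt i n c).wf) (s : State) (j : ℕ) :
    (loopState i c s j).reg i = j ∧ (loopState i c s j).reg n = s.reg n := by
  obtain ⟨-, hi, hn, hin, hi9, hn9⟩ := hwf
  induction j with
  | zero => simp [loopState, hin.symm]
  | succ j ih =>
    rw [loopState_succ]
    simp [incr_reg _ _ _ hi9, hin.symm, hn9, run_reg _ _ _ hi, run_reg _ _ _ hn, ih]

theorem loopState_frame (i : ℕ) (n : ℕ) (c : Prog) (s : State) (j : ℕ) :
    (∀ r ∉ (forLt i n c).wreg, (loopState i c s j).reg r = s.reg r) ∧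
      ∀ a ∉ c.wmem, (loopState i c s j).mem a = s.mem a := by
  constructor
  · intro r hr
    simp only [wreg, List.mem_cons, not_or] at hr
    induction j with
    | zero => simp [loopState, hr]
    | succ j hj => rw [loopState_succ]; simp [incr, hr, run_reg _ _ _ hr.2.2, hj]
  · intro a ha
    induction j with
    | zero => simp [loopState]
    | succ j hj => rw [loopState_succ]; simp [run_mem _ _ _ ha, hj]

/-- Loop invariants with a record of the time. -/
theorem for_rule_time {i n : ℕ} {c : Prog} (hwf : (forLt i n c).wf) (s : State)
    (I : ℕ → State → ℕ → Prop) (h0 : I 0 (s.setReg i 0) 0)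
    (hstep : ∀ j < s.reg n, ∀ s' τ, s'.reg i = j →
      (∀ r ∉ (forLt i n c).wreg, s'.reg r = s.reg r) → (∀ a ∉ c.wmem, s'.mem a = s.mem a) →
      I j s' τ → I (j + 1) (incr (c.run s') i) (τ + (c.time s' + 3))) :
    ∃ τ, (forLt i n c).time s = τ + 2 ∧ I (s.reg n) ((forLt i n c).run s) τ := by
  refine ⟨_, rfl, ?_⟩
  rw [run_forLt]
  suffices h : ∀ j ≤ s.reg n, I j (loopState i c s j)
      (∑ j ∈ Finset.range j, (c.time (loopState i c s j) + 3)) from h _ le_rfl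
  intro j hj
  induction j with
  | zero => simpa [loopState] using h0
  | succ j ih =>
    rw [Finset.sum_range_succ, loopState_succ]
    exact hstep j hj _ _ (loopState_reg hwf s j).1 (loopState_frame i n c s j).1
      (loopState_frame i n c s j).2 (ih (by omega))

/-- Loop invariants. -/
theorem for_rule {i n : ℕ} {c : Prog} (hwf : (forLt i n c).wf) (s : State)
    (I : ℕ → State → Prop) (h0 : I 0 (s.setReg i 0))
    (hstep : ∀ j < s.reg n, ∀ s', s'.reg i = j →
      (∀ r ∉ (forLt i n c).wreg, s'.reg r = s.reg r) → (∀ a ∉ c.wmem, s'.mem a = s.mem a) →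
      I j s' → I (j + 1) (incr (c.run s') i)) :
    I (s.reg n) ((forLt i n c).run s) := by
  obtain ⟨_, _, h⟩ := for_rule_time hwf s (fun j s _ => I j s) h0
    (fun j hj s' _ h1 h2 h3 h4 => hstep j hj s' h1 h2 h3 h4)
  exact h

/-- Registers bounding loops are never written, so their initial values `L` are valid at every inner
loop and the cost depends on the program text and `L` only. -/
theorem time_le_cost (p : Prog) (s : State) (L : ℕ → ℕ) (hL : ∀ r ∈ p.limits, s.reg r = L r)
    (hw : ∀ r ∈ p.limits, r ∉ p.wreg) : p.time s ≤ p.cost L := by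
  induction p generalizing s with
  | seq c d ihc ihd =>
    simp only [limits, wreg, List.mem_append, not_or] at hL hw
    have h1 := ihc s (fun r hr => hL r (.inl hr)) (fun r hr => (hw r (.inl hr)).1)
    have h2 := ihd (c.run s)
      (fun r hr => by rw [run_reg _ _ _ (hw r (.inr hr)).1]; exact hL r (.inr hr))
      (fun r hr => (hw r (.inr hr)).2)
    simp only [time, cost]; omega
  | ifLt x y c d ihc ihd =>
    simp only [limits, wreg, List.mem_append, not_or] at hL hw
    have h1 := ihc s (fun r hr => hL r (.inl hr)) (fun r hr => (hw r (.inl hr)).1)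
    have h2 := ihd s (fun r hr => hL r (.inr hr)) (fun r hr => (hw r (.inr hr)).2)
    simp only [time, cost]; split_ifs <;> omega
  | ifEq x y c d ihc ihd =>
    simp only [limits, wreg, List.mem_append, not_or] at hL hw
    have h1 := ihc s (fun r hr => hL r (.inl hr)) (fun r hr => (hw r (.inl hr)).1)
    have h2 := ihd s (fun r hr => hL r (.inr hr)) (fun r hr => (hw r (.inr hr)).2)
    simp only [time, cost]; split_ifs <;> omega
  | forLt i n c ih =>
    have hf := loopState_frame i n c s
    simp only [limits, wreg, List.mem_cons, not_or] at hL hw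
    have h : ∀ j ∈ Finset.range (s.reg n), c.time (loopState i c s j) + 3 ≤ c.cost L + 3 := by
      intro j _
      have := ih (loopState i c s j) (fun r hr => by
        rw [(hf j).1 r (by simpa [wreg] using hw r (.inr hr))]; exact hL r (.inr hr))
        (fun r hr => (hw r (.inr hr)).2.2)
      omega
    have := Finset.sum_le_card_nsmul _ _ _ h
    rw [Finset.card_range, smul_eq_mul, hL n (.inl rfl)] at this
    simp only [time, cost]
    rw [hL n (.inl rfl)]; omega
  | _ => simp [time, cost]

end Prog

/-- All numbers stored in a state are at most `M`. -/
def State.Bounded (s : State) (M : ℕ) : Prop := (∀ x, s.reg x ≤ M) ∧ ∀ a i, s.mem a i ≤ M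

theorem State.Bounded.mono {s : State} {M N : ℕ} (h : s.Bounded M) (hMN : M ≤ N) : s.Bounded N :=
  ⟨fun x => (h.1 x).trans hMN, fun a i => (h.2 a i).trans hMN⟩

theorem State.Bounded.setReg {s : State} {M : ℕ} (h : s.Bounded M) (x : ℕ) {v : ℕ} (hv : v ≤ M) :
    (s.setReg x v).Bounded M := by
  refine ⟨fun y => ?_, h.2⟩
  rw [State.reg_setReg]; split_ifs
  exacts [hv, h.1 y]

theorem State.Bounded.setMem {s : State} {M : ℕ} (h : s.Bounded M) (a i : ℕ) {v : ℕ}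
    (hv : v ≤ M) : (s.setMem a i v).Bounded M := by
  refine ⟨h.1, fun b j => ?_⟩
  rw [State.mem_setMem]; split_ifs
  · rw [Function.update_apply]; split_ifs
    exacts [hv, h.2 a j]
  · exact h.2 b j

/-- The growth by 2 covers the constant 1 written to register 99, even if `x` is 99, and it equals
the number of steps of the compiled instruction. -/
theorem State.Bounded.incr {s : State} {M : ℕ} (h : s.Bounded M) (x : ℕ) :
    (Prog.incr s x).Bounded (M + 2) := by
  have h1 := (h.mono (Nat.le_add_right M 2)).setReg 99 (v := 1) (by omega)
  refine h1.setReg x ?_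
  rw [State.reg_setReg]; split_ifs
  · omega
  · have := h.1 x; omega

/-! ### Transfer of bounded-loop programs to the machine -/

namespace Prog

theorem exec_inc {s : State} {M B : ℕ} (h : s.Bounded M) (hB : M + 2 ≤ B) (x : ℕ) :
    Exec B (.seq (.const 99 1) (.arith .add x x 99)) s 2 (incr s x) := by
  have h1 := h.incr x
  have := Exec.seq (Exec.const (B := B) s 99 1 (by omega))
    (Exec.arith (B := B) (s.setReg 99 1) .add x x 99 (by
      have := h1.1 x
      simp only [incr, State.reg_setReg, if_true, Op.eval] at this ⊢; omega))
  simpa [Op.eval, incr] using this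

/-- The machine executes a bounded-loop program as described by `run` and `time`, if its words
are long enough compared to the time. -/
theorem exec (p : Prog) (hwf : p.wf) {s : State} {M B : ℕ} (h : s.Bounded M)
    (hB : M + p.time s ≤ B) :
    Exec B p.compile s (p.time s) (p.run s) ∧ (p.run s).Bounded (M + p.time s) := by
  induction p generalizing s M with
  | skip => exact ⟨.skip s, h.mono (by omega)⟩
  | const x c =>
    simp only [time, wf] at hB hwf
    exact ⟨.const s x c (by omega), (h.mono (by simp [time])).setReg x (by simp [time]; omega)⟩
  | copy x y =>
    simp only [time] at hB
    have := h.1 y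
    exact ⟨.copy s x y (by omega), (h.mono (by simp [time])).setReg x (by simp [time]; omega)⟩
  | inc x => exact ⟨exec_inc h hB x, h.incr x⟩
  | dec x =>
    simp only [time] at hB
    have h1 : ((s.setReg 99 1)).Bounded (M + 2) := (h.mono (by omega)).setReg 99 (by omega)
    have h2 : (s.setReg 99 1).reg x - 1 ≤ M + 2 := (Nat.sub_le _ _).trans (h1.1 x)
    refine ⟨?_, h1.setReg x h2⟩
    have := Exec.seq (Exec.const (B := B) s 99 1 (by omega))
      (Exec.arith (B := B) (s.setReg 99 1) .sub x x 99 (by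
        simp only [State.reg_setReg, if_true, Op.eval] at h2 ⊢; omega))
    simpa [Op.eval, run, decr, compile, time] using this
  | load x a i =>
    simp only [time] at hB
    have h1 := h.1 i
    have h2 := h.2 a (s.reg i)
    exact ⟨.load s x a i (by omega) (by omega),
      (h.mono (by simp [time])).setReg x (by simp [time]; omega)⟩
  | store a i x =>
    simp only [time] at hB
    have h1 := h.1 i
    have h2 := h.1 x
    exact ⟨.store s a i x (by omega) (by omega),
      (h.mono (by simp [time])).setMem a _ (by simp [time]; omega)⟩
  | seq c d ihc ihd =>
    simp only [time] at hB
    have h1 := ihc hwf.1 h (by omega)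
    have h2 := ihd hwf.2 h1.2 (by omega)
    exact ⟨.seq h1.1 h2.1, h2.2.mono (by simp only [time]; omega)⟩
  | ifLt x y c d ihc ihd =>
    simp only [time, run] at hB ⊢
    split_ifs at hB ⊢ with hxy
    · have h1 := ihc hwf.1 h (by omega)
      exact ⟨.ifTrue hxy h1.1, h1.2.mono (by omega)⟩
    · have h1 := ihd hwf.2 h (by omega)
      exact ⟨.ifFalse hxy h1.1, h1.2.mono (by omega)⟩
  | ifEq x y c d ihc ihd =>
    simp only [time, run] at hB ⊢
    rcases lt_trichotomy (s.reg x) (s.reg y) with hxy | hxy | hxy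
    · rw [if_pos hxy] at hB
      rw [if_pos hxy, if_neg hxy.ne]
      have h1 := ihd hwf.2 h (by omega)
      exact ⟨.ifTrue hxy h1.1, h1.2.mono (by omega)⟩
    · rw [if_neg hxy.not_lt, if_neg hxy.symm.not_lt] at hB
      rw [if_neg hxy.not_lt, if_neg hxy.symm.not_lt, if_pos hxy]
      have h1 := ihc hwf.1 h (by omega)
      exact ⟨.ifFalse hxy.not_lt (.ifFalse hxy.symm.not_lt h1.1), h1.2.mono (by omega)⟩
    · rw [if_neg hxy.not_gt, if_pos hxy] at hB
      rw [if_neg hxy.not_gt, if_pos hxy, if_neg hxy.ne']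
      have h1 := ihd hwf.2 h (by omega)
      exact ⟨.ifFalse hxy.not_gt (.ifTrue hxy h1.1), h1.2.mono (by omega)⟩
  | forLt i n c ih =>
    have hreg := loopState_reg hwf s
    set N := s.reg n with hN
    let τ : ℕ → ℕ := fun j => ∑ j ∈ Finset.range j, (c.time (loopState i c s j) + 3)
    have hτ : ∀ j, τ (j + 1) = τ j + (c.time (loopState i c s j) + 3) :=
      fun j => Finset.sum_range_succ _ _
    have hmono : ∀ j k, j ≤ k → τ j ≤ τ k := fun j k hjk =>
      Finset.sum_le_sum_of_subset (Finset.range_mono hjk)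
    have htime : (forLt i n c).time s = τ N + 2 := rfl
    rw [htime] at hB ⊢
    -- The summand 1 is the step that initializes the counter.
    have hbd : ∀ j ≤ N, (loopState i c s j).Bounded (M + 1 + τ j) := by
      intro j
      induction j with
      | zero => exact fun _ => (h.mono (by omega)).setReg i (by omega)
      | succ j hj =>
        intro hjN
        have h1 := hmono _ _ hjN
        rw [hτ] at h1
        have h2 := (ih hwf.1 (hj (by omega)) (by omega)).2.incr i
        rw [loopState_succ, hτ]
        exact h2.mono (by omega)
    -- The run of the while loop is assembled from its end, with `k` the number of rounds still to
    -- come. The 1 on the right is the final failing test.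
    have hex : ∀ k ≤ N, ∃ t, t + τ (N - k) = τ N + 1 ∧ Exec B
        (.whileLt i n (.seq c.compile (.seq (.const 99 1) (.arith .add i i 99))))
        (loopState i c s (N - k)) t (loopState i c s N) := by
      intro k
      induction k with
      | zero =>
        refine fun _ => ⟨1, by simp [add_comm], .whileFalse ?_⟩
        rw [Nat.sub_zero, (hreg N).1, (hreg N).2]; exact lt_irrefl N
      | succ k hk =>
        intro hkN
        obtain ⟨t, ht, hE⟩ := hk (by omega)
        have hj : N - k = N - (k + 1) + 1 := by omega
        rw [hj] at ht hE
        set j := N - (k + 1)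
        have h0 := hbd j (by omega)
        have h1 := hmono (j + 1) N (by omega)
        rw [hτ] at h1 ht
        have h2 := ih hwf.1 h0 (by omega)
        have h3 := exec_inc (B := B) h2.2 (by omega) i
        -- A round costs its body, two steps for the counter and one for the test.
        refine ⟨c.time (loopState i c s j) + 2 + t + 1, by omega, .whileTrue ?_ (.seq h2.1 h3) hE⟩
        rw [(hreg j).1, (hreg j).2]; omega
    obtain ⟨t, ht, hE⟩ := hex N le_rfl
    rw [Nat.sub_self] at ht hE
    have h0 : τ 0 = 0 := rfl
    refine ⟨?_, (hbd N le_rfl).mono (by omega)⟩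
    have := Exec.seq (Exec.const (B := B) s i 0 (by omega)) hE
    rwa [show 1 + t = τ N + 2 by omega] at this

end Prog

end Language

end CVD

namespace CVD

/-! ### Graph theory: induced paths, representation by marked vertices, size of the kernel -/

section Kernel

variable {V W : Type*}

/-- The vertices `a`, `b`, `c` induce a path in this order. -/
def InducedPath (A : SimpleGraph V) (a b c : V) : Prop :=
  A.Adj a b ∧ A.Adj b c ∧ a ≠ c ∧ ¬ A.Adj a c

theorem InducedPath.symm {A : SimpleGraph V} {a b c : V} (h : InducedPath A a b c) :
    InducedPath A c b a :=
  ⟨h.2.1.symm, h.1.symm, h.2.2.1.symm, fun h' => h.2.2.2 h'.symm⟩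

/-- Conversely, induct along a walk from `u` to `w`: its second vertex `v` equals `w` or is adjacent
to it, and in the latter case non-adjacent `u` and `w` would form an induced path with `v` in the
middle. -/
theorem isClusterGraph_iff (A : SimpleGraph V) :
    IsClusterGraph A ↔ ∀ a b c, ¬ InducedPath A a b c := by
  constructor
  · rintro h a b c ⟨hab, hbc, hac, hn⟩
    exact hn (h (A.connectedComponentMk a) rfl
      (SimpleGraph.ConnectedComponent.sound (hab.reachable.trans hbc.reachable).symm) hac)
  · intro h c x hx y hy hxy
    have hr : A.Reachable x y := SimpleGraph.ConnectedComponent.exact (hx.trans hy.symm)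
    obtain ⟨w⟩ := hr
    clear hx hy
    induction w with
    | nil => exact absurd rfl hxy
    | @cons u v w huv p ih =>
      by_cases hvw : v = w
      · exact hvw ▸ huv
      · by_contra hn
        exact h u v w ⟨huv, ih hvw, hxy, hn⟩

theorem isClusterVertexDeletion_iff (A : SimpleGraph V) (S : Finset V) :
    IsClusterVertexDeletion A S ↔
      ∀ a b c, InducedPath A a b c → a ∈ S ∨ b ∈ S ∨ c ∈ S := by
  rw [IsClusterVertexDeletion, isClusterGraph_iff]
  constructor
  · intro h a b c hp
    by_contra! hn
    exact h ⟨a, hn.1⟩ ⟨b, hn.2.1⟩ ⟨c, hn.2.2⟩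
      ⟨hp.1, hp.2.1, fun h => hp.2.2.1 (congrArg Subtype.val h), hp.2.2.2⟩
  · rintro h ⟨a, ha⟩ ⟨b, hb⟩ ⟨c, hc⟩ ⟨h1, h2, h3, h4⟩
    rcases h a b c ⟨h1, h2, fun h => h3 (Subtype.ext h), h4⟩ with h | h | h
    exacts [ha h, hb h, hc h]

theorem exists_card_eq_cvdNumber [Fintype V] (A : SimpleGraph V) :
    ∃ S : Finset V, IsClusterVertexDeletion A S ∧ S.card = cvdNumber A :=
  Nat.sInf_mem (s := {k | ∃ S : Finset V, IsClusterVertexDeletion A S ∧ S.card = k})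
    ⟨_, Finset.univ, by simp [isClusterVertexDeletion_iff], rfl⟩

theorem cvdNumber_le (A : SimpleGraph V) {S : Finset V} (hS : IsClusterVertexDeletion A S) :
    cvdNumber A ≤ S.card :=
  Nat.sInf_le ⟨S, hS, rfl⟩

/-- An induced subgraph is a kernel, with nothing forced into the solution, if each of its
solutions that is not larger than the optimum for the whole graph solves the whole graph. -/
theorem isKernel_of_solutions_extend [Fintype V] [DecidableEq V] [Fintype W] {A : SimpleGraph V}
    {H : SimpleGraph W} (φ : H ↪g A)
    (h : ∀ S : Finset W, IsClusterVertexDeletion H S → S.card ≤ cvdNumber A →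
      IsClusterVertexDeletion A (S.map φ.toEmbedding)) : IsKernel A H φ ∅ := by
  -- Induced paths of `H` are induced paths of `A`, so the preimage of a solution is a solution and
  -- the optimum of `H` is at most that of `A`.
  have hres : ∀ T : Finset V, IsClusterVertexDeletion A T →
      ∃ S : Finset W, IsClusterVertexDeletion H S ∧ S.card ≤ T.card := by
    classical
    intro T hT
    refine ⟨Finset.univ.filter fun w => φ w ∈ T, ?_, ?_⟩
    · rw [isClusterVertexDeletion_iff] at hT ⊢
      rintro a b c ⟨h1, h2, h3, h4⟩
      simpa using hT (φ a) (φ b) (φ c) ⟨φ.map_rel_iff.2 h1, φ.map_rel_iff.2 h2,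
        fun h => h3 (φ.injective h), fun h => h4 (φ.map_rel_iff.1 h)⟩
    · exact Finset.card_le_card_of_injOn φ (fun w hw => by simpa using hw) φ.injective.injOn
  have hlow : ∀ T : Finset V, IsClusterVertexDeletion A T → cvdNumber H ≤ T.card := by
    intro T hT
    obtain ⟨S, hS, hST⟩ := hres T hT
    exact (cvdNumber_le H hS).trans hST
  obtain ⟨T₀, hT₀, hc₀⟩ := exists_card_eq_cvdNumber A
  refine ⟨by simp, ?_, ?_⟩
  · rintro S ⟨hS, hmin⟩
    obtain ⟨S', hS', hle⟩ := hres T₀ hT₀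
    have hle' : S.card ≤ cvdNumber A := (hmin S' hS').trans (hle.trans hc₀.le)
    rw [Finset.empty_union]
    refine ⟨h S hS hle', fun T hT => ?_⟩
    rw [Finset.card_map]
    exact hle'.trans (cvdNumber_le A hT)
  · intro b
    simp only [Finset.card_empty, Nat.zero_le, true_and, Nat.sub_zero]
    constructor
    · rintro ⟨T, hT, hb⟩
      obtain ⟨S, hS, hle⟩ := hres T hT
      exact ⟨S, hS, hle.trans hb⟩
    · rintro ⟨S, hS, hb⟩
      -- A solution of `H` larger than the optimum of `A` need not lift, but then an optimum of `A`
      -- fits into the budget.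
      rcases le_total S.card (cvdNumber A) with hle | hle
      · exact ⟨_, h S hS hle, by rwa [Finset.card_map]⟩
      · exact ⟨T₀, hT₀, by omega⟩

/-- The vertex `v` of the modulator `S` is well represented by the set `M` of marked vertices:
either it has many marked neighbours in different cliques, or, in every clique that contains a
neighbour of `v`, all neighbours of `v` or many of them are marked, and likewise for
non-neighbours. Here `r` names the clique of a vertex outside `S`. -/
def Represented (A : SimpleGraph V) (S : Finset V) (r : V → ℕ) (M : Set V) (v : V) : Prop :=
  (∃ I : Finset V, 2 * S.card + 2 ≤ I.card ∧ (∀ x ∈ I, x ∈ M ∧ A.Adj v x) ∧ Set.InjOn r I) ∨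
  ∀ w, w ∉ S → A.Adj v w → ∀ w', w' ∉ S → (∃ z, A.Adj w' z) → r w' = r w →
    w' ∈ M ∨ ∃ I : Finset V, S.card + 1 ≤ I.card ∧
      ∀ x ∈ I, x ∈ M ∧ x ∉ S ∧ r x = r w ∧ (A.Adj v x ↔ A.Adj v w')

theorem Represented.mono {A : SimpleGraph V} {S : Finset V} {r : V → ℕ} {M N : Set V} {v : V}
    (h : Represented A S r M v) (hMN : M ⊆ N) : Represented A S r N v := by
  rcases h with ⟨I, h1, h2, h3⟩ | h
  · exact .inl ⟨I, h1, fun x hx => ⟨hMN (h2 x hx).1, (h2 x hx).2⟩, h3⟩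
  · refine .inr fun w hw hvw w' hw' hz hr => ?_
    rcases h w hw hvw w' hw' hz hr with h | ⟨I, h1, h2⟩
    · exact .inl (hMN h)
    · exact .inr ⟨I, h1, fun x hx => ⟨hMN (h2 x hx).1, (h2 x hx).2⟩⟩

/-- If the vertices of the modulator are marked and well represented, small solutions of the
subgraph induced by the marked vertices are solutions of the graph. -/
theorem hits_of_represented {A : SimpleGraph V} {S : Finset V} {r : V → ℕ} {M : Set V}
    (hSM : ∀ v ∈ S, v ∈ M) (hM : ∀ v ∈ M, ∃ z, A.Adj v z)
    (hr : ∀ w w', w ∉ S → w' ∉ S → (∃ z, A.Adj w z) → (∃ z, A.Adj w' z) →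
      (r w = r w' ↔ w = w' ∨ A.Adj w w'))
    (hrep : ∀ v ∈ S, Represented A S r M v) {T : Finset V} (hT : T.card ≤ S.card)
    (hhit : ∀ a b c, a ∈ M → b ∈ M → c ∈ M → InducedPath A a b c → a ∈ T ∨ b ∈ T ∨ c ∈ T)
    (a b c : V) (hp : InducedPath A a b c) : a ∈ T ∨ b ∈ T ∨ c ∈ T := by
  classical
  have end1 : ∀ {u w}, A.Adj u w → ∃ z, A.Adj w z := fun h => ⟨_, h.symm⟩
  have avoid : ∀ a b c, a ∈ M → b ∈ M → c ∈ M → a ∉ T → b ∉ T → c ∉ T →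
      ¬ InducedPath A a b c := by
    intro a b c ha hb hc ha' hb' hc' hp
    rcases hhit a b c ha hb hc hp with h | h | h <;> contradiction
  -- Substitution: if the clique of `w'` contains a neighbour of `v`, then `w'` may be replaced by a
  -- marked vertex of its clique that avoids `T` and looks the same from `v`.
  have F1 : ∀ v ∈ S, v ∉ T → ∀ w, w ∉ S → A.Adj v w → ∀ w', w' ∉ S → w' ∉ T →
      (∃ z, A.Adj w' z) → r w' = r w →
      ∃ x ∈ M, x ∉ S ∧ x ∉ T ∧ r x = r w ∧ (A.Adj v x ↔ A.Adj v w') := by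
    intro v hv hvT
    rcases hrep v hv with ⟨I, h1, h2, h3⟩ | h
    · exfalso
      -- Members of `I` may lie in `S`, so both `T` and `S` are removed. This is why 2|S|+2 are
      -- required: two remain, in different cliques, and `v` joins them to an induced path missed by
      -- `T`.
      have hcard : 1 < ((I \ T) \ S).card := by
        have := Finset.le_card_sdiff T I
        have := Finset.le_card_sdiff S (I \ T)
        omega
      obtain ⟨x, hx, y, hy, hxy⟩ := Finset.one_lt_card.1 hcard
      simp only [Finset.mem_sdiff] at hx hy
      obtain ⟨hxM, hvx⟩ := h2 x hx.1.1
      obtain ⟨hyM, hvy⟩ := h2 y hy.1.1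
      refine avoid x v y hxM (hSM v hv) hyM hx.1.2 hvT hy.1.2 ⟨hvx.symm, hvy, hxy, fun hA => ?_⟩
      exact hxy (h3 hx.1.1 hy.1.1 ((hr x y hx.2 hy.2 (end1 hvx) (end1 hvy)).2 (.inr hA)))
    · intro w hw hvw w' hw' hwT hz hrw
      rcases h w hw hvw w' hw' hz hrw with hM | ⟨I, h1, h2⟩
      · exact ⟨w', hM, hw', hwT, hrw, Iff.rfl⟩
      · obtain ⟨x, hx⟩ : (I \ T).Nonempty := by
          rw [← Finset.card_pos]
          have := Finset.le_card_sdiff T I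
          omega
        rw [Finset.mem_sdiff] at hx
        obtain ⟨h3, h4, h5, h6⟩ := h2 x hx.1
        exact ⟨x, h3, h4, hx.2, h5, h6⟩
  have F2 : ∀ v ∈ S, v ∉ T → ∀ w, w ∉ S → w ∉ T → A.Adj v w →
      ∃ x ∈ M, x ∉ S ∧ x ∉ T ∧ r x = r w ∧ A.Adj v x := by
    intro v hv hvT w hw hwT hvw
    obtain ⟨x, h1, h2, h3, h4, h5⟩ := F1 v hv hvT w hw hvw w hw hwT (end1 hvw) rfl
    exact ⟨x, h1, h2, h3, h4, h5.2 hvw⟩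
  -- Outside `T`, the vertex `v` sees all or nothing of a clique: otherwise substitutes `x`, `y` of
  -- a neighbour and a non-neighbour give the marked path `v`, `x`, `y`.
  have F4 : ∀ v ∈ S, v ∉ T → ∀ w, w ∉ S → w ∉ T → A.Adj v w → ∀ w', w' ∉ S → w' ∉ T →
      (∃ z, A.Adj w' z) → r w' = r w → A.Adj v w' := by
    intro v hv hvT w hw hwT hvw w' hw' hwT' hz hrw
    by_contra hn
    obtain ⟨x, h1, h2, h3, h4, h5⟩ := F2 v hv hvT w hw hwT hvw
    obtain ⟨y, g1, g2, g3, g4, g5⟩ := F1 v hv hvT w hw hvw w' hw' hwT' hz hrw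
    have hy : ¬ A.Adj v y := fun h => hn (g5.1 h)
    have hxy : x ≠ y := by rintro rfl; exact hy h5
    have hA := ((hr x y h2 g2 (hM x h1) (hM y g1)).1 (h4.trans g4.symm)).resolve_left hxy
    have hvy : v ≠ y := by rintro rfl; exact g2 hv
    exact avoid v x y (hSM v hv) h1 g1 hvT h3 g3 ⟨h5, hA, hvy, hy⟩
  -- Outside `T`, the vertex `v` sees at most one clique, by a path centred at `v`.
  have F5 : ∀ v ∈ S, v ∉ T → ∀ w, w ∉ S → w ∉ T → A.Adj v w → ∀ w', w' ∉ S → w' ∉ T →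
      A.Adj v w' → r w = r w' := by
    intro v hv hvT w hw hwT hvw w' hw' hwT' hvw'
    by_contra hn
    obtain ⟨x, h1, h2, h3, h4, h5⟩ := F2 v hv hvT w hw hwT hvw
    obtain ⟨y, g1, g2, g3, g4, g5⟩ := F2 v hv hvT w' hw' hwT' hvw'
    have hne : r x ≠ r y := by rw [h4, g4]; exact hn
    refine avoid x v y h1 (hSM v hv) g1 h3 hvT g3 ⟨h5.symm, g5, fun h => hne (h ▸ rfl), fun h => ?_⟩
    exact hne ((hr x y h2 g2 (hM x h1) (hM y g1)).2 (.inr h))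
  -- The end `c` is replaced by a marked neighbour of `b` in its clique. If `a` were adjacent to the
  -- substitute, it would be adjacent to `c`, by `F4`.
  have C1 : ∀ a b c, InducedPath A a b c → a ∉ T → b ∉ T → c ∉ T → a ∈ S → b ∈ S → False := by
    intro a b c hp ha hb hc haS hbS
    by_cases hcS : c ∈ S
    · exact avoid a b c (hSM a haS) (hSM b hbS) (hSM c hcS) ha hb hc hp
    obtain ⟨x, h1, h2, h3, h4, h5⟩ := F2 b hbS hb c hcS hc hp.2.1
    refine avoid a b x (hSM a haS) (hSM b hbS) h1 ha hb h3
      ⟨hp.1, h5, fun h => h2 (h ▸ haS), fun h => hp.2.2.2 ?_⟩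
    exact F4 a haS ha x h2 h3 h c hcS hc (end1 hp.2.1) h4.symm
  -- If `c` is in `S`, the middle vertex is replaced, and `F4` keeps it adjacent to `c`. If not, `b`
  -- and `c` share a clique and `F4` makes `a` adjacent to `c`.
  have C2 : ∀ a b c, InducedPath A a b c → a ∉ T → b ∉ T → c ∉ T → a ∈ S → b ∉ S → False := by
    intro a b c hp ha hb hc haS hbS
    by_cases hcS : c ∈ S
    · obtain ⟨x, h1, h2, h3, h4, h5⟩ := F2 a haS ha b hbS hb hp.1
      refine avoid a x c (hSM a haS) h1 (hSM c hcS) ha h3 hc ⟨h5, ?_, hp.2.2.1, hp.2.2.2⟩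
      exact (F4 c hcS hc b hbS hb hp.2.1.symm x h2 h3 (hM x h1) h4).symm
    · refine hp.2.2.2 (F4 a haS ha b hbS hb hp.1 c hcS hc (end1 hp.2.1) ?_)
      exact (hr c b hcS hbS (end1 hp.2.1) (end1 hp.1)).2 (.inr hp.2.1.symm)
  by_contra! hn
  obtain ⟨ha, hb, hc⟩ := hn
  by_cases haS : a ∈ S
  · by_cases hbS : b ∈ S
    exacts [C1 a b c hp ha hb hc haS hbS, C2 a b c hp ha hb hc haS hbS]
  by_cases hcS : c ∈ S
  · by_cases hbS : b ∈ S
    exacts [C1 c b a hp.symm hc hb ha hcS hbS, C2 c b a hp.symm hc hb ha hcS hbS]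
  -- By symmetry both ends are now outside `S`. They lie in the same clique whether or not the
  -- middle vertex is in `S`, so they cannot be distinct and non-adjacent.
  have hac : r a = r c := by
    by_cases hbS : b ∈ S
    · exact F5 b hbS hb a haS ha hp.1.symm c hcS hc hp.2.1
    · rw [(hr a b haS hbS ⟨b, hp.1⟩ (end1 hp.1)).2 (.inr hp.1)]
      exact (hr b c hbS hcS (end1 hp.1) (end1 hp.2.1)).2 (.inr hp.2.1)
  rcases (hr a c haS hcS ⟨b, hp.1⟩ (end1 hp.2.1)).1 hac with h | h
  exacts [hp.2.2.1 h, hp.2.2.2 h]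

/-- A graph has few edges if it consists of `s` vertices and a graph split into parts of at most
`d` vertices each. -/
theorem ncard_edgeSet_le {p : ℕ} (H : SimpleGraph (Fin p)) (s d : ℕ) (r : Fin p → ℕ)
    (hr : ∀ i j : Fin p, s ≤ i → s ≤ j → H.Adj i j → r i = r j)
    (hd : ∀ c, (Finset.univ.filter fun i : Fin p => s ≤ i ∧ r i = c).card ≤ d) :
    H.edgeSet.ncard ≤ p * (s + d) := by
  classical
  -- Each edge can be oriented as a pair (i, j) with `j` in `N i`: towards an end below `s` if there
  -- is one, and arbitrarily inside a part otherwise.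
  let N : Fin p → Finset (Fin p) := fun i =>
    (Finset.univ.filter fun j : Fin p => (j : ℕ) < s) ∪
      Finset.univ.filter fun j : Fin p => s ≤ (j : ℕ) ∧ r j = r i
  have hN : ∀ i, (N i).card ≤ s + d := by
    intro i
    refine (Finset.card_union_le _ _).trans (Nat.add_le_add ?_ (hd _))
    calc _ ≤ (Finset.range s).card :=
          Finset.card_le_card_of_injOn (fun j : Fin p => (j : ℕ)) (fun j hj => by simpa using hj)
            (fun a _ b _ h => Fin.ext h)
      _ = s := Finset.card_range s
  let E : Finset (Sym2 (Fin p)) :=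
    (Finset.univ.sigma N).image fun x : (_ : Fin p) × Fin p => s(x.1, x.2)
  have hsub : H.edgeSet ⊆ E := by
    intro e
    induction e using Sym2.ind with
    | _ i j =>
      intro hA
      rw [SimpleGraph.mem_edgeSet] at hA
      simp only [E, N, Finset.coe_image, Set.mem_image, Finset.mem_coe, Finset.mem_sigma,
        Finset.mem_univ, true_and, Finset.mem_union, Finset.mem_filter]
      by_cases hj : (j : ℕ) < s
      · exact ⟨⟨i, j⟩, .inl hj, rfl⟩
      by_cases hi : (i : ℕ) < s
      · exact ⟨⟨j, i⟩, .inl hi, Sym2.eq_swap⟩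
      · exact ⟨⟨i, j⟩, .inr ⟨not_lt.1 hj, (hr i j (by omega) (by omega) hA).symm⟩, rfl⟩
  calc H.edgeSet.ncard ≤ (E : Set (Sym2 (Fin p))).ncard := Set.ncard_le_ncard hsub
    _ = E.card := Set.ncard_coe_finset E
    _ ≤ (Finset.univ.sigma N).card := Finset.card_image_le
    _ = ∑ i, (N i).card := Finset.card_sigma _ _
    _ ≤ ∑ _i : Fin p, (s + d) := Finset.sum_le_sum fun i _ => hN i
    _ = p * (s + d) := by simp

end Kernel

open Prog

/-! ### Linear passes over the list of arcs -/

section Modulator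

/-- `src` and `dst` list the ordered pairs of adjacent vertices, each exactly once. -/
structure ArcListing (A : SimpleGraph ℕ) (M : ℕ) (src dst : ℕ → ℕ) : Prop where
  adj : ∀ u w, A.Adj u w ↔ ∃ d < M, src d = u ∧ dst d = w
  inj : ∀ d < M, ∀ d' < M, src d = src d' → dst d = dst d' → d = d'

/-- Store both orientations of each edge in the arrays 4 and 5, and their number in register 4. -/
def buildArcs : Prog :=
  forLt 8 1 (load 9 0 8 ;; load 10 1 8 ;; store 4 4 9 ;; store 5 4 10 ;; inc 4 ;;
    store 4 4 10 ;; store 5 4 9 ;; inc 4)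

theorem buildArcs_spec (s : State) (h4 : s.reg 4 = 0) :
    (buildArcs.run s).reg 4 = 2 * s.reg 1 ∧ ∀ j < s.reg 1,
      (buildArcs.run s).mem 4 (2 * j) = s.mem 0 j ∧
      (buildArcs.run s).mem 5 (2 * j) = s.mem 1 j ∧
      (buildArcs.run s).mem 4 (2 * j + 1) = s.mem 1 j ∧
      (buildArcs.run s).mem 5 (2 * j + 1) = s.mem 0 j := by
  refine for_rule (by simp [wf, wreg]) s (fun i s' => s'.reg 4 = 2 * i ∧ ∀ j < i,
      s'.mem 4 (2 * j) = s.mem 0 j ∧ s'.mem 5 (2 * j) = s.mem 1 j ∧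
      s'.mem 4 (2 * j + 1) = s.mem 1 j ∧ s'.mem 5 (2 * j + 1) = s.mem 0 j) ?_ ?_
  · simp [h4]
  · rintro i hi s' h8 hreg hmem ⟨hi4, hI⟩
    have m0 := hmem 0 (by simp [wmem])
    have m1 := hmem 1 (by simp [wmem])
    simp only [run, State.reg_setReg, State.mem_setReg, State.reg_setMem, State.mem_setMem,
      incr_mem, incr_reg, h8, m0, m1, hi4, Nat.reduceEqDiff, if_true, if_false, ne_eq,
      not_false_eq_true, Function.update_apply]
    refine ⟨by ring, fun j hj => ?_⟩
    rcases Nat.lt_succ_iff_lt_or_eq.1 hj with hj | rfl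
    · obtain ⟨h1, h2, h3, h4⟩ := hI j hj
      simp [show 2 * j ≠ 2 * i by omega,
        show 2 * j ≠ 2 * i + 1 by omega, show 2 * j + 1 ≠ 2 * i by omega,
        h1, h2, h3, h4]
    · simp

/-- Initialize the arrays 8, 9 and 10 for all vertices of positive degree. -/
def resetPass : Prog :=
  forLt 8 4 (load 9 4 8 ;; store 8 9 9 ;; store 9 9 3 ;; store 10 9 3)

theorem resetPass_spec (s : State) (h3 : s.reg 3 = 0) (d : ℕ) (hd : d < s.reg 4) :
    (resetPass.run s).mem 8 (s.mem 4 d) = s.mem 4 d ∧ (resetPass.run s).mem 9 (s.mem 4 d) = 0 ∧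
      (resetPass.run s).mem 10 (s.mem 4 d) = 0 := by
  suffices h : ∀ d < s.reg 4, (resetPass.run s).mem 8 (s.mem 4 d) = s.mem 4 d ∧
      (resetPass.run s).mem 9 (s.mem 4 d) = 0 ∧ (resetPass.run s).mem 10 (s.mem 4 d) = 0 from h d hd
  refine for_rule (by simp [wf, wreg]) s (fun i s' => ∀ d < i, s'.mem 8 (s.mem 4 d) = s.mem 4 d ∧
      s'.mem 9 (s.mem 4 d) = 0 ∧ s'.mem 10 (s.mem 4 d) = 0) (by simp) ?_
  intro i hi s' h8 hreg hmem hI d hd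
  have m4 := hmem 4 (by simp [wmem])
  have r3 := hreg 3 (by simp [wreg])
  simp only [run, State.reg_setReg, State.mem_setReg, State.reg_setMem, State.mem_setMem,
    incr_mem, h8, m4, r3, h3, Nat.reduceEqDiff, if_true, if_false,
    Function.update_apply]
  rcases Nat.lt_succ_iff_lt_or_eq.1 hd with hd | rfl
  · obtain ⟨h1, h2, h3⟩ := hI d hd
    split_ifs with h
    · exact ⟨h.symm, rfl, rfl⟩
    · exact ⟨h1, h2, h3⟩
  · simp

/-- Compute, in the graph without the vertices in the list, the smallest member of the closed
neighbourhood (array 8) and the degree (array 9) of each vertex. -/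
def signaturePass : Prog :=
  forLt 8 4 (load 9 4 8 ;; load 10 5 8 ;; load 11 7 9 ;; load 12 7 10 ;;
    ifEq 11 3 (ifEq 12 3 (load 13 8 9 ;; ifLt 10 13 (store 8 9 10) skip ;;
      load 14 9 9 ;; inc 14 ;; store 9 9 14) skip) skip)

/-- In the graph without the vertices with `pos ≠ 0`, the vertex `u` has smallest closed neighbour
`rep` and degree `deg`. -/
structure Signature (M : ℕ) (src dst pos : ℕ → ℕ) (u rep deg : ℕ) : Prop where
  mem : rep = u ∨ ∃ d < M, src d = u ∧ pos (dst d) = 0 ∧ dst d = rep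
  le_self : rep ≤ u
  le : ∀ d < M, src d = u → pos (dst d) = 0 → rep ≤ dst d
  deg_eq : deg = ((Finset.range M).filter fun d => src d = u ∧ pos (dst d) = 0).card

/-- The pass accumulates a minimum and a count over the arcs leaving `u`. Arrays 8 and 9 carry
suitable initial values only at sources of arcs, so isolated vertices are excluded. -/
theorem signaturePass_spec (s : State) (h3 : s.reg 3 = 0)
    (h8 : ∀ d < s.reg 4, s.mem 8 (s.mem 4 d) = s.mem 4 d)
    (h9 : ∀ d < s.reg 4, s.mem 9 (s.mem 4 d) = 0)
    (u : ℕ) (hu : ∃ d < s.reg 4, s.mem 4 d = u) (hpu : s.mem 7 u = 0) :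
    Signature (s.reg 4) (s.mem 4) (s.mem 5) (s.mem 7) u ((signaturePass.run s).mem 8 u)
      ((signaturePass.run s).mem 9 u) := by
  suffices h : ((signaturePass.run s).mem 8 u = u ∨ ∃ d < s.reg 4, s.mem 4 d = u ∧
      s.mem 7 (s.mem 5 d) = 0 ∧ s.mem 5 d = (signaturePass.run s).mem 8 u) ∧
      (signaturePass.run s).mem 8 u ≤ u ∧
      (∀ d < s.reg 4, s.mem 4 d = u → s.mem 7 (s.mem 5 d) = 0 →
        (signaturePass.run s).mem 8 u ≤ s.mem 5 d) ∧
      (signaturePass.run s).mem 9 u =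
        ((Finset.range (s.reg 4)).filter fun d => s.mem 4 d = u ∧ s.mem 7 (s.mem 5 d) = 0).card from
    ⟨h.1, h.2.1, h.2.2.1, h.2.2.2⟩
  refine for_rule (by simp [wf, wreg]) s (fun i s' =>
    (s'.mem 8 u = u ∨ ∃ d < i, s.mem 4 d = u ∧ s.mem 7 (s.mem 5 d) = 0 ∧
        s.mem 5 d = s'.mem 8 u) ∧ s'.mem 8 u ≤ u ∧
      (∀ d < i, s.mem 4 d = u → s.mem 7 (s.mem 5 d) = 0 → s'.mem 8 u ≤ s.mem 5 d) ∧
      s'.mem 9 u =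
        ((Finset.range i).filter fun d => s.mem 4 d = u ∧ s.mem 7 (s.mem 5 d) = 0).card) ?_ ?_
  · obtain ⟨d, hd, rfl⟩ := hu
    simp [h8 d hd, h9 d hd]
  rintro i hi s' hi8 hreg hmem ⟨hI1, hI2, hI3, hI4⟩
  have m4 := hmem 4 (by simp [wmem])
  have m5 := hmem 5 (by simp [wmem])
  have m7 := hmem 7 (by simp [wmem])
  have r3 := hreg 3 (by simp [wreg])
  rw [Finset.range_add_one, Finset.filter_insert]
  by_cases hc : s.mem 4 i = u ∧ s.mem 7 (s.mem 5 i) = 0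
  · obtain ⟨hc1, hc2⟩ := hc
    rw [if_pos ⟨hc1, hc2⟩, Finset.card_insert_of_notMem (by simp), ← hI4]
    by_cases hlt : s.mem 5 i < s'.mem 8 u
    · simp only [run, State.reg_setReg, State.mem_setReg, State.reg_setMem, State.mem_setMem,
        incr_mem, incr_reg, hi8, m4, m5, m7, r3, h3, hc1, hc2, hpu, hlt, Nat.reduceEqDiff, if_true,
        if_false, ne_eq, not_false_eq_true, Function.update_apply]
      refine ⟨.inr ⟨i, by omega, hc1, hc2, rfl⟩, by omega, fun d hd h1 h2 => ?_, trivial⟩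
      rcases Nat.lt_succ_iff_lt_or_eq.1 hd with hd | rfl
      · exact hlt.le.trans (hI3 d hd h1 h2)
      · exact le_rfl
    · simp only [run, State.reg_setReg, State.mem_setReg, State.mem_setMem,
        incr_mem, incr_reg, hi8, m4, m5, m7, r3, h3, hc1, hc2, hpu, hlt, Nat.reduceEqDiff, if_true,
        if_false, ne_eq, not_false_eq_true, Function.update_apply]
      refine ⟨hI1.imp_right ?_, hI2, fun d hd h1 h2 => ?_, trivial⟩
      · rintro ⟨d, hd, h⟩
        exact ⟨d, by omega, h⟩
      rcases Nat.lt_succ_iff_lt_or_eq.1 hd with hd | rfl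
      · exact hI3 d hd h1 h2
      · omega
  · rw [if_neg hc, ← hI4]
    have key : (Prog.run (load 9 4 8 ;; load 10 5 8 ;; load 11 7 9 ;; load 12 7 10 ;;
        ifEq 11 3 (ifEq 12 3 (load 13 8 9 ;; ifLt 10 13 (store 8 9 10) skip ;;
        load 14 9 9 ;; inc 14 ;; store 9 9 14) skip) skip) s').mem 8 u = s'.mem 8 u ∧
        (Prog.run (load 9 4 8 ;; load 10 5 8 ;; load 11 7 9 ;; load 12 7 10 ;;
        ifEq 11 3 (ifEq 12 3 (load 13 8 9 ;; ifLt 10 13 (store 8 9 10) skip ;;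
        load 14 9 9 ;; inc 14 ;; store 9 9 14) skip) skip) s').mem 9 u = s'.mem 9 u := by
      by_cases h1 : s.mem 7 (s.mem 4 i) = 0
      · by_cases h2 : s.mem 7 (s.mem 5 i) = 0
        · have hne : u ≠ s.mem 4 i := fun h => hc ⟨h.symm, h2⟩
          by_cases hlt : s.mem 5 i < s'.mem 8 (s.mem 4 i) <;>
          simp [run, incr_reg, hi8, m4, m5, m7, r3, h3, h1, h2, hlt, hne]
        · simp [run, hi8, m4, m5, m7, r3, h3, h1, h2]
      · simp [run, hi8, m4, m5, m7, r3, h3, h1]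
    rw [incr_mem, key.1, key.2]
    refine ⟨hI1.imp_right ?_, hI2, fun d hd h1 h2 => ?_, rfl⟩
    · rintro ⟨d, hd, h⟩
      exact ⟨d, by omega, h⟩
    rcases Nat.lt_succ_iff_lt_or_eq.1 hd with hd | rfl
    · exact hI3 d hd h1 h2
    · exact absurd ⟨h1, h2⟩ hc

/-- Look for an arc between vertices that are not in the list and have different signatures:
register 20 tells whether there is one, registers 21 and 22 contain its ends. -/
def detectPass : Prog :=
  const 20 0 ;;
  forLt 8 4 (load 9 4 8 ;; load 10 5 8 ;; load 11 7 9 ;; load 12 7 10 ;;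
    ifEq 11 3 (ifEq 12 3 (load 13 8 9 ;; load 14 8 10 ;; load 15 9 9 ;; load 16 9 10 ;;
      ifLt 13 14 (copy 21 9 ;; copy 22 10 ;; const 20 1)
        (ifLt 16 15 (copy 21 9 ;; copy 22 10 ;; const 20 1) skip)) skip) skip)

/-- The arc `d` leads from a vertex with a smaller first, or a larger second, signature to a vertex
with the opposite property, and both are not in the list with positions `pos`. -/
def Mismatch (src dst pos rep deg : ℕ → ℕ) (d : ℕ) : Prop :=
  pos (src d) = 0 ∧ pos (dst d) = 0 ∧ (rep (src d) < rep (dst d) ∨ deg (dst d) < deg (src d))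

theorem detectPass_spec (s : State) (h3 : s.reg 3 = 0) :
    ((detectPass.run s).reg 20 = 0 ∧
      ∀ d < s.reg 4, ¬ Mismatch (s.mem 4) (s.mem 5) (s.mem 7) (s.mem 8) (s.mem 9) d) ∨
    ((detectPass.run s).reg 20 = 1 ∧ ∃ d < s.reg 4,
      Mismatch (s.mem 4) (s.mem 5) (s.mem 7) (s.mem 8) (s.mem 9) d ∧
      (detectPass.run s).reg 21 = s.mem 4 d ∧ (detectPass.run s).reg 22 = s.mem 5 d) := by
  refine for_rule (s := s.setReg 20 0) (by simp [wf, wreg]) (fun i s' =>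
    (s'.reg 20 = 0 ∧
      ∀ d < i, ¬ Mismatch (s.mem 4) (s.mem 5) (s.mem 7) (s.mem 8) (s.mem 9) d) ∨
    (s'.reg 20 = 1 ∧ ∃ d < i, Mismatch (s.mem 4) (s.mem 5) (s.mem 7) (s.mem 8) (s.mem 9) d ∧
      s'.reg 21 = s.mem 4 d ∧ s'.reg 22 = s.mem 5 d)) (by simp) ?_
  rintro i hi s' hi8 hreg hmem hI
  have m4 := hmem 4 (by simp [wmem])
  have m5 := hmem 5 (by simp [wmem])
  have m7 := hmem 7 (by simp [wmem])
  have m8 := hmem 8 (by simp [wmem])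
  have m9 := hmem 9 (by simp [wmem])
  have r3 := hreg 3 (by simp [wreg])
  simp only [State.mem_setReg, State.reg_setReg] at m4 m5 m7 m8 m9 r3
  by_cases hc : Mismatch (s.mem 4) (s.mem 5) (s.mem 7) (s.mem 8) (s.mem 9) i
  · right
    refine ⟨?_, i, by omega, hc, ?_⟩ <;> obtain ⟨h1, h2, h | h⟩ := hc <;>
    by_cases h' : s.mem 8 (s.mem 4 i) < s.mem 8 (s.mem 5 i) <;>
    simp [run, incr_reg, hi8, m4, m5, m7, m8, m9, r3, h3, h1, h2, h, h']
  · have key : ∀ r, r = 20 ∨ r = 21 ∨ r = 22 → (incr (Prog.run (load 9 4 8 ;; load 10 5 8 ;;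
        load 11 7 9 ;; load 12 7 10 ;;
        ifEq 11 3 (ifEq 12 3 (load 13 8 9 ;; load 14 8 10 ;; load 15 9 9 ;; load 16 9 10 ;;
        ifLt 13 14 (copy 21 9 ;; copy 22 10 ;; const 20 1)
        (ifLt 16 15 (copy 21 9 ;; copy 22 10 ;; const 20 1) skip)) skip) skip) s') 8).reg r
        = s'.reg r := by
      intro r hr
      by_cases h1 : s.mem 7 (s.mem 4 i) = 0
      · by_cases h2 : s.mem 7 (s.mem 5 i) = 0
        · have h4 : ¬ s.mem 8 (s.mem 4 i) < s.mem 8 (s.mem 5 i) := fun h => hc ⟨h1, h2, .inl h⟩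
          have h5 : ¬ s.mem 9 (s.mem 5 i) < s.mem 9 (s.mem 4 i) := fun h => hc ⟨h1, h2, .inr h⟩
          rcases hr with rfl | rfl | rfl <;>
          simp [run, incr_reg, hi8, m4, m5, m7, m8, m9, r3, h3, h1, h2, h4, h5]
        · rcases hr with rfl | rfl | rfl <;>
          simp [run, incr_reg, hi8, m4, m5, m7, r3, h3, h1, h2]
      · rcases hr with rfl | rfl | rfl <;>
        simp [run, incr_reg, hi8, m4, m5, m7, r3, h3, h1]
    rw [key 20 (by simp), key 21 (by simp), key 22 (by simp)]
    refine hI.imp (fun h => ⟨h.1, fun d hd => ?_⟩) (fun h => ⟨h.1, ?_⟩)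
    · rcases Nat.lt_succ_iff_lt_or_eq.1 hd with hd | rfl
      exacts [h.2 d hd, hc]
    · obtain ⟨d, hd, h⟩ := h.2
      exact ⟨d, by omega, h⟩

/-- Mark the neighbours of the vertex in register 22 in array 10. -/
def neighbourPass : Prog :=
  forLt 8 4 (load 9 4 8 ;; ifEq 9 22 (load 10 5 8 ;; store 10 10 20) skip)

theorem neighbourPass_spec (s : State) (h20 : s.reg 20 = 1) (w : ℕ) (hw : s.mem 10 w = 0) :
    (neighbourPass.run s).mem 10 w = 0 ↔ ∀ d < s.reg 4, s.mem 4 d = s.reg 22 → s.mem 5 d ≠ w := by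
  refine for_rule (by simp [wf, wreg]) s (fun i s' =>
    s'.mem 10 w = 0 ↔ ∀ d < i, s.mem 4 d = s.reg 22 → s.mem 5 d ≠ w) (by simp [hw]) ?_
  rintro i hi s' hi8 hreg hmem hI
  have m4 := hmem 4 (by simp [wmem])
  have m5 := hmem 5 (by simp [wmem])
  have r20 := hreg 20 (by simp [wreg])
  have r22 := hreg 22 (by simp [wreg])
  rw [Nat.forall_lt_succ_right, ← hI]
  by_cases hc : s.mem 4 i = s.reg 22
  · by_cases hw : w = s.mem 5 i
    · simp [run, hi8, m4, m5, r20, r22, h20, hc, hw]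
    · simp [run, hi8, m4, m5, r20, r22, hc, hw, Ne.symm hw]
  · simp [run, hi8, m4, r22, hc]

/-- Look for a neighbour of the vertex in register 21 that is neither in the list, nor marked in
array 10, nor the vertex in register 22, and put it into register 23. -/
def privatePass : Prog :=
  forLt 8 4 (load 9 4 8 ;; ifEq 9 21 (load 10 5 8 ;; load 12 7 10 ;;
    ifEq 12 3 (load 13 10 10 ;; ifEq 13 3 (ifEq 10 22 skip (copy 23 10)) skip) skip) skip)

/-- The register is overwritten at each suitable arc, and any of them will do. The existence
hypothesis ensures that it does not retain an old value. -/
theorem privatePass_spec (s : State) (h3 : s.reg 3 = 0)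
    (hex : ∃ d < s.reg 4, s.mem 4 d = s.reg 21 ∧ s.mem 7 (s.mem 5 d) = 0 ∧
      s.mem 10 (s.mem 5 d) = 0 ∧ s.mem 5 d ≠ s.reg 22) :
    ∃ d < s.reg 4, s.mem 4 d = s.reg 21 ∧ s.mem 7 (s.mem 5 d) = 0 ∧
      s.mem 10 (s.mem 5 d) = 0 ∧ s.mem 5 d ≠ s.reg 22 ∧ (privatePass.run s).reg 23 = s.mem 5 d := by
  let P : ℕ → Prop := fun d => s.mem 4 d = s.reg 21 ∧ s.mem 7 (s.mem 5 d) = 0 ∧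
      s.mem 10 (s.mem 5 d) = 0 ∧ s.mem 5 d ≠ s.reg 22
  suffices h : (∃ d < s.reg 4, P d) → ∃ d < s.reg 4, P d ∧ (privatePass.run s).reg 23 = s.mem 5 d by
    obtain ⟨d, h1, ⟨h2, h3, h4, h5⟩, h6⟩ := h hex
    exact ⟨d, h1, h2, h3, h4, h5, h6⟩
  refine for_rule (by simp [wf, wreg]) s (fun i s' =>
    (∃ d < i, P d) → ∃ d < i, P d ∧ s'.reg 23 = s.mem 5 d) (by simp) ?_
  rintro i hi s' hi8 hreg hmem hI hex
  have m4 := hmem 4 (by simp [wmem])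
  have m5 := hmem 5 (by simp [wmem])
  have m7 := hmem 7 (by simp [wmem])
  have m10 := hmem 10 (by simp [wmem])
  have r3 := hreg 3 (by simp [wreg])
  have r21 := hreg 21 (by simp [wreg])
  have r22 := hreg 22 (by simp [wreg])
  by_cases hc : P i
  · refine ⟨i, by omega, hc, ?_⟩
    obtain ⟨h1, h2, h4, h5⟩ := hc
    simp [run, incr_reg, hi8, m4, m5, m7, m10, r3, r21, r22, h1, h2, h3, h4, h5]
  · have hex' : ∃ d < i, P d := by
      obtain ⟨d, hd, hP⟩ := hex
      rcases Nat.lt_succ_iff_lt_or_eq.1 hd with hd | rfl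
      exacts [⟨d, hd, hP⟩, absurd hP hc]
    obtain ⟨d, hd, hP, h23⟩ := hI hex'
    refine ⟨d, by omega, hP, ?_⟩
    rw [← h23]
    by_cases h1 : s.mem 4 i = s.reg 21
    · by_cases h2 : s.mem 7 (s.mem 5 i) = 0
      · by_cases h4 : s.mem 10 (s.mem 5 i) = 0
        · have h5 : s.mem 5 i = s.reg 22 := by
            by_contra h5
            exact hc ⟨h1, h2, h4, h5⟩
          simp [run, incr_reg, hi8, m4, m5, m7, m10, r3, r21, r22, h1, h2, h3, ← h5, h4]
        · simp [run, incr_reg, hi8, m4, m5, m7, m10, r3, r21, h1, h2, h3, h4]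
      · simp [run, incr_reg, hi8, m4, m5, m7, r3, r21, h1, h2, h3]
    · simp [run, incr_reg, hi8, m4, r21, h1]

end Modulator

/-! ### Signatures, and the greedy packing of induced paths -/

section Modulator

theorem ArcListing.symm {A : SimpleGraph ℕ} {M : ℕ} {src dst : ℕ → ℕ}
    (h : ArcListing A M src dst) {d : ℕ} (hd : d < M) :
    ∃ d' < M, src d' = dst d ∧ dst d' = src d :=
  (h.adj _ _).1 ((h.adj _ _).2 ⟨d, hd, rfl, rfl⟩).symm

/-- The neighbours of `u` that are not in the list with positions `pos`. -/
def liveNeighbours (M : ℕ) (src dst pos : ℕ → ℕ) (u : ℕ) : Finset ℕ :=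
  ((Finset.range M).filter fun d => src d = u ∧ pos (dst d) = 0).image dst

theorem mem_liveNeighbours {A : SimpleGraph ℕ} {M : ℕ} {src dst pos : ℕ → ℕ}
    (h : ArcListing A M src dst) {u w : ℕ} :
    w ∈ liveNeighbours M src dst pos u ↔ A.Adj u w ∧ pos w = 0 := by
  rw [h.adj]
  simp only [liveNeighbours, Finset.mem_image, Finset.mem_filter, Finset.mem_range]
  constructor
  · rintro ⟨d, ⟨h1, h2, h3⟩, rfl⟩
    exact ⟨⟨d, h1, h2, rfl⟩, h3⟩
  · rintro ⟨⟨d, h1, h2, rfl⟩, h3⟩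
    exact ⟨d, ⟨h1, h2, h3⟩, rfl⟩

section Signatures

variable {A : SimpleGraph ℕ} {M : ℕ} {src dst pos rep deg : ℕ → ℕ}

theorem card_liveNeighbours (h : ArcListing A M src dst) {u r g : ℕ}
    (hs : Signature M src dst pos u r g) : (liveNeighbours M src dst pos u).card = g := by
  rw [hs.deg_eq, liveNeighbours, Finset.card_image_of_injOn]
  intro d hd d' hd' hdd
  simp only [Finset.coe_filter, Finset.mem_range, Set.mem_ofPred_eq] at hd hd'
  exact h.inj d hd.1 d' hd'.1 (hd.2.1.trans hd'.2.1.symm) hdd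

theorem rep_eq_or_adj (h : ArcListing A M src dst) {u r g : ℕ}
    (hs : Signature M src dst pos u r g) : r = u ∨ A.Adj u r ∧ pos r = 0 := by
  refine hs.mem.imp_right ?_
  rintro ⟨d, hd, h1, h2, rfl⟩
  exact ⟨(h.adj _ _).2 ⟨d, hd, h1, rfl⟩, h2⟩

theorem rep_le_of_adj (h : ArcListing A M src dst) {u w r g : ℕ}
    (hs : Signature M src dst pos u r g) (hA : A.Adj u w) (hw : pos w = 0) : r ≤ w := by
  obtain ⟨d, hd, h1, rfl⟩ := (h.adj _ _).1 hA
  exact hs.le d hd h1 hw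

/-- Let the arc lead from a to b. If the smallest closed neighbour of a is below that of b, it is
itself the private neighbour: it is not a, because a is also a neighbour of b. If a has the larger
degree and no private neighbour, exchanging b for a maps the live neighbourhood of a into that of b,
against the degrees. -/
theorem exists_private_neighbour (h : ArcListing A M src dst)
    (hs : ∀ u, (∃ d < M, src d = u) → pos u = 0 → Signature M src dst pos u (rep u) (deg u))
    {d : ℕ} (hd : d < M) (hm : Mismatch src dst pos rep deg d) :
    ∃ x, A.Adj (src d) x ∧ pos x = 0 ∧ ¬ A.Adj (dst d) x ∧ x ≠ dst d := by
  obtain ⟨h1, h2, h3⟩ := hm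
  have hab : A.Adj (src d) (dst d) := (h.adj _ _).2 ⟨d, hd, rfl, rfl⟩
  obtain ⟨d', hd', he, -⟩ := h.symm hd
  have sa := hs _ ⟨d, hd, rfl⟩ h1
  have sb := hs _ ⟨d', hd', he⟩ h2
  rcases h3 with h3 | h3
  · have hb := rep_le_of_adj h sb hab.symm h1
    obtain ⟨hA, hp⟩ := (rep_eq_or_adj h sa).resolve_left (by omega)
    refine ⟨_, hA, hp, fun hA' => ?_, fun he => ?_⟩
    · have := rep_le_of_adj h sb hA' hp
      omega
    · have := sb.le_self
      omega
  · by_contra! hn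
    rw [← card_liveNeighbours h sa, ← card_liveNeighbours h sb] at h3
    have hsub : insert (src d) ((liveNeighbours M src dst pos (src d)).erase (dst d)) ⊆
        liveNeighbours M src dst pos (dst d) := by
      intro x hx
      rw [Finset.mem_insert, Finset.mem_erase] at hx
      rcases hx with rfl | ⟨hne, hx⟩
      · exact (mem_liveNeighbours h).2 ⟨hab.symm, h1⟩
      · obtain ⟨hA, hp⟩ := (mem_liveNeighbours h).1 hx
        exact (mem_liveNeighbours h).2 ⟨by_contra fun hA' => hne (hn x hA hp hA'), hp⟩
    have := Finset.card_le_card hsub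
    rw [Finset.card_insert_of_notMem, Finset.card_erase_of_mem] at this
    · have : 0 < (liveNeighbours M src dst pos (src d)).card :=
        Finset.card_pos.2 ⟨dst d, (mem_liveNeighbours h).2 ⟨hab, h2⟩⟩
      omega
    · exact (mem_liveNeighbours h).2 ⟨hab, h2⟩
    · intro hx
      exact A.loopless.irrefl _ ((mem_liveNeighbours h).1 (Finset.mem_of_mem_erase hx)).1

/-- The values `rep` name the connected components of the graph without the vertices with
`pos ≠ 0` (and without the isolated vertices of the graph), which are cliques. -/
def NamesCliques (A : SimpleGraph ℕ) (pos rep : ℕ → ℕ) : Prop :=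
  ∀ w w', pos w = 0 → pos w' = 0 → (∃ z, A.Adj w z) → (∃ z, A.Adj w' z) →
    (rep w = rep w' ↔ w = w' ∨ A.Adj w w')

/-- Both orientations of each edge are listed, so `rep` and `deg` are constant along live edges. Let
w and w' share the name r, both different from r. Each live neighbour x of w also has name r, so it
is r or adjacent to r. Hence the live neighbourhood of w, with r exchanged for w, lies in that of r
and, the degrees being equal, is all of it. As w' is a neighbour of r, it is w or a neighbour of w.
-/
theorem namesCliques_of_no_mismatch (h : ArcListing A M src dst)
    (hs : ∀ u, (∃ d < M, src d = u) → pos u = 0 → Signature M src dst pos u (rep u) (deg u))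
    (hm : ∀ d < M, ¬ Mismatch src dst pos rep deg d) : NamesCliques A pos rep := by
  replace hs : ∀ u, (∃ z, A.Adj u z) → pos u = 0 →
      Signature M src dst pos u (rep u) (deg u) := by
    rintro u ⟨z, hz⟩ hu
    obtain ⟨d, hd, h1, -⟩ := (h.adj _ _).1 hz
    exact hs u ⟨d, hd, h1⟩ hu
  have hle : ∀ u w, A.Adj u w → pos u = 0 → pos w = 0 → rep w ≤ rep u ∧ deg u ≤ deg w := by
    intro u w hA hu hw
    obtain ⟨d, hd, rfl, rfl⟩ := (h.adj _ _).1 hA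
    have := hm d hd
    simp only [Mismatch, hu, hw, true_and, not_or, not_lt] at this
    exact this
  have heq : ∀ u w, A.Adj u w → pos u = 0 → pos w = 0 → rep u = rep w ∧ deg u = deg w :=
    fun u w hA hu hw => ⟨le_antisymm (hle w u hA.symm hw hu).1 (hle u w hA hu hw).1,
      le_antisymm (hle u w hA hu hw).2 (hle w u hA.symm hw hu).2⟩
  intro w w' hw hw' hz hz'
  constructor
  · intro hr
    by_contra! hn
    have h1 := rep_eq_or_adj h (hs w hz hw)
    have h2 := rep_eq_or_adj h (hs w' hz' hw')
    rw [← hr] at h2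
    rcases h1 with h1 | ⟨h1, hp⟩
    · rw [h1] at h2
      rcases h2 with h2 | h2
      exacts [hn.1 h2, hn.2 h2.1.symm]
    rcases h2 with h2 | ⟨h2, -⟩
    · rw [h2] at h1; exact hn.2 h1
    set r := rep w
    have hsub : insert w ((liveNeighbours M src dst pos w).erase r) ⊆
        liveNeighbours M src dst pos r := by
      intro x hx
      rw [Finset.mem_insert, Finset.mem_erase] at hx
      rcases hx with rfl | ⟨hne, hx⟩
      · exact (mem_liveNeighbours h).2 ⟨h1.symm, hw⟩
      · obtain ⟨hA, hpx⟩ := (mem_liveNeighbours h).1 hx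
        have hrx : rep x = r := (heq w x hA hw hpx).1.symm
        rcases rep_eq_or_adj h (hs x ⟨w, hA.symm⟩ hpx) with h3 | h3
        · exact absurd (h3.symm.trans hrx) hne
        · rw [hrx] at h3
          exact (mem_liveNeighbours h).2 ⟨h3.1.symm, hpx⟩
    have hmem : r ∈ liveNeighbours M src dst pos w := (mem_liveNeighbours h).2 ⟨h1, hp⟩
    have hcard : (liveNeighbours M src dst pos r).card ≤
        (insert w ((liveNeighbours M src dst pos w).erase r)).card := by
      rw [Finset.card_insert_of_notMem, Finset.card_erase_of_mem hmem,
        card_liveNeighbours h (hs w hz hw), card_liveNeighbours h (hs r ⟨w, h1.symm⟩ hp),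
        (heq w r h1 hw hp).2]
      · omega
      · intro hx
        exact A.loopless.irrefl _ ((mem_liveNeighbours h).1 (Finset.mem_of_mem_erase hx)).1
    have hw'mem : w' ∈ liveNeighbours M src dst pos r := (mem_liveNeighbours h).2 ⟨h2.symm, hw'⟩
    rw [← Finset.eq_of_subset_of_card_le hsub hcard, Finset.mem_insert, Finset.mem_erase] at hw'mem
    rcases hw'mem with h3 | ⟨-, h3⟩
    · exact hn.1 h3.symm
    · exact hn.2 ((mem_liveNeighbours h).1 h3).1
  · rintro (rfl | hA)
    exacts [rfl, (heq w w' hA hw hw').1]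

end Signatures

/-- `names` lists `p` distinct vertices of positive degree, and `pos` gives their positions,
counted from one. -/
structure IsVertexList (A : SimpleGraph ℕ) (names pos : ℕ → ℕ) (p : ℕ) : Prop where
  pos_names : ∀ j < p, pos (names j) = j + 1
  names_pos : ∀ w, pos w ≠ 0 → pos w ≤ p ∧ names (pos w - 1) = w
  exists_adj : ∀ w, pos w ≠ 0 → ∃ z, A.Adj w z

theorem IsVertexList.add {A : SimpleGraph ℕ} {names pos : ℕ → ℕ} {p y : ℕ}
    (h : IsVertexList A names pos p) (hy : pos y = 0) (hA : ∃ z, A.Adj y z) :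
    IsVertexList A (Function.update names p y) (Function.update pos y (p + 1)) (p + 1) := by
  refine ⟨fun j hj => ?_, fun w hw => ?_, fun w hw => ?_⟩
  · rcases Nat.lt_succ_iff_lt_or_eq.1 hj with hj | rfl
    · have h1 := h.pos_names j hj
      have h2 : names j ≠ y := by rintro rfl; omega
      rw [Function.update_of_ne hj.ne, Function.update_of_ne h2, h1]
    · simp
  · by_cases hwy : w = y
    · subst hwy; simp
    · rw [Function.update_of_ne hwy] at hw ⊢
      obtain ⟨h1, h2⟩ := h.names_pos w hw
      exact ⟨by omega, by rw [Function.update_of_ne (by omega), h2]⟩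
  · by_cases hwy : w = y
    · exact hwy ▸ hA
    · rw [Function.update_of_ne hwy] at hw
      exact h.exists_adj w hw

theorem IsVertexList.injOn {A : SimpleGraph ℕ} {names pos : ℕ → ℕ} {p : ℕ}
    (h : IsVertexList A names pos p) : Set.InjOn names (Set.Iio p) := by
  intro i hi j hj hij
  have := h.pos_names i hi
  rw [hij, h.pos_names j hj] at this
  omega

/-- `T` meets every induced path on three vertices. -/
def Hits (A : SimpleGraph ℕ) (T : Finset ℕ) : Prop :=
  ∀ a b c, InducedPath A a b c → a ∈ T ∨ b ∈ T ∨ c ∈ T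

/-- Every set meeting all induced paths contains a third of the first `p` listed vertices. -/
def IsPacking (A : SimpleGraph ℕ) (names : ℕ → ℕ) (p : ℕ) : Prop :=
  ∀ T, Hits A T → p ≤ 3 * ((Finset.range p).filter fun j => names j ∈ T).card

/-- One of the three new positions is hit. The ends of the mismatched arc are appended before the
private neighbour, so the middle vertex of the path stands first. -/
theorem IsPacking.add {A : SimpleGraph ℕ} {names names' : ℕ → ℕ} {p : ℕ}
    (h : IsPacking A names p) (hn : ∀ j < p, names' j = names j)
    (hp : InducedPath A (names' (p + 2)) (names' p) (names' (p + 1))) :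
    IsPacking A names' (p + 3) := by
  intro T hT
  have h1 := h T hT
  have heq : ((Finset.range p).filter fun j => names' j ∈ T) =
      (Finset.range p).filter fun j => names j ∈ T :=
    Finset.filter_congr fun j hj => by rw [hn j (Finset.mem_range.1 hj)]
  rw [show p + 3 = p + 1 + 1 + 1 from rfl, Finset.range_add_one, Finset.range_add_one,
    Finset.range_add_one]
  simp only [Finset.filter_insert]
  rw [heq]
  rcases hT _ _ _ hp with h2 | h2 | h2 <;> simp only [h2, if_true]
  all_goals
    split_ifs <;> simp <;> omega

theorem IsPacking.le {A : SimpleGraph ℕ} {names pos : ℕ → ℕ} {p : ℕ} (h : IsPacking A names p)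
    (hl : IsVertexList A names pos p) {T : Finset ℕ} (hT : Hits A T) : p ≤ 3 * T.card := by
  refine (h T hT).trans (Nat.mul_le_mul_left 3 ?_)
  refine Finset.card_le_card_of_injOn names (fun j hj => ?_) (hl.injOn.mono fun j hj => ?_)
  · exact (Finset.mem_filter.1 hj).2
  · exact Finset.mem_range.1 (Finset.mem_filter.1 hj).1

/-- Append the vertex in register `y` to the list. -/
def addVertex (y : ℕ) : Prog :=
  store 2 5 y ;; inc 5 ;; store 7 y 5

theorem addVertex_run (s : State) (y : ℕ) (hy : y ≠ 5) (hy' : y ≠ 99) :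
    ((addVertex y).run s).mem 2 = Function.update (s.mem 2) (s.reg 5) (s.reg y) ∧
    ((addVertex y).run s).mem 7 = Function.update (s.mem 7) (s.reg y) (s.reg 5 + 1) ∧
    ((addVertex y).run s).reg 5 = s.reg 5 + 1 := by
  simp [addVertex, run, incr_reg, hy, hy']

/-- Find an induced path on three vertices outside the list and append its vertices, or set
register 24 if there is none. -/
def packingRound : Prog :=
  resetPass ;; signaturePass ;; detectPass ;; ifEq 20 3 (const 24 1)
    (neighbourPass ;; privatePass ;; addVertex 21 ;; addVertex 22 ;; addVertex 23)

/-- A mismatched arc (a, b) and a private neighbour x of a form the induced path x, a, b outside the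
list. Without a mismatch the signatures name the cliques. -/
theorem packingRound_spec {A : SimpleGraph ℕ} (s : State) (h3 : s.reg 3 = 0) (h24 : s.reg 24 = 0)
    (hA : ArcListing A (s.reg 4) (s.mem 4) (s.mem 5))
    (hl : IsVertexList A (s.mem 2) (s.mem 7) (s.reg 5)) (hp : IsPacking A (s.mem 2) (s.reg 5)) :
    IsVertexList A ((packingRound.run s).mem 2) ((packingRound.run s).mem 7)
      ((packingRound.run s).reg 5) ∧
    IsPacking A ((packingRound.run s).mem 2) ((packingRound.run s).reg 5) ∧
    (((packingRound.run s).reg 24 = 1 ∧ (packingRound.run s).reg 5 = s.reg 5 ∧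
      NamesCliques A ((packingRound.run s).mem 7) ((packingRound.run s).mem 8)) ∨
    ((packingRound.run s).reg 24 = 0 ∧ (packingRound.run s).reg 5 = s.reg 5 + 3)) := by
  set s1 := resetPass.run s with hs1
  set s2 := signaturePass.run s1 with hs2
  set s3 := detectPass.run s2 with hs3
  have R1 : ∀ r, r ∉ resetPass.wreg → s1.reg r = s.reg r := fun r hr => run_reg _ _ _ hr
  have M1 : ∀ r, r ∉ resetPass.wmem → s1.mem r = s.mem r := fun r hr => run_mem _ _ _ hr
  have R2 : ∀ r, r ∉ signaturePass.wreg → s2.reg r = s1.reg r := fun r hr => run_reg _ _ _ hr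
  have M2 : ∀ r, r ∉ signaturePass.wmem → s2.mem r = s1.mem r := fun r hr => run_mem _ _ _ hr
  have R3 : ∀ r, r ∉ detectPass.wreg → s3.reg r = s2.reg r := fun r hr => run_reg _ _ _ hr
  have M3 : ∀ r, r ∉ detectPass.wmem → s3.mem r = s2.mem r := fun r hr => run_mem _ _ _ hr
  have e1 : s1.reg 3 = 0 ∧ s1.reg 4 = s.reg 4 ∧ s1.reg 5 = s.reg 5 ∧ s1.reg 24 = 0 := by
    rw [R1 3 (by decide), R1 4 (by decide), R1 5 (by decide), R1 24 (by decide)]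
    exact ⟨h3, rfl, rfl, h24⟩
  have e2 : s2.reg 3 = 0 ∧ s2.reg 4 = s.reg 4 ∧ s2.reg 5 = s.reg 5 ∧ s2.reg 24 = 0 := by
    rw [R2 3 (by decide), R2 4 (by decide), R2 5 (by decide), R2 24 (by decide)]
    exact e1
  have e3 : s3.reg 3 = 0 ∧ s3.reg 4 = s.reg 4 ∧ s3.reg 5 = s.reg 5 ∧ s3.reg 24 = 0 := by
    rw [R3 3 (by decide), R3 4 (by decide), R3 5 (by decide), R3 24 (by decide)]
    exact e2
  have f1 : s1.mem 2 = s.mem 2 ∧ s1.mem 4 = s.mem 4 ∧ s1.mem 5 = s.mem 5 ∧ s1.mem 7 = s.mem 7 := by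
    rw [M1 2 (by decide), M1 4 (by decide), M1 5 (by decide), M1 7 (by decide)]
    exact ⟨rfl, rfl, rfl, rfl⟩
  have f2 : s2.mem 2 = s.mem 2 ∧ s2.mem 4 = s.mem 4 ∧ s2.mem 5 = s.mem 5 ∧ s2.mem 7 = s.mem 7 := by
    rw [M2 2 (by decide), M2 4 (by decide), M2 5 (by decide), M2 7 (by decide)]
    exact f1
  have f3 : s3.mem 2 = s.mem 2 ∧ s3.mem 4 = s.mem 4 ∧ s3.mem 5 = s.mem 5 ∧ s3.mem 7 = s.mem 7 ∧
      s3.mem 8 = s2.mem 8 ∧ s3.mem 10 = s1.mem 10 := by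
    rw [M3 2 (by decide), M3 4 (by decide), M3 5 (by decide), M3 7 (by decide), M3 8 (by decide),
      M3 10 (by decide), M2 10 (by decide)]
    exact ⟨f2.1, f2.2.1, f2.2.2.1, f2.2.2.2, rfl, rfl⟩
  have hreset := resetPass_spec s h3
  rw [← hs1] at hreset
  have hsig : ∀ u, (∃ d < s.reg 4, s.mem 4 d = u) → s.mem 7 u = 0 →
      Signature (s.reg 4) (s.mem 4) (s.mem 5) (s.mem 7) u (s2.mem 8 u) (s2.mem 9 u) := by
    have := signaturePass_spec s1 e1.1 (by rw [e1.2.1, f1.2.1]; exact fun d hd => (hreset d hd).1)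
      (by rw [e1.2.1, f1.2.1]; exact fun d hd => (hreset d hd).2.1)
    rwa [e1.2.1, f1.2.1, f1.2.2.1, f1.2.2.2, ← hs2] at this
  have hdet := detectPass_spec s2 e2.1
  rw [e2.2.1, f2.2.1, f2.2.2.1, f2.2.2.2, ← hs3] at hdet
  rcases hdet with ⟨h20, hdet⟩ | ⟨h20, d, hd, hmis, h21, h22⟩
  · have hrun : packingRound.run s = s3.setReg 24 1 := by
      rw [packingRound, run, run, run, ← hs1, ← hs2, ← hs3, run, h20, e3.1, if_pos rfl, run]
    rw [hrun]
    simp only [State.mem_setReg, State.reg_setReg, f3, e3, Nat.reduceEqDiff, if_false, if_true]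
    exact ⟨hl, hp, .inl ⟨trivial, trivial, namesCliques_of_no_mismatch hA hsig hdet⟩⟩
  · set s4 := neighbourPass.run s3 with hs4
    set s5 := privatePass.run s4 with hs5
    have hrun : packingRound.run s =
        (addVertex 23).run ((addVertex 22).run ((addVertex 21).run s5)) := by
      rw [packingRound, run, run, run, ← hs1, ← hs2, ← hs3, run, h20, e3.1, if_neg (by decide), run,
        run, run, run]
    obtain ⟨x, hax, hpx, hbx, hxb⟩ := exists_private_neighbour hA hsig hd hmis
    have R4 : ∀ r, r ∉ neighbourPass.wreg → s4.reg r = s3.reg r := fun r hr => run_reg _ _ _ hr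
    have M4 : ∀ r, r ∉ neighbourPass.wmem → s4.mem r = s3.mem r := fun r hr => run_mem _ _ _ hr
    have R5 : ∀ r, r ∉ privatePass.wreg → s5.reg r = s4.reg r := fun r hr => run_reg _ _ _ hr
    have M5 : ∀ r, r ∉ privatePass.wmem → s5.mem r = s4.mem r := fun r hr => run_mem _ _ _ hr
    have e4 : s4.reg 3 = 0 ∧ s4.reg 4 = s.reg 4 ∧ s4.reg 5 = s.reg 5 ∧ s4.reg 24 = 0 ∧
        s4.reg 21 = s.mem 4 d ∧ s4.reg 22 = s.mem 5 d := by
      rw [R4 3 (by decide), R4 4 (by decide), R4 5 (by decide), R4 24 (by decide),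
        R4 21 (by decide), R4 22 (by decide)]
      exact ⟨e3.1, e3.2.1, e3.2.2.1, e3.2.2.2, h21, h22⟩
    have f4 : s4.mem 2 = s.mem 2 ∧ s4.mem 4 = s.mem 4 ∧ s4.mem 5 = s.mem 5 ∧
        s4.mem 7 = s.mem 7 := by
      rw [M4 2 (by decide), M4 4 (by decide), M4 5 (by decide), M4 7 (by decide)]
      exact ⟨f3.1, f3.2.1, f3.2.2.1, f3.2.2.2.1⟩
    have e5 : s5.reg 5 = s.reg 5 ∧ s5.reg 24 = 0 ∧ s5.reg 21 = s.mem 4 d ∧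
        s5.reg 22 = s.mem 5 d := by
      rw [R5 5 (by decide), R5 24 (by decide), R5 21 (by decide), R5 22 (by decide)]
      exact ⟨e4.2.2.1, e4.2.2.2.1, e4.2.2.2.2⟩
    have f5 : s5.mem 2 = s.mem 2 ∧ s5.mem 7 = s.mem 7 := by
      rw [M5 2 (by decide), M5 7 (by decide)]
      exact ⟨f4.1, f4.2.2.2⟩
    have hmark : ∀ d' < s.reg 4, s4.mem 10 (s.mem 5 d') = 0 ↔
        ¬ A.Adj (s.mem 5 d) (s.mem 5 d') := by
      intro d' hd'
      obtain ⟨d'', hd'', h1, -⟩ := hA.symm hd'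
      have h10 : s3.mem 10 (s.mem 5 d') = 0 := by
        rw [f3.2.2.2.2.2, ← h1]; exact (hreset d'' hd'').2.2
      have := neighbourPass_spec s3 h20 _ h10
      rw [← hs4, e3.2.1, f3.2.1, f3.2.2.1, h22] at this
      rw [this, hA.adj]
      push Not
      rfl
    have hpriv := privatePass_spec s4 e4.1 (by
      rw [e4.2.1, f4.2.1, f4.2.2.1, f4.2.2.2, e4.2.2.2.2.1, e4.2.2.2.2.2]
      obtain ⟨d', hd', h1, rfl⟩ := (hA.adj _ _).1 hax
      exact ⟨d', hd', h1, hpx, (hmark d' hd').2 hbx, hxb⟩)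
    rw [e4.2.1, f4.2.1, f4.2.2.1, f4.2.2.2, e4.2.2.2.2.1, e4.2.2.2.2.2, ← hs5] at hpriv
    obtain ⟨d', hd', g1, g2, g3, g4, g5⟩ := hpriv
    rw [hmark d' hd'] at g3
    obtain ⟨p1, p2, -⟩ := hmis
    have hax' : A.Adj (s.mem 4 d) (s.mem 5 d') := (hA.adj _ _).2 ⟨d', hd', g1, rfl⟩
    have hab : A.Adj (s.mem 4 d) (s.mem 5 d) := (hA.adj _ _).2 ⟨d, hd, rfl, rfl⟩
    generalize s.mem 4 d = a at *
    generalize s.mem 5 d = b at *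
    generalize s.mem 5 d' = x at *
    obtain ⟨q1, q2, q3⟩ := addVertex_run s5 21 (by decide) (by decide)
    rw [f5.1, e5.1, e5.2.2.1] at q1
    rw [f5.2, e5.1, e5.2.2.1] at q2
    rw [e5.1] at q3
    have q4 : ((addVertex 21).run s5).reg 22 = b := by
      rw [run_reg _ _ _ (by decide)]; exact e5.2.2.2
    have q5 : ((addVertex 21).run s5).reg 23 = x := by
      rw [run_reg _ _ _ (by decide)]; exact g5
    set s6 := (addVertex 21).run s5
    obtain ⟨t1, t2, t3⟩ := addVertex_run s6 22 (by decide) (by decide)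
    rw [q3, q4, q1] at t1
    rw [q3, q4, q2] at t2
    rw [q3] at t3
    have t5 : ((addVertex 22).run s6).reg 23 = x := by
      rw [run_reg _ _ _ (by decide)]; exact q5
    have h24' : (packingRound.run s).reg 24 = 0 := by
      rw [hrun, run_reg _ _ _ (by decide), run_reg _ _ _ (by decide), run_reg _ _ _ (by decide)]
      exact e5.2.1
    set s7 := (addVertex 22).run s6
    obtain ⟨w1, w2, w3⟩ := addVertex_run s7 23 (by decide) (by decide)
    rw [t3, t5, t1] at w1
    rw [t3, t5, t2] at w2
    rw [t3] at w3
    refine ⟨?_, ?_, .inr ⟨h24', ?_⟩⟩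
    · rw [hrun, w1, w2, w3]
      refine ((hl.add p1 ⟨b, hab⟩).add ?_ ⟨a, hab.symm⟩).add ?_ ⟨a, hax'.symm⟩
      · rw [Function.update_of_ne hab.ne', p2]
      · rw [Function.update_of_ne g4, Function.update_of_ne hax'.ne', g2]
    · rw [hrun, w1, w3]
      refine hp.add (fun j hj => ?_) ?_
      · rw [Function.update_of_ne (by omega), Function.update_of_ne (by omega),
          Function.update_of_ne (by omega)]
      · simp only [Function.update_apply, show s.reg 5 ≠ s.reg 5 + 1 + 1 by omega,
          show s.reg 5 ≠ s.reg 5 + 1 by omega, show s.reg 5 + 1 ≠ s.reg 5 + 1 + 1 by omega,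
          if_true, if_false]
        exact ⟨hax'.symm, hab, g4, fun h => g3 h.symm⟩
    · rw [hrun, w3]

/-- Repeat `packingRound` until there is no induced path on three vertices outside the list. -/
def modulatorPhase : Prog :=
  copy 25 1 ;; inc 25 ;; forLt 26 25 (ifEq 24 3 packingRound skip)

/-- Loops need a bound known beforehand, and k is unknown, so the loop runs m+1 times. Once the flag
is set, a round costs only six steps, and the expensive rounds are charged to the listed vertices.
The set `T` only serves to show that the flag is set in time. -/
theorem modulatorPhase_spec {A : SimpleGraph ℕ} (s : State) (h3 : s.reg 3 = 0)
    (h24 : s.reg 24 = 0) (h5 : s.reg 5 = 0) (h7 : s.mem 7 = fun _ => 0)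
    (hA : ArcListing A (s.reg 4) (s.mem 4) (s.mem 5))
    {T : Finset ℕ} (hT : Hits A T) (hTm : T.card ≤ s.reg 1) :
    IsVertexList A ((modulatorPhase.run s).mem 2) ((modulatorPhase.run s).mem 7)
      ((modulatorPhase.run s).reg 5) ∧
    IsPacking A ((modulatorPhase.run s).mem 2) ((modulatorPhase.run s).reg 5) ∧
    NamesCliques A ((modulatorPhase.run s).mem 7) ((modulatorPhase.run s).mem 8) ∧
    modulatorPhase.time s ≤ ((modulatorPhase.run s).reg 5 + 1) *
      (packingRound.cost (fun _ => s.reg 4) + 6) + 6 * (s.reg 1 + 1) + 5 := by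
  have hcost : ∀ s' : State, s'.reg 4 = s.reg 4 →
      packingRound.time s' ≤ packingRound.cost (fun _ => s.reg 4) := by
    intro s' h4
    have hlim : ∀ r ∈ packingRound.limits, r = 4 := by decide
    exact time_le_cost _ _ _ (fun r hr => by rw [hlim r hr, h4])
      (fun r hr => by rw [hlim r hr]; decide)
  set K := packingRound.cost (fun _ => s.reg 4)
  set s0 := incr (s.setReg 25 (s.reg 1)) 25 with hs0
  have r25 : s0.reg 25 = s.reg 1 + 1 := by simp [hs0, incr_reg]
  have r3 : s0.reg 3 = 0 := by simp [hs0, incr_reg, h3]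
  have r4 : s0.reg 4 = s.reg 4 := by simp [hs0, incr_reg]
  have r5 : s0.reg 5 = 0 := by simp [hs0, incr_reg, h5]
  have r24 : s0.reg 24 = 0 := by simp [hs0, incr_reg, h24]
  have hm : s0.mem = s.mem := rfl
  have hrun : modulatorPhase.run s = (forLt 26 25 (ifEq 24 3 packingRound skip)).run s0 := rfl
  have htime : modulatorPhase.time s =
      1 + (2 + (forLt 26 25 (ifEq 24 3 packingRound skip)).time s0) := rfl
  have main := for_rule_time (i := 26) (n := 25) (c := ifEq 24 3 packingRound skip)
    (by simp [wf, wreg, packingRound, resetPass, signaturePass, detectPass, neighbourPass,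
      privatePass, addVertex]) s0
    (fun j s' τ => IsVertexList A (s'.mem 2) (s'.mem 7) (s'.reg 5) ∧
      IsPacking A (s'.mem 2) (s'.reg 5) ∧ ∃ t, s'.reg 5 = 3 * t ∧
        ((s'.reg 24 = 0 ∧ t = j ∧ τ ≤ t * (K + 6)) ∨
        (s'.reg 24 = 1 ∧ NamesCliques A (s'.mem 7) (s'.mem 8) ∧ τ ≤ (t + 1) * (K + 6) + 6 * j)))
    ?_ ?_
  · obtain ⟨τ, h1, h2, h4, t, ht, h⟩ := main
    rw [htime, h1, hrun]
    refine ⟨h2, h4, ?_⟩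
    rw [r25] at h
    have hle := h4.le h2 hT
    -- With the flag unset, m+1 paths would have been packed, against 3t ≤ 3|T| ≤ 3m.
    rcases h with ⟨-, h, -⟩ | ⟨-, h, hτ⟩
    · omega
    · refine ⟨h, ?_⟩
      have : (t + 1) * (K + 6) ≤ (3 * t + 1) * (K + 6) := Nat.mul_le_mul_right _ (by omega)
      rw [ht]; omega
  · simp only [State.reg_setReg, State.mem_setReg, r5, r24, hm, h7, Nat.reduceEqDiff, if_false]
    exact ⟨⟨by simp, by simp, by simp⟩, fun T _ => by simp, 0, rfl, .inl ⟨trivial, rfl, by simp⟩⟩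
  · rintro j hj s' τ h26 hreg hmem ⟨hl, hp, t, ht, h⟩
    have r3' := (hreg 3 (by decide)).trans r3
    have r4' := (hreg 4 (by decide)).trans r4
    have m4' := hmem 4 (by decide)
    have m5' := hmem 5 (by decide)
    rw [hm] at m4' m5'
    simp only [incr_mem, incr_reg _ 26 _ (by decide : (26 : ℕ) ≠ 99), Nat.reduceEqDiff, if_false]
    rcases h with ⟨h24', rfl, hτ⟩ | ⟨h24', hc, hτ⟩
    · have hr : (ifEq 24 3 packingRound skip).run s' = packingRound.run s' := by
        simp [run, h24', r3']
      have htm : (ifEq 24 3 packingRound skip).time s' = packingRound.time s' + 2 := by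
        simp [time, h24', r3']
      have hct := hcost s' r4'
      rw [hr, htm]
      obtain ⟨k1, k2, k3⟩ := packingRound_spec s' r3' h24'
        (by rw [r4', m4', m5']; exact hA) hl hp
      refine ⟨k1, k2, ?_⟩
      rcases k3 with ⟨k3, k4, k5⟩ | ⟨k3, k4⟩
      · exact ⟨t, by omega, .inr ⟨k3, k5, by rw [Nat.add_mul]; omega⟩⟩
      · exact ⟨t + 1, by omega, .inl ⟨k3, rfl, by rw [Nat.add_mul]; omega⟩⟩
    · have hr : (ifEq 24 3 packingRound skip).run s' = s' := by simp [run, h24', r3']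
      have htm : (ifEq 24 3 packingRound skip).time s' = 3 := by simp [time, h24', r3']
      rw [hr, htm]
      exact ⟨hl, hp, t, ht, .inr ⟨h24', hc, by omega⟩⟩

end Modulator

/-! ### Selecting cliques and marking vertices for one vertex of the modulator -/

section Marking

/-- Mark the neighbours of the vertex `v` in register 31 with a stamp (register 30) in array 11,
and select with the same stamp, in array 12, cliques that contain a neighbour of `v`, but no more
than register 27 allows. -/
def selectPass : Prog :=
  const 29 0 ;;
  forLt 8 4 (load 9 4 8 ;; ifEq 9 31 (load 10 5 8 ;; store 11 10 30 ;; load 11 8 10 ;;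
    load 12 12 11 ;; ifEq 12 30 skip (ifLt 29 27
      (store 12 11 30 ;; store 13 11 3 ;; store 14 11 3 ;; inc 29) skip)) skip)

/-- The stamp exceeds all old entries of arrays 11 and 12, so a cell contains it only if it was
written in this pass, and no array has to be cleared. The counters of a clique are zeroed when it is
selected. `Q` collects the selected names. If the limit was not reached, no clique with a neighbour
was refused. -/
theorem selectPass_spec (s : State) (h3 : s.reg 3 = 0) (h11 : ∀ w, s.mem 11 w < s.reg 30)
    (h12 : ∀ c, s.mem 12 c < s.reg 30) :
    (∀ w, (selectPass.run s).mem 11 w = s.reg 30 ↔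
      ∃ d < s.reg 4, s.mem 4 d = s.reg 31 ∧ s.mem 5 d = w) ∧
    (∀ w, (selectPass.run s).mem 11 w ≤ s.reg 30) ∧
    (∀ c, (selectPass.run s).mem 12 c ≤ s.reg 30) ∧
    ∃ Q : Finset ℕ, (∀ c, c ∈ Q ↔ (selectPass.run s).mem 12 c = s.reg 30) ∧
      Q.card = (selectPass.run s).reg 29 ∧ Q.card ≤ s.reg 27 ∧
      (∀ c ∈ Q, (selectPass.run s).mem 13 c = 0 ∧ (selectPass.run s).mem 14 c = 0 ∧
        ∃ d < s.reg 4, s.mem 4 d = s.reg 31 ∧ s.mem 8 (s.mem 5 d) = c) ∧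
      ∀ d < s.reg 4, s.mem 4 d = s.reg 31 → s.mem 8 (s.mem 5 d) ∈ Q ∨ Q.card = s.reg 27 := by
  refine for_rule (s := s.setReg 29 0) (by simp [wf, wreg]) (fun i s' =>
    (∀ w, s'.mem 11 w = s.reg 30 ↔ ∃ d < i, s.mem 4 d = s.reg 31 ∧ s.mem 5 d = w) ∧
    (∀ w, s'.mem 11 w ≤ s.reg 30) ∧ (∀ c, s'.mem 12 c ≤ s.reg 30) ∧
    ∃ Q : Finset ℕ, (∀ c, c ∈ Q ↔ s'.mem 12 c = s.reg 30) ∧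
      Q.card = s'.reg 29 ∧ Q.card ≤ s.reg 27 ∧
      (∀ c ∈ Q, s'.mem 13 c = 0 ∧ s'.mem 14 c = 0 ∧
        ∃ d < i, s.mem 4 d = s.reg 31 ∧ s.mem 8 (s.mem 5 d) = c) ∧
      ∀ d < i, s.mem 4 d = s.reg 31 → s.mem 8 (s.mem 5 d) ∈ Q ∨ Q.card = s.reg 27) ?_ ?_
  · simp only [State.mem_setReg, State.reg_setReg]
    exact ⟨fun w => by simpa using (h11 w).ne, fun w => (h11 w).le, fun w => (h12 w).le, ∅,
      fun c => by simpa using (h12 c).ne, by simp⟩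
  rintro i hi s' hi8 hreg hmem ⟨hI1, hI2, hI3, Q, hQ, hQ29, hQL, hI4, hI5⟩
  have m4 := hmem 4 (by decide)
  have m5 := hmem 5 (by decide)
  have m8 := hmem 8 (by decide)
  have r3 := hreg 3 (by decide)
  have r27 := hreg 27 (by decide)
  have r30 := hreg 30 (by decide)
  have r31 := hreg 31 (by decide)
  simp only [State.mem_setReg, State.reg_setReg, Nat.reduceEqDiff, if_false, h3]
    at m4 m5 m8 r3 r27 r30 r31
  by_cases hv : s.mem 4 i = s.reg 31
  swap
  · simp only [run, State.reg_setReg, State.mem_setReg, incr_mem, incr_reg, hi8, m4, r31, hv,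
      Nat.reduceEqDiff, if_true, if_false, ne_eq, not_false_eq_true]
    refine ⟨fun w => ?_, hI2, hI3, Q, hQ, hQ29, hQL, fun c hc => ?_, fun d hd hdv => ?_⟩
    · rw [hI1, Nat.exists_lt_succ_right]
      simp [hv]
    · obtain ⟨h1, h2, d, hd, h⟩ := hI4 c hc
      exact ⟨h1, h2, d, by omega, h⟩
    · rcases Nat.lt_succ_iff_lt_or_eq.1 hd with hd | rfl
      exacts [hI5 d hd hdv, absurd hdv hv]
  have hnb : ∀ w, Function.update (s'.mem 11) (s.mem 5 i) (s.reg 30) w = s.reg 30 ↔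
      ∃ d < i + 1, s.mem 4 d = s.reg 31 ∧ s.mem 5 d = w := by
    intro w
    rw [Nat.exists_lt_succ_right, ← hI1, Function.update_apply]
    by_cases hw : w = s.mem 5 i
    · simp [hw, hv]
    · simp [hw, Ne.symm hw]
  have hnb' : ∀ w, Function.update (s'.mem 11) (s.mem 5 i) (s.reg 30) w ≤ s.reg 30 := by
    intro w
    rw [Function.update_apply]
    split_ifs
    exacts [le_rfl, hI2 w]
  have hI4' : ∀ c ∈ Q, s'.mem 13 c = 0 ∧ s'.mem 14 c = 0 ∧
      ∃ d < i + 1, s.mem 4 d = s.reg 31 ∧ s.mem 8 (s.mem 5 d) = c := by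
    intro c hc
    obtain ⟨h1, h2, d, hd, h⟩ := hI4 c hc
    exact ⟨h1, h2, d, by omega, h⟩
  by_cases hsel : s'.mem 12 (s.mem 8 (s.mem 5 i)) = s.reg 30
  · simp only [run, State.reg_setReg, State.mem_setReg, State.reg_setMem, State.mem_setMem,
      incr_mem, incr_reg, hi8, m4, m5, m8, r30, r31, hv, hsel,
      Nat.reduceEqDiff, if_true, if_false, ne_eq, not_false_eq_true]
    refine ⟨hnb, hnb', hI3, Q, hQ, hQ29, hQL, hI4', fun d hd hdv => ?_⟩
    rcases Nat.lt_succ_iff_lt_or_eq.1 hd with hd | rfl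
    exacts [hI5 d hd hdv, .inl ((hQ _).2 hsel)]
  · by_cases hlt : s'.reg 29 < s.reg 27
    · simp only [run, State.reg_setReg, State.mem_setReg, State.reg_setMem, State.mem_setMem,
        incr_mem, incr_reg, hi8, m4, m5, m8, r3, r27, r30, r31, hv, hsel, hlt,
        Nat.reduceEqDiff, if_true, if_false, ne_eq, not_false_eq_true]
      have hc : s.mem 8 (s.mem 5 i) ∉ Q := fun h => hsel ((hQ _).1 h)
      refine ⟨hnb, hnb', fun c => ?_, insert (s.mem 8 (s.mem 5 i)) Q, fun c => ?_, ?_, ?_,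
        fun c hcQ => ?_, fun d hd hdv => ?_⟩
      · rw [Function.update_apply]
        split_ifs
        exacts [le_rfl, hI3 c]
      · rw [Finset.mem_insert, Function.update_apply]
        split_ifs with h
        · simp [h]
        · simp [h, hQ]
      · rw [Finset.card_insert_of_notMem hc, hQ29]
      · rw [Finset.card_insert_of_notMem hc]; omega
      · simp only [Function.update_apply]
        rcases Finset.mem_insert.1 hcQ with rfl | hcQ
        · exact ⟨if_pos rfl, if_pos rfl, i, by omega, hv, rfl⟩
        · obtain ⟨h1, h2, h⟩ := hI4' c hcQ
          exact ⟨by simp [h1], by simp [h2], h⟩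
      · rcases Nat.lt_succ_iff_lt_or_eq.1 hd with hd | rfl
        · rcases hI5 d hd hdv with h | h
          · exact .inl (Finset.mem_insert_of_mem h)
          · omega
        · exact .inl (Finset.mem_insert_self _ _)
    · simp only [run, State.reg_setReg, State.mem_setReg, State.reg_setMem, State.mem_setMem,
        incr_mem, incr_reg, hi8, m4, m5, m8, r27, r30, r31, hv, hsel, hlt,
        Nat.reduceEqDiff, if_true, if_false, ne_eq, not_false_eq_true]
      refine ⟨hnb, hnb', hI3, Q, hQ, hQ29, hQL, hI4', fun d hd hdv => ?_⟩
      rcases Nat.lt_succ_iff_lt_or_eq.1 hd with hd | rfl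
      exacts [hI5 d hd hdv, .inr (by omega)]

/-- The body of `markPass`. -/
def markStep : Prog :=
  load 9 4 8 ;; load 10 7 9 ;; ifEq 10 3 (load 11 8 9 ;; load 12 12 11 ;; ifEq 12 30
    (load 13 11 9 ;; ifEq 13 30
      (load 14 13 11 ;; ifLt 6 14 skip (inc 14 ;; store 13 11 14 ;; addVertex 9))
      (load 14 14 11 ;; ifLt 6 14 skip (inc 14 ;; store 14 11 14 ;; addVertex 9))) skip) skip

/-- Append vertices of the selected cliques to the list: in each clique, one more neighbour and one
more non-neighbour than register 6 says, or all of them. -/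
def markPass : Prog := forLt 8 4 markStep

/-- The number of neighbours, respectively of non-neighbours, marked in a clique. -/
def markCount (s : State) (b : Bool) : ℕ → ℕ := if b then s.mem 13 else s.mem 14

/-- The Boolean `b` tells neighbours from non-neighbours, so that both counters are treated at once.
The two alternatives are that `w` is appended, or that nothing relevant changes. -/
theorem markStep_run (s : State) (h3 : s.reg 3 = 0) {w c : ℕ} {b : Bool}
    (hw : s.mem 4 (s.reg 8) = w) (hc : s.mem 8 w = c) (hb : s.mem 11 w = s.reg 30 ↔ b = true) :
    (s.mem 7 w = 0 ∧ s.mem 12 c = s.reg 30 ∧ markCount s b c ≤ s.reg 6 ∧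
      (markStep.run s).mem 2 = Function.update (s.mem 2) (s.reg 5) w ∧
      (markStep.run s).mem 7 = Function.update (s.mem 7) w (s.reg 5 + 1) ∧
      (markStep.run s).reg 5 = s.reg 5 + 1 ∧
      markCount (markStep.run s) b = Function.update (markCount s b) c (markCount s b c + 1) ∧
      markCount (markStep.run s) (!b) = markCount s !b) ∨
    ((s.mem 7 w ≠ 0 ∨ s.mem 12 c ≠ s.reg 30 ∨ s.reg 6 < markCount s b c) ∧
      (markStep.run s).mem 2 = s.mem 2 ∧ (markStep.run s).mem 7 = s.mem 7 ∧
      (markStep.run s).reg 5 = s.reg 5 ∧ markCount (markStep.run s) = markCount s) := by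
  subst hw hc
  by_cases h7 : s.mem 7 (s.mem 4 (s.reg 8)) = 0
  swap
  · right
    refine ⟨.inl h7, ?_⟩
    simp [markStep, run, h3, h7, markCount, funext_iff]
  by_cases h12 : s.mem 12 (s.mem 8 (s.mem 4 (s.reg 8))) = s.reg 30
  swap
  · right
    refine ⟨.inr (.inl h12), ?_⟩
    simp [markStep, run, h3, h7, h12, markCount, funext_iff]
  by_cases hlt : s.reg 6 < markCount s b (s.mem 8 (s.mem 4 (s.reg 8)))
  · right
    refine ⟨.inr (.inr hlt), ?_⟩
    cases b
    · have h11 : s.mem 11 (s.mem 4 (s.reg 8)) ≠ s.reg 30 := by simpa using hb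
      have hlt' : s.reg 6 < s.mem 14 (s.mem 8 (s.mem 4 (s.reg 8))) := hlt
      simp [markStep, run, h3, h7, h12, h11, hlt', markCount, funext_iff]
    · have h11 : s.mem 11 (s.mem 4 (s.reg 8)) = s.reg 30 := by simpa using hb
      have hlt' : s.reg 6 < s.mem 13 (s.mem 8 (s.mem 4 (s.reg 8))) := hlt
      simp [markStep, run, h3, h7, h12, h11, hlt', markCount, funext_iff]
  · left
    refine ⟨h7, h12, not_lt.1 hlt, ?_⟩
    cases b
    · have h11 : s.mem 11 (s.mem 4 (s.reg 8)) ≠ s.reg 30 := by simpa using hb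
      have hlt' : ¬ s.reg 6 < s.mem 14 (s.mem 8 (s.mem 4 (s.reg 8))) := hlt
      simp [markStep, run, addVertex, incr_reg, h3, h7, h12, h11, hlt', markCount]
    · have h11 : s.mem 11 (s.mem 4 (s.reg 8)) = s.reg 30 := by simpa using hb
      have hlt' : ¬ s.reg 6 < s.mem 13 (s.mem 8 (s.mem 4 (s.reg 8))) := hlt
      simp [markStep, run, addVertex, incr_reg, h3, h7, h12, h11, hlt', markCount]

/-- The positions from `q` on in the list at which a vertex satisfying `P` stands. -/
def positions (names : ℕ → ℕ) (q p : ℕ) (P : ℕ → Prop) [DecidablePred P] : Finset ℕ :=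
  (Finset.Ico q p).filter fun i => P (names i)

theorem card_positions_update (names : ℕ → ℕ) {q p : ℕ} (hqp : q ≤ p) (w : ℕ) (P : ℕ → Prop)
    [DecidablePred P] : (positions (Function.update names p w) q (p + 1) P).card =
      (positions names q p P).card + if P w then 1 else 0 := by
  have h : (Finset.Ico q p).filter (fun i => P (Function.update names p w i)) =
      (Finset.Ico q p).filter fun i => P (names i) :=
    Finset.filter_congr fun i hi => by
      rw [Function.update_of_ne (Finset.mem_Ico.1 hi).2.ne]
  rw [positions, positions, ← Finset.insert_Ico_right_eq_Ico_add_one hqp, Finset.filter_insert,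
    Function.update_self, h]
  split_ifs with hw
  · rw [Finset.card_insert_of_notMem (by simp)]
  · rfl

/-- Going through the sources of arcs visits every vertex of positive degree. A vertex of a selected
clique stays unlisted only if the counter of its kind is already full, at one more than register 6.
The invariant identifies the counters with the numbers of positions filled in this pass. -/
theorem markPass_spec {A : SimpleGraph ℕ} (s : State) (h3 : s.reg 3 = 0)
    (hl : IsVertexList A (s.mem 2) (s.mem 7) (s.reg 5))
    (hA : ∀ d < s.reg 4, ∃ z, A.Adj (s.mem 4 d) z)
    (hcnt : ∀ c, s.mem 12 c = s.reg 30 → s.mem 13 c = 0 ∧ s.mem 14 c = 0) :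
    IsVertexList A ((markPass.run s).mem 2) ((markPass.run s).mem 7) ((markPass.run s).reg 5) ∧
    s.reg 5 ≤ (markPass.run s).reg 5 ∧
    (∀ j < s.reg 5, (markPass.run s).mem 2 j = s.mem 2 j) ∧
    (∀ w, s.mem 7 w ≠ 0 → (markPass.run s).mem 7 w = s.mem 7 w) ∧
    (∀ j, s.reg 5 ≤ j → j < (markPass.run s).reg 5 →
      s.mem 12 (s.mem 8 ((markPass.run s).mem 2 j)) = s.reg 30) ∧
    (∀ c, s.mem 12 c = s.reg 30 → ∀ b : Bool, (positions ((markPass.run s).mem 2) (s.reg 5)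
      ((markPass.run s).reg 5) fun w => s.mem 8 w = c ∧ (s.mem 11 w = s.reg 30 ↔ b = true)).card ≤
        s.reg 6 + 1) ∧
    ∀ d < s.reg 4, (markPass.run s).mem 7 (s.mem 4 d) ≠ 0 ∨
      s.mem 12 (s.mem 8 (s.mem 4 d)) ≠ s.reg 30 ∨
      s.reg 6 + 1 ≤ (positions ((markPass.run s).mem 2) (s.reg 5) ((markPass.run s).reg 5)
        fun w => s.mem 8 w = s.mem 8 (s.mem 4 d) ∧
          (s.mem 11 w = s.reg 30 ↔ s.mem 11 (s.mem 4 d) = s.reg 30)).card := by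
  have main : IsVertexList A ((markPass.run s).mem 2) ((markPass.run s).mem 7)
      ((markPass.run s).reg 5) ∧ s.reg 5 ≤ (markPass.run s).reg 5 ∧
    (∀ j < s.reg 5, (markPass.run s).mem 2 j = s.mem 2 j) ∧
    (∀ w, s.mem 7 w ≠ 0 → (markPass.run s).mem 7 w = s.mem 7 w) ∧
    (∀ j, s.reg 5 ≤ j → j < (markPass.run s).reg 5 →
      s.mem 12 (s.mem 8 ((markPass.run s).mem 2 j)) = s.reg 30) ∧
    (∀ c, s.mem 12 c = s.reg 30 → ∀ b : Bool, (positions ((markPass.run s).mem 2) (s.reg 5)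
      ((markPass.run s).reg 5) fun w => s.mem 8 w = c ∧ (s.mem 11 w = s.reg 30 ↔ b = true)).card =
        markCount (markPass.run s) b c ∧ markCount (markPass.run s) b c ≤ s.reg 6 + 1) ∧
    ∀ d < s.reg 4, (markPass.run s).mem 7 (s.mem 4 d) ≠ 0 ∨
      s.mem 12 (s.mem 8 (s.mem 4 d)) ≠ s.reg 30 ∨
      s.reg 6 + 1 ≤ markCount (markPass.run s) (decide (s.mem 11 (s.mem 4 d) = s.reg 30))
        (s.mem 8 (s.mem 4 d)) := by
    refine for_rule (by simp [wf, wreg, markStep, addVertex]) s (fun i s' =>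
      IsVertexList A (s'.mem 2) (s'.mem 7) (s'.reg 5) ∧ s.reg 5 ≤ s'.reg 5 ∧
      (∀ j < s.reg 5, s'.mem 2 j = s.mem 2 j) ∧
      (∀ w, s.mem 7 w ≠ 0 → s'.mem 7 w = s.mem 7 w) ∧
      (∀ j, s.reg 5 ≤ j → j < s'.reg 5 → s.mem 12 (s.mem 8 (s'.mem 2 j)) = s.reg 30) ∧
      (∀ c, s.mem 12 c = s.reg 30 → ∀ b : Bool, (positions (s'.mem 2) (s.reg 5) (s'.reg 5)
        fun w => s.mem 8 w = c ∧ (s.mem 11 w = s.reg 30 ↔ b = true)).card = markCount s' b c ∧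
        markCount s' b c ≤ s.reg 6 + 1) ∧
      ∀ d < i, s'.mem 7 (s.mem 4 d) ≠ 0 ∨ s.mem 12 (s.mem 8 (s.mem 4 d)) ≠ s.reg 30 ∨
        s.reg 6 + 1 ≤ markCount s' (decide (s.mem 11 (s.mem 4 d) = s.reg 30))
          (s.mem 8 (s.mem 4 d))) ?_ ?_
    · refine ⟨by simpa using hl, by simp, by simp, by simp, ?_, ?_, by simp⟩
      · intro j h1 h2
        simp only [State.reg_setReg, Nat.reduceEqDiff, if_false] at h2
        omega
      · intro c hc b
        obtain ⟨h1, h2⟩ := hcnt c hc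
        cases b <;> simp [positions, markCount, h1, h2]
    rintro i hi s' hi8 hreg hmem ⟨hl', hle, hn, hpos, hsel, hcount, hdone⟩
    have m4 := hmem 4 (by decide)
    have m8 := hmem 8 (by decide)
    have m11 := hmem 11 (by decide)
    have m12 := hmem 12 (by decide)
    have r3 := hreg 3 (by decide)
    have r6 := hreg 6 (by decide)
    have r30 := hreg 30 (by decide)
    rw [h3] at r3
    have hmc : ∀ t : State, markCount (incr t 8) = markCount t := fun t => rfl
    simp only [incr_mem, incr_reg _ 8 _ (by decide : (8 : ℕ) ≠ 99), Nat.reduceEqDiff, if_false, hmc]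
    set w := s.mem 4 i with hw
    set c := s.mem 8 w with hc
    set b : Bool := decide (s.mem 11 w = s.reg 30) with hb
    have hstep := markStep_run s' r3 (w := w) (c := c) (b := b) (by rw [m4, hi8]) (by rw [m8])
      (by rw [m11, r30, hb, decide_eq_true_iff])
    rw [m12, r30, r6] at hstep
    rcases hstep with ⟨k1, k2, k3, k4, k5, k6, k7, k8⟩ | ⟨k1, k2, k3, k4, k5⟩
    · rw [k4, k5, k6]
      have hw0 : s.mem 7 w = 0 := by
        by_contra h
        rw [hpos w h] at k1
        exact h k1
      have hmono : ∀ b' c', markCount s' b' c' ≤ markCount (markStep.run s') b' c' := by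
        intro b' c'
        by_cases hbb : b' = b
        · rw [hbb, k7, Function.update_apply]
          split_ifs with h
          · rw [h]; omega
          · exact le_rfl
        · rw [Bool.eq_not_of_ne hbb, k8]
      refine ⟨hl'.add k1 (hA i hi), by omega, fun j hj => ?_, fun x hx => ?_, fun j h1 h2 => ?_,
        fun c' hc' b' => ?_, fun d hd => ?_⟩
      · rw [Function.update_of_ne (by omega), hn j hj]
      · rw [Function.update_of_ne (by rintro rfl; exact hx hw0), hpos x hx]
      · rcases Nat.lt_succ_iff_lt_or_eq.1 h2 with h2 | rfl
        · rw [Function.update_of_ne (by omega)]; exact hsel j h1 h2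
        · rw [Function.update_self]; exact k2
      · obtain ⟨g1, g2⟩ := hcount c' hc' b'
        rw [card_positions_update _ hle, g1]
        by_cases hcc : c' = c
        · by_cases hbb : b' = b
          · rw [if_pos ⟨by rw [hcc], by rw [hbb, hb, decide_eq_true_iff]⟩, hbb, k7, hcc,
              Function.update_self]
            exact ⟨rfl, by omega⟩
          · rw [if_neg, Bool.eq_not_of_ne hbb, k8, ← Bool.eq_not_of_ne hbb]
            · exact ⟨rfl, g2⟩
            · rintro ⟨-, h⟩
              apply hbb
              rw [hb]
              cases b' <;> simp_all
        · rw [if_neg (fun h => hcc (h.1.symm.trans hc.symm))]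
          have : markCount (markStep.run s') b' c' = markCount s' b' c' := by
            by_cases hbb : b' = b
            · rw [hbb, k7, Function.update_of_ne hcc]
            · rw [Bool.eq_not_of_ne hbb, k8]
          rw [this]
          exact ⟨rfl, g2⟩
      · rcases Nat.lt_succ_iff_lt_or_eq.1 hd with hd | rfl
        · rcases hdone d hd with h | h | h
          · left
            rw [Function.update_apply]
            split_ifs
            · omega
            · exact h
          · exact .inr (.inl h)
          · exact .inr (.inr (h.trans (hmono _ _)))
        · left
          rw [← hw, Function.update_self]; omega
    · rw [k2, k3, k4, k5]
      refine ⟨hl', hle, hn, hpos, hsel, hcount, fun d hd => ?_⟩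
      rcases Nat.lt_succ_iff_lt_or_eq.1 hd with hd | rfl
      exacts [hdone d hd, k1]
  obtain ⟨h1, h2, h4, h5, h6, h7, h8⟩ := main
  refine ⟨h1, h2, h4, h5, h6, fun c hc b => (h7 c hc b).1.trans_le (h7 c hc b).2, fun d hd => ?_⟩
  rcases h8 d hd with h | h | h
  · exact .inl h
  · exact .inr (.inl h)
  · by_cases hs : s.mem 12 (s.mem 8 (s.mem 4 d)) = s.reg 30
    · rw [← (h7 _ hs _).1] at h
      simp only [decide_eq_true_iff] at h
      exact .inr (.inr h)
    · exact .inr (.inl hs)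

end Marking

/-! ### Marking rounds for all vertices of the modulator -/

section Marking

theorem card_positions_le_add (names names' : ℕ → ℕ) {q p p' : ℕ} (hn : ∀ j < p, names' j = names j)
    (P : ℕ → Prop) [DecidablePred P] : (positions names' q p' P).card ≤
      (positions names q p P).card + (positions names' p p' P).card := by
  refine (Finset.card_le_card fun i hi => ?_).trans (Finset.card_union_le _ _)
  simp only [positions, Finset.mem_union, Finset.mem_filter, Finset.mem_Ico] at hi ⊢
  by_cases h : i < p
  · rw [hn i h] at hi
    exact .inl ⟨⟨hi.1.1, h⟩, hi.2⟩
  · exact .inr ⟨⟨by omega, hi.1.2⟩, hi.2⟩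

/-- Mark vertices on account of the vertex at the position in register 28 of the list. -/
def markRound : Prog :=
  load 31 2 28 ;; copy 30 28 ;; inc 30 ;; selectPass ;; markPass

/-- The situation after `j` marking rounds for the modulator `S`, which consists of the first
vertices of the list. -/
structure MarkInvariant (A : SimpleGraph ℕ) (S : Finset ℕ) (rep names : ℕ → ℕ) (j : ℕ)
    (s : State) : Prop where
  isList : IsVertexList A (s.mem 2) (s.mem 7) (s.reg 5)
  card_le : S.card ≤ s.reg 5
  names_eq : ∀ i < S.card, s.mem 2 i = names i
  mem_iff : ∀ w, w ∈ S ↔ s.mem 7 w ≠ 0 ∧ s.mem 7 w ≤ S.card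
  nb_le : ∀ w, s.mem 11 w ≤ j
  sel_le : ∀ c, s.mem 12 c ≤ j
  represented : ∀ i < j, Represented A S rep {w | s.mem 7 w ≠ 0} (names i)
  clique_le : ∀ c, (positions (s.mem 2) S.card (s.reg 5) fun w => rep w = c).card ≤
    j * (2 * (S.card + 1))
  size_le : s.reg 5 ≤ S.card + j * ((2 * S.card + 2) * (2 * (S.card + 1)))

/-- The stamp of the round is j+1. If the selection limit was reached, the first clause of
`Represented` holds for the current vertex. Otherwise every clique containing one of its neighbours
was selected, and the second clause holds. Earlier vertices stay represented because marks are never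
removed. -/
theorem markRound_spec {A : SimpleGraph ℕ} {S : Finset ℕ} {rep names : ℕ → ℕ} {j : ℕ} (s : State)
    (h3 : s.reg 3 = 0) (h6 : s.reg 6 = S.card) (h27 : s.reg 27 = 2 * S.card + 2)
    (h28 : s.reg 28 = j) (h8 : s.mem 8 = rep) (hj : j < S.card)
    (hA : ArcListing A (s.reg 4) (s.mem 4) (s.mem 5)) (hI : MarkInvariant A S rep names j s) :
    MarkInvariant A S rep names (j + 1) (markRound.run s) := by
  set s0 := incr ((s.setReg 31 (s.mem 2 (s.reg 28))).setReg 30 (s.reg 28)) 30 with hs0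
  have hrun : markRound.run s = markPass.run (selectPass.run s0) := by
    simp [markRound, run, hs0]
  have hm : s0.mem = s.mem := rfl
  have q3 : s0.reg 3 = 0 := by simp [hs0, incr_reg, h3]
  have q4 : s0.reg 4 = s.reg 4 := by simp [hs0, incr_reg]
  have q5 : s0.reg 5 = s.reg 5 := by simp [hs0, incr_reg]
  have q6 : s0.reg 6 = S.card := by simp [hs0, incr_reg, h6]
  have q27 : s0.reg 27 = 2 * S.card + 2 := by simp [hs0, incr_reg, h27]
  have q30 : s0.reg 30 = j + 1 := by simp [hs0, incr_reg, h28]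
  have q31 : s0.reg 31 = names j := by simp [hs0, incr_reg, h28, hI.names_eq j hj]
  set s1 := selectPass.run s0 with hs1
  obtain ⟨a1, a2, a3, Q, a4, -, a5, a6, a7⟩ := selectPass_spec s0 q3
    (by rw [hm, q30]; exact fun w => Nat.lt_succ_of_le (hI.nb_le w))
    (by rw [hm, q30]; exact fun w => Nat.lt_succ_of_le (hI.sel_le w))
  rw [← hs1, q4, q31, q30, hm] at a1
  rw [← hs1, q30] at a2 a3 a4
  rw [q27] at a5
  rw [← hs1, q4, q31, hm, h8] at a6
  rw [q4, q31, q27, hm, h8] at a7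
  have R : ∀ r, r ∉ selectPass.wreg → s1.reg r = s0.reg r := fun r hr => run_reg _ _ _ hr
  have M : ∀ r, r ∉ selectPass.wmem → s1.mem r = s.mem r := fun r hr => run_mem _ _ _ hr
  have t3 := (R 3 (by decide)).trans q3
  have t4 := (R 4 (by decide)).trans q4
  have t5 := (R 5 (by decide)).trans q5
  have t6 := (R 6 (by decide)).trans q6
  have t30 := (R 30 (by decide)).trans q30
  have m2 := M 2 (by decide)
  have m4 := M 4 (by decide)
  have m7 := M 7 (by decide)
  have m8 := (M 8 (by decide)).trans h8
  obtain ⟨b1, b2, b3, b4, b5, b6, b7⟩ := markPass_spec (A := A) s1 t3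
    (by rw [m2, m7, t5]; exact hI.isList)
    (by rw [t4, m4]; exact fun d hd => ⟨_, (hA.adj _ _).2 ⟨d, hd, rfl, rfl⟩⟩)
    (by
      rw [t30]
      intro c hc
      obtain ⟨h1, h2, -⟩ := a6 c ((a4 c).2 hc)
      exact ⟨h1, h2⟩)
  rw [← hrun] at b1 b2 b3 b4 b5 b6 b7
  rw [t5] at b2 b3 b5
  rw [m2] at b3
  rw [m7] at b4
  rw [m8, t30] at b5
  rw [m8, t30, t5, t6] at b6
  rw [m8, t30, t4, t5, t6, m4] at b7
  have n11 : (markRound.run s).mem 11 = s1.mem 11 := by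
    rw [hrun]; exact run_mem _ _ _ (by decide)
  have n12 : (markRound.run s).mem 12 = s1.mem 12 := by
    rw [hrun]; exact run_mem _ _ _ (by decide)
  set f := markRound.run s
  have hsub : {w | s.mem 7 w ≠ 0} ⊆ {w | f.mem 7 w ≠ 0} := fun w hw => by
    rw [Set.mem_ofPred_eq, b4 w hw]; exact hw
  have hmem : ∀ w, w ∈ S ↔ f.mem 7 w ≠ 0 ∧ f.mem 7 w ≤ S.card := by
    intro w
    rw [hI.mem_iff]
    constructor
    · rintro ⟨h1, h2⟩
      rw [b4 w h1]; exact ⟨h1, h2⟩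
    · rintro ⟨h1, h2⟩
      have h4 := (b1.names_pos w h1).2
      have h5 := hI.card_le
      have h6 : s.mem 2 (f.mem 7 w - 1) = w := by rw [← b3 _ (by omega)]; exact h4
      have h7 : s.mem 7 w = f.mem 7 w := by
        conv_lhs => rw [← h6, hI.isList.pos_names _ (by omega)]
        omega
      rw [h7]; exact ⟨h1, h2⟩
  -- The modulator occupies the first |S| positions, so whatever is appended lies outside it.
  have hnew : ∀ i, s.reg 5 ≤ i → i < f.reg 5 → f.mem 7 (f.mem 2 i) ≠ 0 ∧ f.mem 2 i ∉ S := by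
    intro i h1 h2
    have h4 := b1.pos_names i h2
    have h5 := hI.card_le
    refine ⟨by omega, fun h => ?_⟩
    have := ((hmem _).1 h).2
    omega
  have hnb : ∀ w, s1.mem 11 w = j + 1 ↔ A.Adj (names j) w := fun w => by rw [a1, hA.adj]
  have hnewclique : ∀ c, (positions (f.mem 2) (s.reg 5) (f.reg 5) fun w => rep w = c).card ≤
      2 * (S.card + 1) := by
    intro c
    by_cases hc : s1.mem 12 c = j + 1
    · have h1 := b6 c hc true
      have h2 := b6 c hc false
      refine (Finset.card_le_card fun i hi => ?_).trans
        ((Finset.card_union_le _ _).trans (by rw [two_mul]; exact Nat.add_le_add h1 h2))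
      simp only [positions, Finset.mem_union, Finset.mem_filter] at hi ⊢
      by_cases h : s1.mem 11 (f.mem 2 i) = j + 1 <;> simp [h, hi]
    · have : (positions (f.mem 2) (s.reg 5) (f.reg 5) fun w => rep w = c) = ∅ := by
        rw [positions, Finset.filter_eq_empty_iff]
        rintro i hi rfl
        rw [Finset.mem_Ico] at hi
        exact hc (b5 i hi.1 hi.2)
      rw [this]; simp
  -- The new positions are counted by clique: at most 2|S|+2 names are selected, each with at most
  -- |S|+1 marks of either kind.
  have hcount : f.reg 5 - s.reg 5 ≤ (2 * S.card + 2) * (2 * (S.card + 1)) := by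
    have h := Finset.card_le_mul_card_image_of_maps_to (s := Finset.Ico (s.reg 5) (f.reg 5)) (t := Q)
      (f := fun i => rep (f.mem 2 i))
      (fun i hi => by
        rw [Finset.mem_Ico] at hi
        exact (a4 _).2 (b5 i hi.1 hi.2)) (2 * (S.card + 1)) (fun c _ => hnewclique c)
    rw [Nat.card_Ico] at h
    calc _ ≤ _ := h
      _ ≤ _ := by rw [mul_comm]; exact Nat.mul_le_mul_right _ a5
  have hrep : Represented A S rep {w | f.mem 7 w ≠ 0} (names j) := by
    by_cases hQ : Q.card = 2 * S.card + 2
    · left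
      -- The name `c` was selected because of some neighbour. Either that neighbour is listed,
      -- possibly as a member of `S`, or |S|+1 other neighbours with the same name were marked in
      -- its place.
      have hx : ∀ c ∈ Q, ∃ x, f.mem 7 x ≠ 0 ∧ A.Adj (names j) x ∧ rep x = c := by
        intro c hc
        obtain ⟨-, -, d, hd, h1, h2⟩ := a6 c hc
        have hadj : A.Adj (names j) (s.mem 5 d) := (hA.adj _ _).2 ⟨d, hd, h1, rfl⟩
        obtain ⟨d', hd', h4, -⟩ := hA.symm hd
        rcases b7 d' hd' with h | h | h
        · exact ⟨_, h, by rw [h4]; exact hadj, by rw [h4]; exact h2⟩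
        · rw [h4, h2] at h
          exact absurd ((a4 c).1 hc) h
        · obtain ⟨i, hi⟩ := Finset.card_pos.1 (lt_of_lt_of_le (Nat.succ_pos _) h)
          simp only [positions, Finset.mem_filter, Finset.mem_Ico] at hi
          obtain ⟨⟨i1, i2⟩, i3, i4⟩ := hi
          refine ⟨f.mem 2 i, (hnew i i1 i2).1, ?_, by rw [i3, h4, h2]⟩
          rw [h4] at i4
          exact (hnb _).1 (i4.2 ((hnb _).2 hadj))
      choose! x hx1 hx2 hx3 using hx
      have hinj : Set.InjOn x Q := fun c hc c' hc' h => by rw [← hx3 c hc, h, hx3 c' hc']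
      refine ⟨Q.image x, by rw [Finset.card_image_of_injOn hinj, hQ], fun y hy => ?_, ?_⟩
      · obtain ⟨c, hc, rfl⟩ := Finset.mem_image.1 hy
        exact ⟨hx1 c hc, hx2 c hc⟩
      · intro y hy y' hy' h
        obtain ⟨c, hc, rfl⟩ := Finset.mem_image.1 (Finset.mem_coe.1 hy)
        obtain ⟨c', hc', rfl⟩ := Finset.mem_image.1 (Finset.mem_coe.1 hy')
        rw [hx3 c hc, hx3 c' hc'] at h
        rw [h]
    · right
      rintro w hw hvw w' hw' ⟨z, hz⟩ hr
      obtain ⟨d, hd, h1, rfl⟩ := (hA.adj _ _).1 hvw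
      obtain ⟨d', hd', rfl, h2⟩ := (hA.adj _ _).1 hz
      have hsel := (a4 _).1 ((a7 d hd h1).resolve_right hQ)
      rcases b7 d' hd' with h | h | h
      · exact .inl h
      · rw [hr] at h; exact absurd hsel h
      · refine .inr ⟨(positions (f.mem 2) (s.reg 5) (f.reg 5) fun w => rep w = rep (s.mem 4 d') ∧
            (s1.mem 11 w = j + 1 ↔ s1.mem 11 (s.mem 4 d') = j + 1)).image (f.mem 2), ?_, ?_⟩
        · rw [Finset.card_image_of_injOn]
          · exact h
          · refine b1.injOn.mono fun i hi => ?_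
            simp only [positions, Finset.coe_filter, Finset.mem_Ico, Set.mem_ofPred_eq] at hi
            exact hi.1.2
        · intro x hx
          obtain ⟨i, hi, rfl⟩ := Finset.mem_image.1 hx
          simp only [positions, Finset.mem_filter, Finset.mem_Ico] at hi
          obtain ⟨⟨i1, i2⟩, i3, i4⟩ := hi
          rw [hnb, hnb] at i4
          exact ⟨(hnew i i1 i2).1, (hnew i i1 i2).2, i3.trans hr, i4⟩
  refine ⟨b1, hI.card_le.trans b2, fun i hi => ?_, hmem, fun w => ?_, fun c => ?_, fun i hi => ?_,
    fun c => ?_, ?_⟩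
  · rw [b3 i (hi.trans_le hI.card_le), hI.names_eq i hi]
  · rw [n11]; exact a2 w
  · rw [n12]; exact a3 c
  · rcases Nat.lt_succ_iff_lt_or_eq.1 hi with hi | rfl
    · exact (hI.represented i hi).mono hsub
    · exact hrep
  · have h1 := card_positions_le_add (s.mem 2) (f.mem 2) (q := S.card) (p' := f.reg 5) b3
      (fun w => rep w = c)
    have h2 := hnewclique c
    have h4 := hI.clique_le c
    rw [Nat.add_mul, one_mul]
    omega
  · have := hI.size_le
    rw [Nat.add_mul, one_mul]
    omega

/-- Declare the listed vertices to be the modulator, and compute the number of cliques to select. -/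
def limitPass : Prog :=
  copy 6 5 ;; forLt 8 6 (inc 27 ;; inc 27) ;; inc 27 ;; inc 27

/-- The language has no addition, so the limit is reached by increments. -/
theorem limitPass_spec (s : State) (h27 : s.reg 27 = 0) :
    (limitPass.run s).reg 6 = s.reg 5 ∧ (limitPass.run s).reg 27 = 2 * s.reg 5 + 2 := by
  have main := for_rule (i := 8) (n := 6) (c := inc 27 ;; inc 27) (by simp [wf, wreg])
    (s.setReg 6 (s.reg 5)) (fun j s' => s'.reg 27 = 2 * j ∧ s'.reg 6 = s.reg 5)
    (by simp [h27]) (by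
      rintro j hj s' h8 - - ⟨h1, h2⟩
      simp [run, incr_reg, h1, h2]; ring)
  simp only [State.reg_setReg, if_true] at main
  constructor
  · simp only [limitPass, run, incr_reg _ 27 _ (by decide : (27 : ℕ) ≠ 99), Nat.reduceEqDiff,
      if_false]
    exact main.2
  · simp only [limitPass, run, incr_reg _ 27 _ (by decide : (27 : ℕ) ≠ 99), if_true]
    rw [show ∀ a b : ℕ, a + 1 + 1 = b + 2 ↔ a = b by omega]
    exact main.1

/-- Mark vertices on account of each vertex of the modulator. -/
def markPhase : Prog := limitPass ;; forLt 28 6 markRound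

theorem markPhase_spec {A : SimpleGraph ℕ} (s : State) (h3 : s.reg 3 = 0) (h27 : s.reg 27 = 0)
    (h11 : s.mem 11 = fun _ => 0) (h12 : s.mem 12 = fun _ => 0)
    (hA : ArcListing A (s.reg 4) (s.mem 4) (s.mem 5))
    (hl : IsVertexList A (s.mem 2) (s.mem 7) (s.reg 5)) {S : Finset ℕ}
    (hS : S = (Finset.range (s.reg 5)).image (s.mem 2)) :
    S.card = s.reg 5 ∧
      MarkInvariant A S (s.mem 8) (s.mem 2) (s.reg 5) (markPhase.run s) := by
  have hcard : S.card = s.reg 5 := by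
    rw [hS, Finset.card_image_of_injOn, Finset.card_range]
    exact hl.injOn.mono fun i hi => by simpa using hi
  refine ⟨hcard, ?_⟩
  obtain ⟨k6, k27⟩ := limitPass_spec s h27
  have R : ∀ r, r ∉ limitPass.wreg → (limitPass.run s).reg r = s.reg r :=
    fun r hr => run_reg _ _ _ hr
  have hm : (limitPass.run s).mem = s.mem := funext fun a => run_mem _ _ _ (by simp [limitPass, wmem])
  set s0 := limitPass.run s
  have h := for_rule (i := 28) (n := 6) (c := markRound)
    (by simp [wf, wreg, markRound, selectPass, markPass, markStep, addVertex]) s0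
    (fun j s' => MarkInvariant A S (s.mem 8) (s.mem 2) j s') ?_ ?_
  · rw [k6] at h
    exact h
  · have hr5 : (s0.setReg 28 0).reg 5 = s.reg 5 := by
      rw [State.reg_setReg, if_neg (by decide), R 5 (by decide)]
    have hm0 : (s0.setReg 28 0).mem = s.mem := hm
    refine ⟨?_, ?_, ?_, ?_, ?_, ?_, ?_, ?_, ?_⟩
    · rw [hm0, hr5]; exact hl
    · rw [hr5, hcard]
    · rw [hm0]; exact fun _ _ => rfl
    · intro w
      rw [hm0, hcard, hS, Finset.mem_image]
      constructor
      · rintro ⟨i, hi, rfl⟩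
        rw [Finset.mem_range] at hi
        rw [hl.pos_names i hi]
        omega
      · rintro ⟨h1, h2⟩
        exact ⟨_, Finset.mem_range.2 (by omega), (hl.names_pos w h1).2⟩
    · rw [hm0, h11]; exact fun _ => le_rfl
    · rw [hm0, h12]; exact fun _ => le_rfl
    · exact fun i hi => absurd hi (Nat.not_lt_zero i)
    · intro c
      rw [hr5, hcard]; simp [positions]
    · rw [hr5, hcard]; omega
  · intro j hj s' h28 hreg hmem hI
    have e8 : s'.mem 8 = s.mem 8 := (hmem 8 (by decide)).trans (by rw [hm])
    have hI' := markRound_spec (A := A) (S := S) s'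
      ((hreg 3 (by decide)).trans ((R 3 (by decide)).trans h3))
      ((hreg 6 (by decide)).trans (k6.trans hcard.symm))
      ((hreg 27 (by decide)).trans (by rw [k27, hcard])) h28 e8 (by rw [hcard, ← k6]; exact hj)
      (by
        rw [hreg 4 (by decide), R 4 (by decide), hmem 4 (by decide), hmem 5 (by decide), hm]
        exact hA) hI
    have hr : ∀ r, r ≠ 28 → r ≠ 99 →
        (incr (markRound.run s') 28).reg r = (markRound.run s').reg r := fun r h1 h2 => by
      rw [incr_reg _ _ _ (by decide), if_neg h1, if_neg h2]
    obtain ⟨c1, c2, c3, c4, c5, c6, c7, c8, c9⟩ := hI'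
    have h5 := hr 5 (by decide) (by decide)
    exact ⟨by rw [h5]; exact c1, by rw [h5]; exact c2, c3, c4, c5, c6, c7, by rw [h5]; exact c8,
      by rw [h5]; exact c9⟩

end Marking

/-! ### Writing the edges of the kernel -/

section Output

/-- The body of the loop of `outputPass`. -/
def outputStep : Prog :=
  load 9 0 8 ;; load 10 1 8 ;; load 11 7 9 ;; load 12 7 10 ;;
    ifLt 3 11 (ifLt 3 12
      (dec 11 ;; dec 12 ;; store 0 29 11 ;; store 1 29 12 ;; inc 29) skip) skip

/-- Replace the list of edges by the list of the edges of the subgraph induced by the listed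
vertices, renamed according to their positions in the list. -/
def outputPass : Prog :=
  const 29 0 ;; forLt 8 1 outputStep ;; copy 0 5 ;; copy 1 29

/-- The edge list is overwritten in place. The write index never passes the read index, so edges
still to be read are intact. The function `g` sends each output edge to its input edge. Positions
are counted from one, hence the subtraction. -/
theorem outputPass_spec (s : State) (h3 : s.reg 3 = 0) :
    (outputPass.run s).reg 0 = s.reg 5 ∧ ∃ g : ℕ → ℕ,
      (∀ l < (outputPass.run s).reg 1, g l < s.reg 1 ∧
        s.mem 7 (s.mem 0 (g l)) ≠ 0 ∧ s.mem 7 (s.mem 1 (g l)) ≠ 0 ∧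
        (outputPass.run s).mem 0 l = s.mem 7 (s.mem 0 (g l)) - 1 ∧
        (outputPass.run s).mem 1 l = s.mem 7 (s.mem 1 (g l)) - 1) ∧
      (∀ l < (outputPass.run s).reg 1, ∀ l' < (outputPass.run s).reg 1, g l = g l' → l = l') ∧
      ∀ i < s.reg 1, s.mem 7 (s.mem 0 i) ≠ 0 → s.mem 7 (s.mem 1 i) ≠ 0 →
        ∃ l < (outputPass.run s).reg 1, g l = i := by
  have main := for_rule (i := 8) (n := 1) (c := outputStep)
    (by simp [wf, wreg, outputStep]) (s.setReg 29 0) (fun i s' => s'.reg 29 ≤ i ∧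
      (∀ j, i ≤ j → s'.mem 0 j = s.mem 0 j ∧ s'.mem 1 j = s.mem 1 j) ∧ ∃ g : ℕ → ℕ,
      (∀ l < s'.reg 29, g l < i ∧
        s.mem 7 (s.mem 0 (g l)) ≠ 0 ∧ s.mem 7 (s.mem 1 (g l)) ≠ 0 ∧
        s'.mem 0 l = s.mem 7 (s.mem 0 (g l)) - 1 ∧ s'.mem 1 l = s.mem 7 (s.mem 1 (g l)) - 1) ∧
      (∀ l < s'.reg 29, ∀ l' < s'.reg 29, g l = g l' → l = l') ∧
      ∀ i' < i, s.mem 7 (s.mem 0 i') ≠ 0 → s.mem 7 (s.mem 1 i') ≠ 0 →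
        ∃ l < s'.reg 29, g l = i') (by simp) ?_
  · set t := (forLt 8 1 outputStep).run (s.setReg 29 0) with ht
    have hrun : outputPass.run s =
        (t.setReg 0 (t.reg 5)).setReg 1 ((t.setReg 0 (t.reg 5)).reg 29) := rfl
    have h5 : t.reg 5 = s.reg 5 := by rw [ht, run_reg _ _ _ (by decide)]; simp
    simp only [hrun, State.reg_setReg, State.mem_setReg, Nat.reduceEqDiff,
      if_true, if_false, one_ne_zero, zero_ne_one] at main ⊢
    exact ⟨h5, main.2.2⟩
  · rintro i hi s' hi8 hreg hmem ⟨hq, horig, g, hg, hinj, hsurj⟩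
    have m7 := hmem 7 (by decide)
    have r3 := hreg 3 (by decide)
    simp only [State.mem_setReg, State.reg_setReg, Nat.reduceEqDiff, if_false, h3] at m7 r3
    obtain ⟨o0, o1⟩ := horig i le_rfl
    by_cases hc : s.mem 7 (s.mem 0 i) ≠ 0 ∧ s.mem 7 (s.mem 1 i) ≠ 0
    · obtain ⟨c1, c2⟩ := hc
      have d1 := Nat.pos_of_ne_zero c1
      have d2 := Nat.pos_of_ne_zero c2
      simp only [outputStep, run, decr, State.reg_setReg, State.mem_setReg, State.reg_setMem,
        State.mem_setMem, incr_mem, incr_reg, hi8, m7, r3, o0, o1, d1, d2, Nat.reduceEqDiff, if_true,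
        if_false, ne_eq, not_false_eq_true, zero_ne_one, one_ne_zero]
      refine ⟨by omega, fun j hj => ?_, Function.update g (s'.reg 29) i, fun l hl => ?_,
        fun l hl l' hl' h => ?_, fun i' hi' e1 e2 => ?_⟩
      · rw [Function.update_of_ne (by omega), Function.update_of_ne (by omega)]
        exact horig j (by omega)
      · rcases Nat.lt_succ_iff_lt_or_eq.1 hl with hl | rfl
        · obtain ⟨g1, g2⟩ := hg l hl
          simp only [Function.update_of_ne hl.ne]
          exact ⟨by omega, g2⟩
        · simp only [Function.update_self]
          exact ⟨by omega, c1, c2, trivial, trivial⟩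
      · rcases Nat.lt_succ_iff_lt_or_eq.1 hl with hl | rfl <;>
        rcases Nat.lt_succ_iff_lt_or_eq.1 hl' with hl' | rfl
        · rw [Function.update_of_ne hl.ne, Function.update_of_ne hl'.ne] at h
          exact hinj l hl l' hl' h
        · rw [Function.update_of_ne hl.ne, Function.update_self] at h
          have := (hg l hl).1
          omega
        · rw [Function.update_of_ne hl'.ne, Function.update_self] at h
          have := (hg l' hl').1
          omega
        · rfl
      · rcases Nat.lt_succ_iff_lt_or_eq.1 hi' with hi' | rfl
        · obtain ⟨l, hl, rfl⟩ := hsurj i' hi' e1 e2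
          exact ⟨l, by omega, Function.update_of_ne hl.ne _ _⟩
        · exact ⟨_, Nat.lt_succ_self _, Function.update_self _ _ _⟩
    · have key : ∀ t, t = incr (outputStep.run s') 8 →
          t.reg 29 = s'.reg 29 ∧ t.mem = s'.mem := by
        rintro t rfl
        by_cases c1 : s.mem 7 (s.mem 0 i) = 0
        · simp [outputStep, run, incr_reg, hi8, m7, r3, o0, o1, c1]
        · have c2 : s.mem 7 (s.mem 1 i) = 0 := by
            by_contra c2
            exact hc ⟨c1, c2⟩
          simp [outputStep, run, incr_reg, hi8, m7, r3, o0, o1, c2, Nat.pos_of_ne_zero c1]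
      obtain ⟨k1, k2⟩ := key _ rfl
      rw [k1, k2]
      refine ⟨by omega, fun j hj => horig j (by omega), g, fun l hl => ?_, hinj,
        fun i' hi' e1 e2 => ?_⟩
      · obtain ⟨g1, g2⟩ := hg l hl
        exact ⟨by omega, g2⟩
      · rcases Nat.lt_succ_iff_lt_or_eq.1 hi' with hi' | rfl
        · exact hsurj i' hi' e1 e2
        · exact absurd ⟨e1, e2⟩ hc

end Output

/-! ### The input graph as a graph on the natural numbers -/

section Input

variable {n m : ℕ} {G : SimpleGraph (Fin n)} {e : Fin m → Fin n × Fin n}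

theorem IsEdgeListing.ncard_eq (he : IsEdgeListing G e) : G.edgeSet.ncard = m := by
  rw [← he.2, ← Set.image_univ, Set.ncard_image_of_injective _ he.1, Set.ncard_univ, Nat.card_fin]

theorem IsEdgeListing.le_sq (he : IsEdgeListing G e) : m ≤ n * n := by
  have h : Function.Injective e := fun i j hij => he.1 (by simp only [hij])
  simpa using Fintype.card_le_of_injective e h

theorem IsEdgeListing.adj_iff (he : IsEdgeListing G e) (a b : Fin n) :
    G.Adj a b ↔ ∃ i, e i = (a, b) ∨ e i = (b, a) := by
  rw [← SimpleGraph.mem_edgeSet, ← he.2]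
  simp only [Set.mem_range, Sym2.eq_iff, Prod.ext_iff]

theorem inputState_mem (e : Fin m → Fin n × Fin n) (i : Fin m) :
    (inputState e).mem 0 i = (e i).1 ∧ (inputState e).mem 1 i = (e i).2 := by
  simp [inputState]

theorem inputState_mem_of_two_le (e : Fin m → Fin n × Fin n) {a : ℕ} (ha : 2 ≤ a) :
    (inputState e).mem a = fun _ => 0 := by
  funext i
  simp [inputState, show a ≠ 0 by omega, show a ≠ 1 by omega]

theorem inputState_bounded (he : IsEdgeListing G e) :
    (inputState e).Bounded ((n + 2) ^ 2) := by
  have hn : n ≤ (n + 2) ^ 2 := by nlinarith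
  have hm : m ≤ (n + 2) ^ 2 := he.le_sq.trans (by nlinarith)
  constructor
  · intro x
    simp only [inputState]
    split_ifs
    exacts [hn, hm, Nat.zero_le _]
  · intro a i
    simp only [inputState]
    split_ifs <;> omega

/-- The graph on the natural numbers with the same edges as `G`. -/
def natGraph (G : SimpleGraph (Fin n)) : SimpleGraph ℕ := G.map Fin.valEmbedding

theorem natGraph_adj {u w : ℕ} :
    (natGraph G).Adj u w ↔ ∃ a b : Fin n, G.Adj a b ∧ (a : ℕ) = u ∧ (b : ℕ) = w :=
  SimpleGraph.map_adj Fin.valEmbedding G u w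

theorem natGraph_adj_val {a b : Fin n} : (natGraph G).Adj a b ↔ G.Adj a b := by
  rw [natGraph_adj]
  constructor
  · rintro ⟨a', b', h, ha, hb⟩
    rwa [← Fin.ext ha, ← Fin.ext hb]
  · exact fun h => ⟨a, b, h, rfl, rfl⟩

theorem inducedPath_natGraph {a b c : Fin n} :
    InducedPath (natGraph G) a b c ↔ InducedPath G a b c := by
  simp only [InducedPath, natGraph_adj_val, ne_eq, Fin.val_inj]

theorem hits_natGraph_iff {T : Finset ℕ} :
    Hits (natGraph G) T ↔ ∀ a b c : Fin n, InducedPath G a b c →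
      (a : ℕ) ∈ T ∨ (b : ℕ) ∈ T ∨ (c : ℕ) ∈ T := by
  constructor
  · exact fun h a b c hp => h a b c (inducedPath_natGraph.2 hp)
  · intro h a b c hp
    obtain ⟨a, b, -, rfl, rfl⟩ := natGraph_adj.1 hp.1
    obtain ⟨_, c, -, -, rfl⟩ := natGraph_adj.1 hp.2.1
    exact h a b c (inducedPath_natGraph.1 hp)

theorem hits_map_iff {T : Finset (Fin n)} :
    Hits (natGraph G) (T.map Fin.valEmbedding) ↔ IsClusterVertexDeletion G T := by
  rw [hits_natGraph_iff, isClusterVertexDeletion_iff]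
  simp [Fin.val_inj]

/-- Elements of `T` that are not vertices of `G` are discarded. -/
theorem cvdNumber_le_of_hits {T : Finset ℕ} (hT : Hits (natGraph G) T) : cvdNumber G ≤ T.card := by
  have h : IsClusterVertexDeletion G (Finset.univ.filter fun v : Fin n => (v : ℕ) ∈ T) := by
    rw [isClusterVertexDeletion_iff]
    simpa using hits_natGraph_iff.1 hT
  exact (cvdNumber_le G h).trans (Finset.card_le_card_of_injOn (fun v : Fin n => (v : ℕ))
    (fun v hv => by simpa using hv) (fun a _ b _ h => Fin.ext h))

/-- One end of each edge is enough. This crude bound limits the number of packing rounds. -/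
theorem exists_hits_card_le (he : IsEdgeListing G e) :
    ∃ T, Hits (natGraph G) T ∧ T.card ≤ m := by
  refine ⟨Finset.univ.image fun i : Fin m => ((e i).1 : ℕ), ?_, ?_⟩
  · rw [hits_natGraph_iff]
    rintro a b c ⟨hab, -⟩
    obtain ⟨i, hi | hi⟩ := (he.adj_iff a b).1 hab
    · exact .inl (Finset.mem_image.2 ⟨i, Finset.mem_univ i, by rw [hi]⟩)
    · exact .inr (.inl (Finset.mem_image.2 ⟨i, Finset.mem_univ i, by rw [hi]⟩))
  · exact Finset.card_image_le.trans (by simp)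

/-- Even and odd cells hold the two orientations of an edge. They differ because there are no loops,
and different edges differ as unordered pairs. -/
theorem buildArcs_arcListing (he : IsEdgeListing G e) :
    (buildArcs.run (inputState e)).reg 4 = 2 * m ∧
      ArcListing (natGraph G) (2 * m) ((buildArcs.run (inputState e)).mem 4)
        ((buildArcs.run (inputState e)).mem 5) := by
  obtain ⟨h4, h⟩ := buildArcs_spec (inputState e) rfl
  have hr1 : (inputState e).reg 1 = m := rfl
  rw [hr1] at h4 h
  set f := buildArcs.run (inputState e)
  replace h : ∀ i : Fin m, f.mem 4 (2 * i) = (e i).1 ∧ f.mem 5 (2 * i) = (e i).2 ∧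
      f.mem 4 (2 * i + 1) = (e i).2 ∧ f.mem 5 (2 * i + 1) = (e i).1 := by
    intro i
    have := h i i.2
    rwa [(inputState_mem e i).1, (inputState_mem e i).2] at this
  have hodd : ∀ d < 2 * m, ∃ i : Fin m, d = 2 * i ∨ d = 2 * i + 1 := fun d hd =>
    ⟨⟨d / 2, by omega⟩, by simp only; omega⟩
  have hne : ∀ i : Fin m, (e i).1 ≠ (e i).2 := fun i =>
    ((he.adj_iff _ _).2 ⟨i, .inl rfl⟩ : G.Adj (e i).1 (e i).2).ne
  refine ⟨h4, ⟨fun u w => ?_, fun d hd d' hd' h1 h2 => ?_⟩⟩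
  · rw [natGraph_adj]
    constructor
    · rintro ⟨a, b, hab, rfl, rfl⟩
      obtain ⟨i, hi | hi⟩ := (he.adj_iff a b).1 hab
      · exact ⟨2 * i, by omega, by rw [(h i).1, hi], by rw [(h i).2.1, hi]⟩
      · exact ⟨2 * i + 1, by omega, by rw [(h i).2.2.1, hi], by rw [(h i).2.2.2, hi]⟩
    · rintro ⟨d, hd, rfl, rfl⟩
      obtain ⟨i, rfl | rfl⟩ := hodd d hd
      · exact ⟨_, _, (he.adj_iff _ _).2 ⟨i, .inl rfl⟩, (h i).1.symm, (h i).2.1.symm⟩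
      · exact ⟨_, _, (he.adj_iff _ _).2 ⟨i, .inr rfl⟩, (h i).2.2.1.symm, (h i).2.2.2.symm⟩
  · obtain ⟨i, rfl | rfl⟩ := hodd d hd <;> obtain ⟨i', rfl | rfl⟩ := hodd d' hd'
    · rw [(h i).1, (h i').1, Fin.val_inj] at h1
      rw [(h i).2.1, (h i').2.1, Fin.val_inj] at h2
      rw [he.1 (a₁ := i) (a₂ := i') (by simp only [h1, h2])]
    · rw [(h i).1, (h i').2.2.1, Fin.val_inj] at h1
      rw [(h i).2.1, (h i').2.2.2, Fin.val_inj] at h2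
      have := he.1 (a₁ := i) (a₂ := i') (by simp only [h1, h2, Sym2.eq_swap])
      subst this
      exact absurd h1 (hne i)
    · rw [(h i).2.2.1, (h i').1, Fin.val_inj] at h1
      rw [(h i).2.2.2, (h i').2.1, Fin.val_inj] at h2
      have := he.1 (a₁ := i) (a₂ := i') (by simp only [h1, h2, Sym2.eq_swap])
      subst this
      exact absurd h2 (hne i)
    · rw [(h i).2.2.1, (h i').2.2.1, Fin.val_inj] at h1
      rw [(h i).2.2.2, (h i').2.2.2, Fin.val_inj] at h2
      rw [he.1 (a₁ := i) (a₂ := i') (by simp only [h1, h2])]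

end Input

/-! ### Size of the kernel in terms of k -/

section Arithmetic

/-- For k ≥ 1 one has s + 1 ≤ 4k, hence p ≤ 195 k^3 and one plus the degree term is at most 28 k^2.
The product of the constants is 5460. For k = 0 everything vanishes. -/
theorem kernel_size_le {k s p q : ℕ} (hs : s ≤ 3 * k)
    (hp : p ≤ s + s * ((2 * s + 2) * (2 * (s + 1)))) (hq : q ≤ p * (s + s * (2 * (s + 1)))) :
    p + q ≤ 6000 * k ^ 5 := by
  rcases Nat.eq_zero_or_pos k with rfl | hk
  · have : s = 0 := by omega
    subst this
    simp_all
  · have h1 : s + 1 ≤ 4 * k := by omega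
    have h2 : (2 * s + 2) * (2 * (s + 1)) ≤ 8 * k * (8 * k) := Nat.mul_le_mul (by omega) (by omega)
    have h3 : p ≤ 3 * k + 3 * k * (8 * k * (8 * k)) :=
      hp.trans (Nat.add_le_add hs (Nat.mul_le_mul hs h2))
    have h4 : s + s * (2 * (s + 1)) ≤ 3 * k + 3 * k * (8 * k) :=
      Nat.add_le_add hs (Nat.mul_le_mul hs (by omega))
    have h5 : k ≤ k ^ 2 := Nat.le_self_pow (by norm_num) k
    have h6 : k ≤ k ^ 3 := Nat.le_self_pow (by norm_num) k
    have h7 : 1 ≤ k ^ 2 := Nat.one_le_pow _ _ hk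
    have h8 : p ≤ 195 * k ^ 3 := by
      have : 3 * k * (8 * k * (8 * k)) = 192 * k ^ 3 := by ring
      omega
    have h9 : 1 + (s + s * (2 * (s + 1))) ≤ 28 * k ^ 2 := by
      have : 3 * k * (8 * k) = 24 * k ^ 2 := by ring
      omega
    calc p + q ≤ p * (1 + (s + s * (2 * (s + 1)))) := by rw [Nat.mul_add, mul_one]; omega
      _ ≤ 195 * k ^ 3 * (28 * k ^ 2) := Nat.mul_le_mul h8 h9
      _ = 5460 * k ^ 5 := by ring
      _ ≤ 6000 * k ^ 5 := Nat.mul_le_mul_right _ (by norm_num)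

end Arithmetic

/-! ### The complete algorithm: running time and correctness -/

section Kernelization

/-- The kernelization algorithm. -/
def kernelization : Prog := buildArcs ;; modulatorPhase ;; markPhase ;; outputPass

theorem kernelization_wf : kernelization.wf := by
  simp [kernelization, buildArcs, modulatorPhase, packingRound, resetPass, signaturePass,
    detectPass, neighbourPass, privatePass, addVertex, markPhase, limitPass, markRound, selectPass,
    markPass, markStep, outputPass, outputStep, wf, wreg]

theorem packingRound_cost (M : ℕ) : packingRound.cost (fun _ => M) ≤ 200 * (M + 1) := by
  simp only [packingRound, resetPass, signaturePass, detectPass, neighbourPass, privatePass,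
    addVertex, cost]
  omega

theorem buildArcs_time (s : State) : buildArcs.time s ≤ 20 * s.reg 1 + 10 := by
  have h := time_le_cost buildArcs s s.reg (fun _ _ => rfl) (by decide)
  simp only [buildArcs, cost] at h ⊢
  omega

theorem outputPass_time (s : State) : outputPass.time s ≤ 50 * s.reg 1 + 10 := by
  have h := time_le_cost (forLt 8 1 outputStep) (s.setReg 29 0) (s.setReg 29 0).reg
    (fun _ _ => rfl) (by decide)
  change 1 + ((forLt 8 1 outputStep).time (s.setReg 29 0) + (1 + 1)) ≤ _
  simp only [outputStep, cost, State.reg_setReg, Nat.reduceEqDiff, if_false] at h ⊢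
  omega

theorem markPhase_time (s : State) (h27 : s.reg 27 = 0) :
    markPhase.time s ≤ s.reg 5 * (200 * (s.reg 4 + 1)) + 20 := by
  have h1 := time_le_cost (forLt 8 6 (inc 27 ;; inc 27)) (s.setReg 6 (s.reg 5))
    (s.setReg 6 (s.reg 5)).reg (fun _ _ => rfl) (by decide)
  have h2 := time_le_cost (forLt 28 6 markRound) (limitPass.run s) (limitPass.run s).reg
    (fun _ _ => rfl) (by decide)
  have h4 : (limitPass.run s).reg 4 = s.reg 4 := run_reg _ _ _ (by decide)
  change (1 + ((forLt 8 6 (inc 27 ;; inc 27)).time (s.setReg 6 (s.reg 5)) + (2 + 2))) +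
    (forLt 28 6 markRound).time (limitPass.run s) ≤ _
  simp only [markRound, selectPass, markPass, markStep, addVertex, cost, State.reg_setReg, if_true,
    h4, (limitPass_spec s h27).1] at h1 h2 ⊢
  have h5 : s.reg 5 * (200 * (s.reg 4 + 1)) =
      200 * (s.reg 5 * s.reg 4) + 200 * s.reg 5 := by ring
  ring_nf at h1 h2 h5 ⊢
  omega

theorem kernelization_time_arith {m s k t₁ t₂ t₃ t₄ K : ℕ} (hs : s ≤ 3 * k)
    (h1 : t₁ ≤ 20 * m + 10) (hK : K ≤ 200 * (2 * m + 1))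
    (h2 : t₂ ≤ (s + 1) * (K + 6) + 6 * (m + 1) + 5) (h3 : t₃ ≤ s * (200 * (2 * m + 1)) + 20)
    (h4 : t₄ ≤ 50 * m + 10) : t₁ + (t₂ + (t₃ + t₄)) ≤ 4000 * ((k + 1) * (m + 1)) := by
  have e2 : (s + 1) * (K + 6) ≤ (3 * (k + 1)) * (406 * (m + 1)) :=
    Nat.mul_le_mul (by omega) (by omega)
  have e3 : s * (200 * (2 * m + 1)) ≤ (3 * (k + 1)) * (400 * (m + 1)) :=
    Nat.mul_le_mul (by omega) (by omega)
  have e5 : (3 * (k + 1)) * (406 * (m + 1)) = 1218 * ((k + 1) * (m + 1)) := by ring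
  have e6 : (3 * (k + 1)) * (400 * (m + 1)) = 1200 * ((k + 1) * (m + 1)) := by ring
  have e7 : m + 1 ≤ (k + 1) * (m + 1) := Nat.le_mul_of_pos_left _ (by omega)
  omega

variable {n m : ℕ} {G : SimpleGraph (Fin n)} {e : Fin m → Fin n × Fin n}

theorem IsVertexList.le_of_natGraph {names pos : ℕ → ℕ} {p : ℕ}
    (h : IsVertexList (natGraph G) names pos p) {i : ℕ} (hi : i < p) : names i < n := by
  obtain ⟨z, hz⟩ := h.exists_adj (names i) (by rw [h.pos_names i hi]; omega)
  obtain ⟨a, b, -, ha, -⟩ := natGraph_adj.1 hz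
  omega

/-- The map that numbers the vertices of the kernel. -/
def IsVertexList.embedding {names pos : ℕ → ℕ} {p : ℕ}
    (h : IsVertexList (natGraph G) names pos p) : Fin p ↪ Fin n where
  toFun i := ⟨names i, h.le_of_natGraph i.2⟩
  inj' i j hij := Fin.ext (h.injOn i.2 j.2 (Fin.mk.inj_iff.1 hij))

/-- As `rep` names cliques outside `S`, the set `S` meets all induced paths. So k ≤ |S|, and every
solution of the subgraph of size at most k is small enough for `hits_of_represented`. -/
theorem isKernel_of_markInvariant {S : Finset ℕ} {rep names : ℕ → ℕ} {s : State}
    (hI : MarkInvariant (natGraph G) S rep names S.card s)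
    (hS : ∀ v ∈ S, ∃ i < S.card, names i = v)
    (hclique : ∀ w w', w ∉ S → w' ∉ S → (∃ z, (natGraph G).Adj w z) →
      (∃ z, (natGraph G).Adj w' z) → (rep w = rep w' ↔ w = w' ∨ (natGraph G).Adj w w')) :
    IsKernel G (G.comap hI.isList.embedding) (SimpleGraph.Embedding.comap hI.isList.embedding G) ∅ := by
  set φ := hI.isList.embedding with hφ
  have hSh : Hits (natGraph G) S := by
    intro a b c hp
    by_contra! hn
    have hab := (hclique a b hn.1 hn.2.1 ⟨b, hp.1⟩ ⟨a, hp.1.symm⟩).2 (.inr hp.1)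
    have hbc := (hclique b c hn.2.1 hn.2.2 ⟨a, hp.1.symm⟩ ⟨b, hp.2.1.symm⟩).2 (.inr hp.2.1)
    rcases (hclique a c hn.1 hn.2.2 ⟨b, hp.1⟩ ⟨b, hp.2.1.symm⟩).1 (hab.trans hbc) with h | h
    exacts [hp.2.2.1 h, hp.2.2.2 h]
  refine isKernel_of_solutions_extend _ fun T hT hTk => ?_
  rw [← hits_map_iff]
  refine hits_of_represented (S := S) (r := rep) (M := {w | s.mem 7 w ≠ 0})
    (fun v hv => ((hI.mem_iff v).1 hv).1) (fun v hv => hI.isList.exists_adj v hv) hclique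
    (fun v hv => ?_) ?_ ?_
  · obtain ⟨i, hi, rfl⟩ := hS v hv
    exact hI.represented i hi
  · rw [Finset.card_map, Finset.card_map]
    exact hTk.trans (cvdNumber_le_of_hits hSh)
  · have key : ∀ a ∈ {w | s.mem 7 w ≠ 0}, ∃ i : Fin (s.reg 5), a = (φ i : ℕ) := by
      intro a ha
      obtain ⟨h1, h2⟩ := hI.isList.names_pos a ha
      have ha' : s.mem 7 a ≠ 0 := ha
      exact ⟨⟨s.mem 7 a - 1, by omega⟩, h2.symm⟩
    intro a b c ha hb hc hp
    obtain ⟨i, rfl⟩ := key a ha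
    obtain ⟨j, rfl⟩ := key b hb
    obtain ⟨l, rfl⟩ := key c hc
    obtain ⟨h1, h2, h3, h4⟩ := inducedPath_natGraph.1 hp
    have := (isClusterVertexDeletion_iff _ _).1 hT i j l
      ⟨h1, h2, fun h => h3 (congrArg φ h), h4⟩
    have hmem : ∀ i, i ∈ T → (φ i : ℕ) ∈ (T.map
        (SimpleGraph.Embedding.comap φ G).toEmbedding).map Fin.valEmbedding := fun i hi =>
      Finset.mem_map.2 ⟨φ i, Finset.mem_map.2 ⟨i, hi, rfl⟩, rfl⟩
    exact this.imp (hmem i) (Or.imp (hmem j) (hmem l))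

/-- Beyond the first |S| positions, edges stay within one clique, and `clique_le` bounds the number
of marks there. -/
theorem kernel_edges_le {S : Finset ℕ} {rep names : ℕ → ℕ} {s : State}
    (hI : MarkInvariant (natGraph G) S rep names S.card s)
    (hclique : ∀ w w', w ∉ S → w' ∉ S → (∃ z, (natGraph G).Adj w z) →
      (∃ z, (natGraph G).Adj w' z) → (rep w = rep w' ↔ w = w' ∨ (natGraph G).Adj w w')) :
    (G.comap hI.isList.embedding).edgeSet.ncard ≤
      s.reg 5 * (S.card + S.card * (2 * (S.card + 1))) := by
  refine ncard_edgeSet_le _ _ _ (fun i => rep (s.mem 2 i)) (fun i j hi hj hA => ?_) fun c => ?_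
  · have hA' : (natGraph G).Adj (s.mem 2 i) (s.mem 2 j) :=
      natGraph_adj_val.2 (SimpleGraph.comap_adj.1 hA)
    have hnot : ∀ i : Fin (s.reg 5), S.card ≤ i → s.mem 2 i ∉ S := by
      intro i hi h
      have := ((hI.mem_iff _).1 h).2
      rw [hI.isList.pos_names i i.2] at this
      omega
    exact (hclique _ _ (hnot i hi) (hnot j hj) ⟨_, hA'⟩ ⟨_, hA'.symm⟩).2 (.inr hA')
  · refine le_trans ?_ (hI.clique_le c)
    refine Finset.card_le_card_of_injOn (fun i : Fin (s.reg 5) => (i : ℕ)) (fun i hi => ?_)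
      (fun a _ b _ h => Fin.ext h)
    simpa [positions] using hi

theorem kernelization_spec (he : IsEdgeListing G e) :
    kernelization.time (inputState e) ≤ 4000 * ((cvdNumber G + 1) * (m + 1)) ∧
    ∃ (p q r : ℕ) (H : SimpleGraph (Fin p)) (f : Fin q → Fin p × Fin p) (φ : H ↪g G)
      (x : Fin r ↪ Fin n), IsEdgeListing H f ∧
      IsOutput (kernelization.run (inputState e)) f φ x ∧
      IsKernel G H φ (Finset.univ.map x) ∧
      p + H.edgeSet.ncard ≤ 6000 * cvdNumber G ^ 5 := by
  set s0 := inputState e with hs0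
  obtain ⟨a4, aA⟩ := buildArcs_arcListing he
  rw [← hs0] at a4 aA
  set s1 := buildArcs.run s0 with hs1
  have R1 : ∀ r, r ∉ buildArcs.wreg → s1.reg r = s0.reg r := fun r hr => run_reg _ _ _ hr
  have M1 : ∀ a, a ∉ buildArcs.wmem → s1.mem a = s0.mem a := fun r hr => run_mem _ _ _ hr
  obtain ⟨T, hT, hTm⟩ := exists_hits_card_le he
  obtain ⟨b1, b2, b3, b4⟩ := modulatorPhase_spec s1 (R1 3 (by decide)) (R1 24 (by decide))
    (R1 5 (by decide)) ((M1 7 (by decide)).trans (inputState_mem_of_two_le e (by decide)))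
    (by rw [a4]; exact aA) hT (by rw [R1 1 (by decide)]; exact hTm)
  rw [R1 1 (by decide), a4] at b4
  set s2 := modulatorPhase.run s1 with hs2
  have R2 : ∀ r, r ∉ modulatorPhase.wreg → s2.reg r = s1.reg r := fun r hr => run_reg _ _ _ hr
  have M2 : ∀ a, a ∉ modulatorPhase.wmem → s2.mem a = s1.mem a := fun r hr => run_mem _ _ _ hr
  have c4 : s2.reg 4 = 2 * m := (R2 4 (by decide)).trans a4
  have c27 : s2.reg 27 = 0 := (R2 27 (by decide)).trans (R1 27 (by decide))
  have hzero : ∀ a, 2 ≤ a → a ∉ modulatorPhase.wmem → a ∉ buildArcs.wmem →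
      s2.mem a = fun _ => 0 := fun a h1 h2 h3 =>
    (M2 a h2).trans ((M1 a h3).trans (inputState_mem_of_two_le e h1))
  set S := (Finset.range (s2.reg 5)).image (s2.mem 2) with hS
  obtain ⟨hcard, hI⟩ := markPhase_spec s2 ((R2 3 (by decide)).trans (R1 3 (by decide))) c27
    (hzero 11 (by decide) (by decide) (by decide)) (hzero 12 (by decide) (by decide) (by decide))
    (by rw [c4, M2 4 (by decide), M2 5 (by decide)]; exact aA) b1 hS
  have htime3 := markPhase_time s2 c27
  set s3 := markPhase.run s2 with hs3
  have R3 : ∀ r, r ∉ markPhase.wreg → s3.reg r = s2.reg r := fun r hr => run_reg _ _ _ hr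
  have M3 : ∀ a, a ∉ markPhase.wmem → s3.mem a = s2.mem a := fun r hr => run_mem _ _ _ hr
  have d1 : s3.reg 1 = m := (R3 1 (by decide)).trans ((R2 1 (by decide)).trans (R1 1 (by decide)))
  have d3 : s3.reg 3 = 0 := (R3 3 (by decide)).trans ((R2 3 (by decide)).trans (R1 3 (by decide)))
  have dm0 : s3.mem 0 = s0.mem 0 :=
    (M3 0 (by decide)).trans ((M2 0 (by decide)).trans (M1 0 (by decide)))
  have dm1 : s3.mem 1 = s0.mem 1 :=
    (M3 1 (by decide)).trans ((M2 1 (by decide)).trans (M1 1 (by decide)))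
  obtain ⟨o0, g, hg, hginj, hgsurj⟩ := outputPass_spec s3 d3
  have htime4 := outputPass_time s3
  rw [d1] at hg hgsurj htime4
  rw [dm0, dm1] at hg hgsurj
  have hrun : kernelization.run s0 = outputPass.run s3 := rfl
  have htime : kernelization.time s0 = buildArcs.time s0 + (modulatorPhase.time s1 +
    (markPhase.time s2 + outputPass.time s3)) := rfl
  have e2 : (outputPass.run s3).mem 2 = s3.mem 2 := run_mem _ _ _ (by decide)
  have e3 : (outputPass.run s3).reg 2 = 0 := by
    rw [run_reg _ _ _ (by decide), R3 2 (by decide), R2 2 (by decide), R1 2 (by decide)]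
    rfl
  rw [hrun]
  set s4 := outputPass.run s3
  set s := s2.reg 5 with hs
  obtain ⟨T₀, hT₀, hT₀k⟩ := exists_card_eq_cvdNumber G
  have hsk : s ≤ 3 * cvdNumber G := by
    have := b2.le b1 (hits_map_iff.2 hT₀)
    rwa [Finset.card_map, hT₀k] at this
  have hSiff : ∀ w, w ∉ S ↔ s2.mem 7 w = 0 := by
    intro w
    rw [hS, Finset.mem_image, not_iff_comm]
    constructor
    · intro h
      obtain ⟨h1, h2⟩ := b1.names_pos w h
      exact ⟨_, Finset.mem_range.2 (by omega), h2⟩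
    · rintro ⟨i, hi, rfl⟩
      rw [b1.pos_names i (Finset.mem_range.1 hi)]
      omega
  have hclique : ∀ w w', w ∉ S → w' ∉ S → (∃ z, (natGraph G).Adj w z) →
      (∃ z, (natGraph G).Adj w' z) →
      (s2.mem 8 w = s2.mem 8 w' ↔ w = w' ∨ (natGraph G).Adj w w') := fun w w' hw hw' =>
    b3 w w' ((hSiff w).1 hw) ((hSiff w').1 hw')
  rw [← hcard] at hI
  refine ⟨?_, ?_⟩
  · rw [htime]
    refine kernelization_time_arith hsk (buildArcs_time s0) (packingRound_cost (2 * m)) b4 ?_ htime4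
    rw [← c4]; exact htime3
  · set φ := hI.isList.embedding with hφ
    have hpos : ∀ l : Fin (s4.reg 1), ∃ i : Fin m, g l = i ∧
        s3.mem 7 (e i).1 ≠ 0 ∧ s3.mem 7 (e i).2 ≠ 0 ∧ s4.mem 0 l = s3.mem 7 (e i).1 - 1 ∧
        s4.mem 1 l = s3.mem 7 (e i).2 - 1 := by
      intro l
      obtain ⟨h1, h2, h3, h4, h5⟩ := hg l l.2
      have h6 := inputState_mem e ⟨g l, h1⟩
      rw [← hs0] at h6
      rw [h6.1] at h2 h4
      rw [h6.2] at h3 h5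
      exact ⟨⟨g l, h1⟩, rfl, h2, h3, h4, h5⟩
    choose i hi1 hi2 hi3 hi4 hi5 using hpos
    have hlt : ∀ v : Fin n, s3.mem 7 v ≠ 0 → s3.mem 7 v - 1 < s3.reg 5 := fun v hv => by
      have := (hI.isList.names_pos v hv).1
      omega
    have hφ' : ∀ (v : Fin n) (hv : s3.mem 7 v ≠ 0), φ ⟨s3.mem 7 v - 1, hlt v hv⟩ = v :=
      fun v hv => Fin.ext (hI.isList.names_pos v hv).2
    have hφpos : ∀ j, s3.mem 7 (φ j) ≠ 0 := fun j => by
      have : s3.mem 7 (φ j) = j + 1 := hI.isList.pos_names j j.2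
      omega
    let f : Fin (s4.reg 1) → Fin (s3.reg 5) × Fin (s3.reg 5) := fun l =>
      (⟨_, hlt _ (hi2 l)⟩, ⟨_, hlt _ (hi3 l)⟩)
    have hf : ∀ l, Sym2.map φ s((f l).1, (f l).2) = s((e (i l)).1, (e (i l)).2) := fun l => by
      rw [Sym2.map_mk, hφ' _ (hi2 l), hφ' _ (hi3 l)]
    -- The list of forced vertices is empty, and register 2, never written, is still zero.
    refine ⟨s3.reg 5, s4.reg 1, 0, G.comap φ, f, SimpleGraph.Embedding.comap φ G,
      ⟨Fin.elim0, fun a => a.elim0⟩, ⟨?_, ?_⟩, ?_, ?_, ?_⟩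
    · intro l l' h
      have h1 := congrArg (Sym2.map φ) h
      simp only [hf] at h1
      have h2 := he.1 h1
      exact Fin.ext (hginj l l.2 l' l'.2 (by rw [hi1, hi1, h2]))
    · ext z
      induction z using Sym2.ind with
      | _ a b =>
        rw [SimpleGraph.mem_edgeSet, SimpleGraph.comap_adj, ← SimpleGraph.mem_edgeSet, ← he.2]
        constructor
        · rintro ⟨l, hl⟩
          refine ⟨i l, ?_⟩
          simp only at hl ⊢
          rw [← hf, hl, Sym2.map_mk]
        · rintro ⟨i', hi'⟩
          simp only at hi'
          have hne : s3.mem 7 (e i').1 ≠ 0 ∧ s3.mem 7 (e i').2 ≠ 0 := by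
            rcases Sym2.eq_iff.1 hi' with ⟨h1, h2⟩ | ⟨h1, h2⟩ <;> rw [h1, h2] <;>
            exact ⟨hφpos _, hφpos _⟩
          have h6 := inputState_mem e i'
          rw [← hs0] at h6
          obtain ⟨l, hl, hgl⟩ := hgsurj i' i'.2 (by rw [h6.1]; exact hne.1)
            (by rw [h6.2]; exact hne.2)
          refine ⟨⟨l, hl⟩, Sym2.map.injective φ.injective ?_⟩
          have hii : i ⟨l, hl⟩ = i' := Fin.ext ((hi1 ⟨l, hl⟩).symm.trans hgl)
          simp only
          rw [hf, hii, hi', Sym2.map_mk]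
    · exact ⟨o0, rfl, fun l => ⟨hi4 l, hi5 l⟩, fun j => by rw [e2]; rfl, e3, fun i => i.elim0⟩
    · have := isKernel_of_markInvariant hI (fun v hv => by
        obtain ⟨i, hi, rfl⟩ := Finset.mem_image.1 hv
        exact ⟨i, by rw [hcard]; exact Finset.mem_range.1 hi, rfl⟩) hclique
      simpa using this
    · refine kernel_size_le (s := S.card) (by rw [hcard]; exact hsk) hI.size_le ?_
      exact kernel_edges_le hI hclique

end Kernelization

end CVD

theorem mainTheorem3 :
    ∃ (P : CVD.Cmd) (C : ℕ), ∀ (n m : ℕ) (G : SimpleGraph (Fin n)) (e : Fin m → Fin n × Fin n),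
      CVD.IsEdgeListing G e →
      ∃ (t : ℕ) (s : CVD.State),
        CVD.Exec ((n + 2) ^ C) P (CVD.inputState e) t s ∧
        t ≤ C * (CVD.cvdNumber G + 1) ^ 8 * (G.edgeSet.ncard + 1) * Nat.log 2 (n + 2) ∧
        ∃ (p q r : ℕ) (H : SimpleGraph (Fin p)) (f : Fin q → Fin p × Fin p) (φ : H ↪g G)
          (x : Fin r ↪ Fin n),
          CVD.IsEdgeListing H f ∧
          CVD.IsOutput s f φ x ∧
          CVD.IsKernel G H φ (Finset.univ.map x) ∧
          p + H.edgeSet.ncard ≤ C * CVD.cvdNumber G ^ 5 := by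
  -- The one constant serves three purposes: the kernel size needs 6000, the time 4000 and the word
  -- length the exponent 15. Only `6000 ≤ C` is used.
  obtain ⟨C, hC⟩ : ∃ C : ℕ, 6000 ≤ C := ⟨6000, le_rfl⟩
  refine ⟨CVD.kernelization.compile, C, fun n m G e he => ?_⟩
  obtain ⟨htime, p, q, r, H, f, φ, x, h1, h2, h3, h4⟩ := CVD.kernelization_spec he
  set t := CVD.kernelization.time (CVD.inputState e)
  have hk : CVD.cvdNumber G ≤ n := by
    simpa using CVD.cvdNumber_le G (S := Finset.univ)
      ((CVD.isClusterVertexDeletion_iff _ _).2 (by simp))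
  have hm : m + 1 ≤ (n + 2) ^ 2 := Nat.succ_le_of_lt (he.le_sq.trans_lt (by nlinarith))
  -- The input is bounded by (n+2)^2 and numbers grow by at most one per step on balance. Since k ≤
  -- n and m + 1 ≤ (n+2)^2, the sum is at most 4001 (n+2)^3, and 4001 ≤ 2^12.
  have hword : (n + 2) ^ 2 + t ≤ (n + 2) ^ C := by
    have e1 : (CVD.cvdNumber G + 1) * (m + 1) ≤ (n + 2) * (n + 2) ^ 2 :=
      Nat.mul_le_mul (by omega) hm
    have e2 : (n + 2) ^ 2 ≤ (n + 2) * (n + 2) ^ 2 := Nat.le_mul_of_pos_left _ (by omega)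
    calc (n + 2) ^ 2 + t ≤ 2 ^ 12 * ((n + 2) * (n + 2) ^ 2) := by omega
      _ ≤ (n + 2) ^ 12 * ((n + 2) * (n + 2) ^ 2) :=
          Nat.mul_le_mul_right _ (Nat.pow_le_pow_left (by omega) 12)
      _ = (n + 2) ^ 15 := by ring
      _ ≤ (n + 2) ^ C := Nat.pow_le_pow_right (by omega) (by omega)
  refine ⟨t, _, (CVD.Prog.exec _ CVD.kernelization_wf (CVD.inputState_bounded he) hword).1, ?_,
    p, q, r, H, f, φ, x, h1, h2, h3, h4.trans (Nat.mul_le_mul_right _ hC)⟩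
  have hlog : 1 ≤ Nat.log 2 (n + 2) := Nat.log_pos (by norm_num) (by omega)
  rw [he.ncard_eq]
  -- The proved time is linear in k+1 and has no logarithm; the remaining factors of the claimed
  -- bound are slack.
  calc t ≤ 4000 * ((CVD.cvdNumber G + 1) * (m + 1)) := htime
    _ ≤ C * ((CVD.cvdNumber G + 1) ^ 8 * (m + 1)) :=
        Nat.mul_le_mul (by omega) (Nat.mul_le_mul_right _ (Nat.le_self_pow (by norm_num) _))
    _ = C * (CVD.cvdNumber G + 1) ^ 8 * (m + 1) := (mul_assoc _ _ _).symm
    _ ≤ _ := Nat.le_mul_of_pos_right _ hlog
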